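/- **Conventions.** $\kappa$ is a strongly inaccessible (in particular uncountable) cardinal and $\lambda<\kappa$ an infinite regular cardinal; $\beth_0=\aleph_0$, and $\beth_\alpha$ is also regarded as an initial ordinal. For a set $X$ of ordinals put $\operatorname{psup}X=\sup\{\alpha+1:\alpha\in X\}$. Products and sums of ordinals are ordinal operations. For functions, $\subseteq$ is inclusion of graphs. **The equivalence relation.** $\phi$ is a first order sentence in the vocabulary $\{\in,R_0,R_1,R_2,R_3\}$ ($R_0$ unary, $R_1,R_2,R_3$ binary), $P\subseteq V_\kappa$, and $$s\sim t\iff (V_\kappa,\in,P,s,t,r)\models\phi\ \text{ for some } r\in{}^\kappa2$$ is an equivalence relation on ${}^\kappa2$ (a $\Sigma^1_1$-equivalence relation; $P,s,t,r$ interpret $R_0,R_1,R_2,R_3$). $\phi$ is normalized as follows, for all $s,t,r,r'\in{}^\kappa2$: 1. $(V_\kappa,P,s,t,r)\models\phi\iff(V_\kappa,P,t,s,r)\models\phi$; 2. if $s(\beth_\alpha)=t(\beth_\alpha)$ for all $\alpha<\kappa$, then $s\sim t$; 3. if $r(\beth_\alpha)=r'(\beth_\alpha)$ for all $\alpha<\kappa$,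 then $(V_\kappa,P,s,t,r)\models\phi\iff(V_\kappa,P,s,t,r')\models\phi$. **The tree $T$.** $T_0=\{\emptyset\}$; for $0<\alpha<\kappa$, $T_\alpha$ is the set of all $u=(\eta,\nu,\tau,C)$ with $\eta,\nu,\tau\in{}^{\beth_\alpha}2$, $\eta\ne\nu$, and $C$ a closed subset of $\alpha$. $T=\bigcup_{\alpha<\kappa}T_\alpha$. For $u\in T_\alpha$ write $o(u)=\alpha$, $u=(u^1,u^2,u^3,C_u)$ (with $C_\emptyset=\emptyset$), $u^{-1}=(u^2,u^1,u^3,C_u)$, $u\restriction\beta=(u^1\restriction\beth_\beta,u^2\restriction\beth_\beta,u^3\restriction\beth_\beta,C_u\cap\beta)$ for $\beta>0$, and $u\restriction0=\emptyset$. Put $u\lhd v$ iff $u=v\restriction o(u)$ and $o(u)\in C_v$. $T^<$ is the set of $u\in T\setminus\{\emptyset\}$ such that $u^1$ is lexicographically smaller than $u^2$. For $s,t,r\in{}^\kappa2$ let $C_{str}$ be the set consisting of $0$ and all $\delta<\kappa$ with $(V_\delta,P\cap V_\delta,s\restriction\delta,t\restriction\delta,r\restriction\delta)\prec(V_\kappa,P,s,t,r)\models\phi$.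 $T_H$ is the set of $u\in T$ such that for some $s,t,r\in{}^\kappa2$: $u^1\subseteq s$, $u^2\subseteq t$, $u^3\subseteq r$, $o(u)\in C_{str}$ and $C_u=C_{str}\cap o(u)$. Let $G=\{\beta+1<\kappa:\beta\text{ a successor ordinal}\}$ and fix a surjection $\pi:\{0\}\cup G\to\{\emptyset\}\cup T^<$ such that $\pi(0)=\emptyset$, $o(\pi(\alpha))<\alpha$ for $\alpha\in G$, and $\pi$ takes every value unboundedly often on $G$. $T_G$ is the smallest subset of $T$ that contains $\emptyset$, is closed under $u\mapsto u^{-1}$, and contains every $u\in T^<$ such that: if $\sup C_u<o(u)$, then $o(u)\in G$, $C_u$ has a maximum $\gamma$, and $\pi(o(u))=u\restriction\gamma\in T_H\cup T_G$; and if $\sup C_u=o(u)$, then $C_u\cap G\neq\emptyset$, $\operatorname{cf}(o(u))<\lambda$, and $u\restriction\beta\in T_H\cup T_G$ for all $\beta\in C_u$. Call a function $\eta$ into $2$ whose domain is some $\beth_\alpha$ $(\alpha<\kappa)$ or $\kappa$ *steady* if it is $0$ on $\beth_0$ and constant on the part of every interval $[\beth_\beta,\beth_{\beta+1})$ in its domain.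 $U$ consists of $\emptyset$ and of all $u\in T_H\cup T_G$ with $u^1,u^2,u^3$ steady; $U_H=U\cap T_H$, $U_G=U\cap T_G$. An element $u\in U$ is a *successor of* $v\in U$ if $v\lhd u$ and there is no $w\in U$ with $v\lhd w\lhd u$. **The functions $p_u$ ($u\in U$).** Fix well-orderings of the levels $\{u\in U:o(u)=\alpha\}$, $\alpha<\kappa$; let $\prec$ be the well-ordering of $U$ by $o(u)$ first and then by these. Fix for each $\beta<\kappa$ an enumeration $(w^\beta_\gamma)_{\gamma<\theta_\beta}$, $\theta_\beta\le\beth_{\beta+1}$, of $T_\beta$ without repetition. Let $E^\beta_\gamma(\xi)=\beth_\beta\cdot(\gamma+1)+\xi$ for $\xi<\beth_\beta$. For injections $p,e$ let $p\uplus e=p\cup\{(\xi,\zeta)\in e:\xi\notin\operatorname{dom}p,\ \zeta\notin\operatorname{ran}p\}$. Let $\mathrm{Id}_u$ be the identity function on $\{\xi<\beth_{o(u)}:u^1\restriction(\xi+1)=u^2\restriction(\xi+1)\}$. Then: * $p_\emptyset=\emptyset$. * Let $u\in T^<$ be a successor of $v$. If $u\in U_G$, let $\beta$ be given by $o(u)=\beta+1$.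 If $u\in U_H$, let $\beta=\beta'_v$, where, by induction along $\prec$, $\beta'_w$ ($w\in U$) is the least limit ordinal not in $\operatorname{dom}(\mathrm{Id}_u)\cup(o(w)+1)\cup\{\beta'_{w'}:w'\prec w\}$. Put $e=E^\beta_\gamma$ where $w^\beta_\gamma=u\restriction\beta$ ($e=\emptyset$ if $u\restriction\beta\notin T_\beta$). Then $p_u=\mathrm{Id}_u\uplus(p_v\uplus e)$ if $\operatorname{ran}p_v$ is an ordinal, and $p_u=\mathrm{Id}_u\uplus(p_v\uplus e^{-1})$ otherwise. * If $u\in T^<$ is not a successor of any $v\in U$, then $p_u=\bigcup\{p_v:v\in U,\ v\lhd u\}$. * If $u\notin T^<$, then $p_u=(p_{u^{-1}})^{-1}$. **Minimal sequences.** Consider $u_0,\dots,u_{n-1}\in U\setminus\{\emptyset\}$, $n\ge1$, and a nonempty set $W_0$ of ordinals such that $W_i\subseteq\operatorname{dom}p_{u_i}$ for $i<n$, where $W_{i+1}=p_{u_i}[W_i]$, and $u_i^2$, $u_{i+1}^1$ agree below $\operatorname{psup}W_{i+1}$ for $i+1<n$. Let $f_i=p_{u_i}\restriction W_i$, $\mathrm{Beg}(f_i)=u_i^1\restriction\operatorname{psup}(\operatorname{dom}f_i)$,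 $\mathrm{End}(f_i)=u_i^2\restriction\operatorname{psup}(\operatorname{ran}f_i)$. The sequence $(f_0,\dots,f_{n-1})$ is *minimal* if (i) $\operatorname{dom}f_i\not\subseteq\operatorname{dom}p_v$ whenever $i<n$, $v\in U$, $v\lhd u_i$; and (ii) there are no $i\le j<n$ such that $f_j\circ\dots\circ f_i$ is an identity function and $\mathrm{Beg}(f_i)=\mathrm{End}(f_j)$. It *leads from $\eta$ to $\nu$* ($\eta,\nu\in{}^\kappa2$) if $\mathrm{Beg}(f_0)\subseteq\eta$ and $\mathrm{End}(f_{n-1})\subseteq\nu$. **The models.** The vocabulary has one $\theta$-ary relation symbol $R_a$ for each $\theta<\kappa$ and each sequence $a=(a_i)_{i<\theta}$ of distinct ordinals below $\kappa$ with $\operatorname{psup}\{a_i\}<\kappa$. For $\eta\in{}^\kappa2$, $R_a^\eta$ is the set consisting of $a$ itself, if $\eta$ vanishes below $\operatorname{psup}\{a_i\}$, and of all sequences $(f(a_i))_{i<\theta}$ where $f=f_{n-1}\circ\dots\circ f_0$ for some minimal sequence $(f_0,\dots,f_{n-1})$ leading from the zero function to $\eta$ with $\operatorname{dom}f=\{a_i:i<\theta\}$.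 For $t\in{}^\kappa2$ let $\bar t\in{}^\kappa2$ be the steady function with $\bar t(\beth_\beta)=t(\beth_\beta)$ for all $\beta<\kappa$ (so $\bar t=t$ if $t$ is steady, and always $\bar t\sim t$). $M_t$ is the structure with universe $\kappa$ in which $R_a$ is interpreted by $R_a^{\bar t}$. **Claim.** For all $\kappa,\lambda,\phi,P$ as above, all choices of $\pi$, of the well-orderings and of the enumerations, and all $s,t\in{}^\kappa2$: $$s\sim t\iff M_s\cong M_t .$$ -/

import Mathlib

universe u

noncomputable section

namespace SigmaModels

open Set
open scoped Cardinal

/-! ### Ordinals -/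

/-- The cardinal `ℶ_α` (with `ℶ_0 = ℵ₀`) as an initial ordinal. -/
def bethOrd (α : Ordinal.{u}) : Ordinal.{u} := (ℶ_ α).ord

/-- The proper supremum `sup {α + 1 | α ∈ X}` of a bounded set of ordinals. -/
def psup (X : Set Ordinal.{u}) : Ordinal.{u} := sSup (Order.succ '' X)

/-- `C` is a closed subset of the ordinal `α`. -/
def ClosedIn (C : Set Ordinal.{u}) (α : Ordinal.{u}) : Prop :=
  (∀ ξ ∈ C, ξ < α) ∧ ∀ S ⊆ C, S.Nonempty → sSup S < α → sSup S ∈ C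

/-! ### The vocabulary `{∈, R₀, R₁, R₂, R₃}` and the structures on the sets `V_δ` -/

/-- The relation symbols: `∈`, one unary symbol and three binary symbols. -/
inductive VocRel : ℕ → Type
  | mem : VocRel 2
  | R0 : VocRel 1
  | R1 : VocRel 2
  | R2 : VocRel 2
  | R3 : VocRel 2

/-- The vocabulary `{∈, R₀, R₁, R₂, R₃}`. -/
def voc : FirstOrder.Language.{0, 0} := ⟨fun _ => Empty, VocRel⟩

/-- The set of all functions from `κ` into `2`. -/
abbrev Fun2 (κ : Cardinal.{u}) : Type (u + 1) := Set.Iio κ.ord → Fin 2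

/-- Extension of `s : κ → 2` by the value `0` to all ordinals. -/
def ext {κ : Cardinal.{u}} (s : Fun2 κ) (ξ : Ordinal.{u}) : Fin 2 :=
  if h : ξ < κ.ord then s ⟨ξ, h⟩ else 0

/-- The function `s : κ → 2` as a binary relation between sets. -/
def graphRel {κ : Cardinal.{u}} (s : Fun2 κ) (x y : ZFSet.{u}) : Prop :=
  ∃ ξ : Set.Iio κ.ord, x = ξ.1.toZFSet ∧ y = (((s ξ : ℕ) : Ordinal.{u})).toZFSet

/-- The members of the level `V_δ` of the cumulative hierarchy. -/
abbrev VSet (δ : Ordinal.{u}) : Type (u + 1) := {x : ZFSet.{u} // x ∈ ZFSet.vonNeumann δ}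

/-- The structure `(V_δ, ∈, P ∩ V_δ, s ↾ δ, t ↾ δ, r ↾ δ)`. -/
@[reducible] def str {κ : Cardinal.{u}} (P : Set ZFSet.{u}) (s t r : Fun2 κ) (δ : Ordinal.{u}) :
    voc.Structure (VSet δ) where
  funMap := fun f _ => Empty.elim f
  RelMap := fun {n} (R : VocRel n) v =>
    match n, R, v with
    | _, .mem, v => (v 0).1 ∈ (v 1).1
    | _, .R0, v => (v 0).1 ∈ P
    | _, .R1, v => graphRel s (v 0).1 (v 1).1
    | _, .R2, v => graphRel t (v 0).1 (v 1).1
    | _, .R3, v => graphRel r (v 0).1 (v 1).1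

/-- `(V_κ, ∈, P, s, t, r) ⊨ φ`. -/
def Sat {κ : Cardinal.{u}} (φ : voc.Sentence) (P : Set ZFSet.{u}) (s t r : Fun2 κ) : Prop :=
  @FirstOrder.Language.Sentence.Realize voc (VSet κ.ord) (str P s t r κ.ord) φ

/-- `(V_δ, ∈, P ∩ V_δ, s ↾ δ, t ↾ δ, r ↾ δ)` is an elementary substructure of
`(V_κ, ∈, P, s, t, r)`. -/
def ElemSub {κ : Cardinal.{u}} (P : Set ZFSet.{u}) (s t r : Fun2 κ) (δ : Ordinal.{u}) : Prop :=
  ∃ h : δ ≤ κ.ord, ∀ (n : ℕ) (ψ : voc.Formula (Fin n)) (v : Fin n → VSet δ),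
    @FirstOrder.Language.Formula.Realize voc (VSet κ.ord) (str P s t r κ.ord) (Fin n) ψ
      (fun i => ⟨(v i).1, ZFSet.vonNeumann_subset_of_le h (v i).2⟩) ↔
    @FirstOrder.Language.Formula.Realize voc (VSet δ) (str P s t r δ) (Fin n) ψ v

/-! ### The tree `T` -/

/-- Tuples `(η, ν, τ, C)` of height `ord`. A function from `ℶ_ord` into `2` is represented by its
extension by `0` to all ordinals. -/
structure Node : Type (u + 1) where
  ord : Ordinal.{u}
  fst : Ordinal.{u} → Fin 2
  snd : Ordinal.{u} → Fin 2
  trd : Ordinal.{u} → Fin 2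
  cub : Set Ordinal.{u}

/-- The empty tuple, the root of the tree. -/
def Node.root : Node.{u} := ⟨0, fun _ => 0, fun _ => 0, fun _ => 0, ∅⟩

/-- Exchange of the first two components. -/
def Node.inv (x : Node.{u}) : Node.{u} := ⟨x.ord, x.snd, x.fst, x.trd, x.cub⟩

/-- `η ↾ θ`, again extended by `0`. -/
def cut (θ : Ordinal.{u}) (η : Ordinal.{u} → Fin 2) : Ordinal.{u} → Fin 2 :=
  fun ξ => if ξ < θ then η ξ else 0

/-- The restriction `x ↾ β`. -/
def Node.res (x : Node.{u}) (β : Ordinal.{u}) : Node.{u} :=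
  if β = 0 then Node.root
  else ⟨β, cut (bethOrd β) x.fst, cut (bethOrd β) x.snd, cut (bethOrd β) x.trd,
    x.cub ∩ Set.Iio β⟩

/-- The tree order: `x = y ↾ ord x` and `ord x` belongs to the closed set of `y`. -/
def Node.Below (x y : Node.{u}) : Prop := x = y.res x.ord ∧ x.ord ∈ y.cub

/-- The level `T_α`. -/
def TLevel (α : Ordinal.{u}) : Set Node.{u} :=
  {x | (α = 0 ∧ x = Node.root) ∨
    (α ≠ 0 ∧ x.ord = α ∧
      (∀ ξ, bethOrd α ≤ ξ → x.fst ξ = 0 ∧ x.snd ξ = 0 ∧ x.trd ξ = 0) ∧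
      x.fst ≠ x.snd ∧ ClosedIn x.cub α)}

/-- The tree `T`, the union of its levels below `κ`. -/
def T (κ : Cardinal.{u}) : Set Node.{u} := {x | ∃ α < κ.ord, x ∈ TLevel α}

/-- The elements of `T` whose first component is lexicographically smaller than the second. -/
def TLex (κ : Cardinal.{u}) : Set Node.{u} :=
  {x | x ∈ T κ ∧ ∃ ξ < bethOrd x.ord, x.fst ξ < x.snd ξ ∧ ∀ ζ < ξ, x.fst ζ = x.snd ζ}

/-- The ordinals `β + 1 < κ` with `β` a successor ordinal. -/
def GInds (κ : Cardinal.{u}) : Set Ordinal.{u} :=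
  {α | α < κ.ord ∧ ∃ γ : Ordinal.{u}, α = Order.succ (Order.succ γ)}

/-- The functions on `ℶ_α` that vanish on `ℶ_0` and are constant on every `[ℶ_β, ℶ_{β+1})`. -/
def UFun (α : Ordinal.{u}) (η : Ordinal.{u} → Fin 2) : Prop :=
  (∀ ξ < bethOrd 0, η ξ = 0) ∧
    ∀ β < α, ∀ ξ, bethOrd β ≤ ξ → ξ < bethOrd (Order.succ β) → η ξ = η (bethOrd β)

/-! ### Partial functions between ordinals, as sets of pairs -/

/-- Sets of pairs of ordinals. -/
abbrev Gr : Type (u + 1) := Set (Ordinal.{u} × Ordinal.{u})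

/-- Domain. -/
def dom (g : Gr.{u}) : Set Ordinal.{u} := {ξ | ∃ ζ, (ξ, ζ) ∈ g}

/-- Range. -/
def ran (g : Gr.{u}) : Set Ordinal.{u} := {ζ | ∃ ξ, (ξ, ζ) ∈ g}

/-- Inverse. -/
def gInv (g : Gr.{u}) : Gr.{u} := {x | (x.2, x.1) ∈ g}

/-- Restriction of the domain. -/
def gRes (g : Gr.{u}) (W : Set Ordinal.{u}) : Gr.{u} := {x | x ∈ g ∧ x.1 ∈ W}

/-- Image of a set. -/
def gImage (g : Gr.{u}) (W : Set Ordinal.{u}) : Set Ordinal.{u} := {ζ | ∃ ξ ∈ W, (ξ, ζ) ∈ g}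

/-- `p ⊎ e`: extend the injection `p` by those pairs of the injection `e` whose first coordinate
is not in the domain and whose second coordinate is not in the range of `p`. -/
def fUnion (p e : Gr.{u}) : Gr.{u} := p ∪ {x | x ∈ e ∧ x.1 ∉ dom p ∧ x.2 ∉ ran p}

/-- A set of ordinals is an ordinal. -/
def IsOrd (X : Set Ordinal.{u}) : Prop := ∃ α : Ordinal.{u}, X = Set.Iio α

/-- The function `ξ ↦ ℶ_β · (γ + 1) + ξ` with domain `ℶ_β`. -/
def shift (β γ : Ordinal.{u}) : Gr.{u} :=
  {x | x.1 < bethOrd β ∧ x.2 = bethOrd β * (γ + 1) + x.1}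

/-- The partial function with domain `θ` which agrees there with `η`. -/
def restr (η : Ordinal.{u} → Fin 2) (θ : Ordinal.{u}) : Set (Ordinal.{u} × Fin 2) :=
  {x | x.1 < θ ∧ x.2 = η x.1}

/-- The graph of `s : κ → 2`. -/
def graph {κ : Cardinal.{u}} (s : Fun2 κ) : Set (Ordinal.{u} × Fin 2) := restr (ext s) κ.ord

/-! ### The data of the construction -/

/-- The objects which are fixed for the construction: the cardinals `κ` and `lam`, the sentence
`φ` with its parameter `P`, the bookkeeping function `bk`, the relations `wo α` ordering the
levels of the tree `U`, and enumerations `enum β` of the levels `T_β`, of length `len β`. -/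
structure Data : Type (u + 1) where
  κ : Cardinal.{u}
  lam : Cardinal.{u}
  φ : voc.Sentence
  P : Set ZFSet.{u}
  bk : Ordinal.{u} → Node.{u}
  wo : Ordinal.{u} → Node.{u} → Node.{u} → Prop
  enum : Ordinal.{u} → Ordinal.{u} → Node.{u}
  len : Ordinal.{u} → Ordinal.{u}

namespace Data

variable (D : Data.{u})

/-- The relation on `κ → 2` which `φ` defines with the parameter `P`:
`s ∼ t` iff `(V_κ, ∈, P, s, t, r) ⊨ φ` for some `r : κ → 2`. -/
def Equiv (s t : Fun2 D.κ) : Prop := ∃ r : Fun2 D.κ, Sat D.φ D.P s t r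

/-- `φ` defines a `Σ¹₁` equivalence relation with the parameter `P ⊆ V_κ`. -/
def DefinesEquivalence : Prop :=
  (∀ x ∈ D.P, x ∈ ZFSet.vonNeumann D.κ.ord) ∧ Equivalence D.Equiv

/-- `φ` is symmetric in `R₁` and `R₂`. -/
def Symmetric : Prop := ∀ s t r : Fun2 D.κ, Sat D.φ D.P s t r ↔ Sat D.φ D.P t s r

/-- Functions which agree at all the points `ℶ_α` are equivalent. -/
def BethInvariant : Prop :=
  ∀ s t : Fun2 D.κ, (∀ α < D.κ.ord, ext s (bethOrd α) = ext t (bethOrd α)) → D.Equiv s t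

/-- Also the truth of `φ` depends only on the values of the witness `r` at the points `ℶ_α`. -/
def WitnessBethInvariant : Prop :=
  ∀ s t r r' : Fun2 D.κ, (∀ α < D.κ.ord, ext r (bethOrd α) = ext r' (bethOrd α)) →
    (Sat D.φ D.P s t r ↔ Sat D.φ D.P s t r')

/-- `bk` is a surjection of `{0} ∪ GInds` onto the root and the elements of `TLex` such that the
value at `α` has height below `α` (only the root being taken at `0`), and every value is taken
unboundedly often in `κ`. -/
def IsBookkeeping : Prop :=
  (∀ α ∈ insert 0 (GInds D.κ), D.bk α ∈ insert Node.root (TLex D.κ)) ∧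
  (∀ x ∈ insert Node.root (TLex D.κ), ∃ α ∈ insert 0 (GInds D.κ), D.bk α = x) ∧
  (∀ α ∈ insert 0 (GInds D.κ), (α = 0 ∧ D.bk α = Node.root) ∨ (D.bk α).ord < α) ∧
  (∀ x ∈ insert Node.root (TLex D.κ), ∀ γ < D.κ.ord, ∃ α ∈ GInds D.κ, γ < α ∧ D.bk α = x)

/-- The closed set `C_{str}`: `0` and all `δ < κ` with
`(V_δ, P ∩ V_δ, s ↾ δ, t ↾ δ, r ↾ δ) ≺ (V_κ, P, s, t, r) ⊨ φ`. -/
def club (s t r : Fun2 D.κ) : Set Ordinal.{u} :=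
  {0} ∪ {δ | δ < D.κ.ord ∧ ElemSub D.P s t r δ ∧ Sat D.φ D.P s t r}

/-- The elements of `T` coming from elementary substructures. -/
def TH : Set Node.{u} :=
  {x | x ∈ T D.κ ∧ ∃ s t r : Fun2 D.κ,
    (∀ ξ < bethOrd x.ord, x.fst ξ = ext s ξ ∧ x.snd ξ = ext t ξ ∧ x.trd ξ = ext r ξ) ∧
    x.ord ∈ D.club s t r ∧ x.cub = D.club s t r ∩ Set.Iio x.ord}

/-- The closure conditions whose smallest solution is `TG`. -/
def TGClosed (S : Set Node.{u}) : Prop :=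
  S ⊆ T D.κ ∧ Node.root ∈ S ∧ (∀ x ∈ S, x.inv ∈ S) ∧
  ∀ x ∈ TLex D.κ,
    (sSup x.cub < x.ord → x.ord ∈ GInds D.κ ∧
      ∃ γ, IsGreatest x.cub γ ∧ D.bk x.ord = x.res γ ∧ x.res γ ∈ D.TH ∪ S) →
    (sSup x.cub = x.ord → (x.cub ∩ GInds D.κ).Nonempty ∧ x.ord.cof < D.lam ∧
      ∀ β ∈ x.cub, x.res β ∈ D.TH ∪ S) →
    x ∈ S

/-- The smallest set with the closure conditions above. -/
def TG : Set Node.{u} := ⋂₀ {S | D.TGClosed S}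

/-- The restricted tree `U`. -/
def U : Set Node.{u} :=
  {x | x ∈ D.TH ∪ D.TG ∧
    (x = Node.root ∨ (UFun x.ord x.fst ∧ UFun x.ord x.snd ∧ UFun x.ord x.trd))}

/-- `U` intersected with `TH`. -/
def UH : Set Node.{u} := D.TH ∩ D.U

/-- `U` intersected with `TG`. -/
def UG : Set Node.{u} := D.TG ∩ D.U

/-- `x` is a successor of `y` in the tree `U`. -/
def SuccOf (x y : Node.{u}) : Prop :=
  x ∈ D.U ∧ y ∈ D.U ∧ y.Below x ∧ ¬ ∃ z ∈ D.U, y.Below z ∧ z.Below x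

/-- `wo α` well-orders the level `U_α`, for every `α < κ`. -/
def IsLevelOrder : Prop :=
  ∀ α < D.κ.ord, IsWellOrder {x : Node.{u} // x ∈ D.U ∧ x.ord = α} (fun x y => D.wo α x.1 y.1)

/-- `enum β` enumerates `T_β` without repetition in length `len β ≤ ℶ_{β+1}`. -/
def IsEnumeration : Prop :=
  ∀ β < D.κ.ord, D.len β ≤ bethOrd (Order.succ β) ∧
    Set.BijOn (D.enum β) (Set.Iio (D.len β)) (TLevel β)

/-- The well-ordering of `U`: first by height, then by `wo`. -/
def Prec (x y : Node.{u}) : Prop :=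
  x.ord < y.ord ∨ (x.ord = y.ord ∧ D.wo x.ord x y)

/-! ### The functions `p_x` -/

/-- The identity function on the part of `ℶ_{ord x}` up to which the first two components of `x`
agree. -/
def idPart (x : Node.{u}) : Gr.{u} :=
  {y | y.1 = y.2 ∧ y.1 < bethOrd x.ord ∧ ∀ ζ ≤ y.1, x.fst ζ = x.snd ζ}

/-- `b w`, for `w ∈ U`, is defined by induction along the well-ordering of `U` as the least limit
ordinal below `κ` outside `dom (idPart x) ∪ (ord w + 1) ∪ {b w' | w' precedes w}`. -/
def IsReflection (x : Node.{u}) (b : Node.{u} → Ordinal.{u}) : Prop :=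
  ∀ w ∈ D.U, IsLeast {β | β < D.κ.ord ∧ Order.IsSuccLimit β ∧ β ∉ dom (idPart x) ∧ w.ord < β ∧
    ∀ w' ∈ D.U, D.Prec w' w → b w' ≠ β} (b w)

/-- `β` is the ordinal fixed for the successor `x` of `y` in the definition of `p_x`. -/
def ReflectsAt (x y : Node.{u}) (β : Ordinal.{u}) : Prop :=
  (x ∈ D.UH ∧ ∃ b, D.IsReflection x b ∧ b y = β) ∨ (x ∈ D.UG ∧ x.ord = Order.succ β)

/-- The shift function with parameters `β` and `γ`, where `x ↾ β` is the `γ`th element of the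
enumeration of `T_β`. -/
def codeShift (x : Node.{u}) (β : Ordinal.{u}) : Gr.{u} :=
  {y | ∃ γ < D.len β, D.enum β γ = x.res β ∧ y ∈ shift β γ}

open Classical in
/-- `p_x` for a successor `x` of `y`, where `q = p_y` and `β` is the ordinal fixed for `x`. -/
def succStep (x : Node.{u}) (q : Gr.{u}) (β : Ordinal.{u}) : Gr.{u} :=
  fUnion (idPart x)
    (fUnion q (if IsOrd (ran q) then D.codeShift x β else gInv (D.codeShift x β)))

/-- `p_x` for `x` the root or `x ∈ U ∩ TLex`, by recursion on the height: `∅` at the root,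
`succStep` at successors, unions at limits. -/
def pLex (x : Node.{u}) : Gr.{u} :=
  {z | (∃ y, ∃ _h : y.ord < x.ord, D.SuccOf x y ∧
          ∃ β, D.ReflectsAt x y β ∧ z ∈ D.succStep x (pLex y) β) ∨
       ((¬ ∃ y, D.SuccOf x y) ∧
          ∃ y, ∃ _h : y.ord < x.ord, y ∈ D.U ∧ y.Below x ∧ z ∈ pLex y)}
termination_by x.ord

open Classical in
/-- The function `p_x` for `x ∈ U`; outside `TLex` it is the inverse of `p_{x.inv}`. -/
def p (x : Node.{u}) : Gr.{u} := if x ∈ TLex D.κ then D.pLex x else gInv (D.pLex x.inv)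

/-! ### Sequences of functions. A sequence of length `n` is given by its values below `n`. -/

/-- The sets `W_0 = W`, `W_{i+1} = p_{x_i}[W_i]`. -/
def track (x : ℕ → Node.{u}) (W : Set Ordinal.{u}) : ℕ → Set Ordinal.{u}
  | 0 => W
  | i + 1 => gImage (D.p (x i)) (track x W i)

/-- The functions `f_i = p_{x_i} ↾ W_i`. -/
def comp (x : ℕ → Node.{u}) (W : Set Ordinal.{u}) (i : ℕ) : Gr.{u} :=
  gRes (D.p (x i)) (D.track x W i)

/-- The composition `f_{i+k} ∘ ⋯ ∘ f_i` of `k + 1` consecutive functions. -/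
def compose (x : ℕ → Node.{u}) (W : Set Ordinal.{u}) (i : ℕ) : ℕ → Gr.{u}
  | 0 => D.comp x W i
  | k + 1 => {z | ∃ ζ, (z.1, ζ) ∈ compose x W i k ∧ (ζ, z.2) ∈ D.comp x W (i + k + 1)}

/-- `Beg f_i`: the restriction of the first component of `x_i` to the proper supremum of the
domain of `f_i`. -/
def beg (x : ℕ → Node.{u}) (W : Set Ordinal.{u}) (i : ℕ) : Set (Ordinal.{u} × Fin 2) :=
  restr (x i).fst (psup (dom (D.comp x W i)))

/-- `End f_i`: the restriction of the second component of `x_i` to the proper supremum of the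
range of `f_i`. -/
def fin (x : ℕ → Node.{u}) (W : Set Ordinal.{u}) (i : ℕ) : Set (Ordinal.{u} × Fin 2) :=
  restr (x i).snd (psup (ran (D.comp x W i)))

/-- `(x_0, …, x_{n-1})` and `W` determine a composable sequence of functions. -/
def IsSeq (n : ℕ) (x : ℕ → Node.{u}) (W : Set Ordinal.{u}) : Prop :=
  0 < n ∧ W.Nonempty ∧ (∀ i < n, x i ∈ D.U ∧ x i ≠ Node.root) ∧
  (∀ i < n, D.track x W i ⊆ dom (D.p (x i))) ∧
  ∀ i, i + 1 < n → restr (x i).snd (psup (D.track x W (i + 1))) =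
    restr (x (i + 1)).fst (psup (D.track x W (i + 1)))

/-- The sequence of functions is minimal. -/
def IsMinimal (n : ℕ) (x : ℕ → Node.{u}) (W : Set Ordinal.{u}) : Prop :=
  (∀ i < n, ∀ y ∈ D.U, y.Below (x i) → ¬ dom (D.comp x W i) ⊆ dom (D.p y)) ∧
  ¬ ∃ i k, i + k < n ∧ (∀ z ∈ D.compose x W i k, z.1 = z.2) ∧
    D.beg x W i = D.fin x W (i + k)

/-- The minimal sequence given by `n`, `x`, `W` leads from `η` to `ν`. -/
def Leads (η ν : Fun2 D.κ) (n : ℕ) (x : ℕ → Node.{u}) (W : Set Ordinal.{u}) : Prop :=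
  D.IsSeq n x W ∧ D.IsMinimal n x W ∧
    D.beg x W 0 ⊆ graph η ∧ D.fin x W (n - 1) ⊆ graph ν

end Data

/-! ### Relational structures with relations of arbitrary arity -/

/-- A structure with universe `M` for a vocabulary of relation symbols `Sym`, where the symbol `R`
has arity `ar R`. -/
structure RelStr {Sym : Type*} (ar : Sym → Type*) (M : Type*) where
  rel : (R : Sym) → Set (ar R → M)

/-- Isomorphism of structures of a common vocabulary. -/
def RelStr.Isomorphic {Sym : Type*} {ar : Sym → Type*} {M N : Type*}
    (A : RelStr ar M) (B : RelStr ar N) : Prop :=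
  ∃ h : M ≃ N, ∀ (R : Sym) (b : ar R → M), b ∈ A.rel R ↔ h ∘ b ∈ B.rel R

/-- Bounded sequences without repetition of ordinals below `κ`, of length `len < κ`. -/
structure BSeq (κ : Cardinal.{u}) : Type (u + 1) where
  len : Ordinal.{u}
  len_lt : len < κ.ord
  seq : Set.Iio len → Set.Iio κ.ord
  inj : Function.Injective seq
  bdd : psup (Set.range fun i => (seq i).1) < κ.ord

/-- The arity of the relation symbol `R_a` is the length of `a`. -/
def BSeq.arity {κ : Cardinal.{u}} (a : BSeq κ) : Type (u + 1) := Set.Iio a.len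

/-- The set of the entries of `a`. -/
def BSeq.entries {κ : Cardinal.{u}} (a : BSeq κ) : Set Ordinal.{u} :=
  Set.range fun i => (a.seq i).1

/-- The function which vanishes on `ℶ_0` and has on each `[ℶ_β, ℶ_{β+1})` the constant value
`s (ℶ_β)`. -/
def steady {κ : Cardinal.{u}} (s : Fun2 κ) : Fun2 κ := fun ξ =>
  if ξ.1 < bethOrd 0 then 0 else ext s (sSup {x | x ≤ ξ.1 ∧ ∃ β : Ordinal.{u}, x = bethOrd β})

namespace Data

variable (D : Data.{u})

/-- The relation interpreting `R_a` for the index `η`: it contains `a` itself if `η` vanishes below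
the proper supremum of `a`, and the image `f(a)` for the composition `f`, with domain the set of
entries of `a`, of any minimal sequence leading from the zero function to `η`. -/
def relOf (η : Fun2 D.κ) (a : BSeq D.κ) : Set (a.arity → Set.Iio D.κ.ord) :=
  {b | ((∀ ξ < psup a.entries, ext η ξ = 0) ∧ b = a.seq) ∨
    ∃ (n : ℕ) (x : ℕ → Node.{u}), D.Leads (fun _ => 0) η n x a.entries ∧
      ∀ i : Set.Iio a.len, ((a.seq i).1, (b i).1) ∈ D.compose x a.entries 0 (n - 1)}

/-- The structure with universe `κ` and the relations `relOf η a`. -/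
def modelOf (η : Fun2 D.κ) : RelStr (BSeq.arity (κ := D.κ)) (Set.Iio D.κ.ord) where
  rel := fun a => D.relOf η a

/-- The model `M_t`, for `t : κ → 2`. Only functions which vanish on `ℶ_0` and are constant on the
intervals `[ℶ_β, ℶ_{β+1})` occur in the tree `U`; `t` is represented by the one of these which
agrees with it at all the points `ℶ_β`. -/
def model (t : Fun2 D.κ) : RelStr (BSeq.arity (κ := D.κ)) (Set.Iio D.κ.ord) :=
  D.modelOf (steady t)

end Data

end SigmaModels

end

/-!
The proof analyses the partial injections `p_x`, `x ∈ U`, by means of *chains* of nodes (`Conn`).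
A chain from `(η, c)` to `(ν, d)` consists of nodes whose functions `p_x` successively map the
family `c` of ordinals to `d`, and whose first and second components fit together and lead from
`η` to `ν`, as far as the entries of the families reach. Chains can be composed and inverted, and
by cutting out superfluous parts every chain becomes empty or a minimal sequence. So `R_a` consists
of the families to which some chain leads from the zero function and `a` (`mem_relOf_iff`).

*Equivalent functions have isomorphic models* (`isomorphic_of_equiv`). Let `r` witness `s ∼ t`,
where `s` is lexicographically smaller than `t`. The set `C_{str}` is closed and unbounded in `κ`,
by the Löwenheim–Skolem theorem (`exists_elemSub`) and Tarski's theorem on elementary chains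
(`ElemSub.of_cofinal`). Hence `s`, `t`, `r` form a branch through `U_H`, and the functions `p_x`
for the nodes of the branch increase. At successors the new pairs are taken alternately from a
shift function and from the inverse of one, so that after two steps domain and range include any
given initial segment of `κ` (`subset_dom_ran_of_two_steps`). The union is a bijection of `κ`, and
it is an isomorphism, since the nodes of the branch are chains from `s` to `t`
(`isomorphic_of_lex`).

*Isomorphic models come from equivalent functions* (`equiv_of_isomorphic`). Elements of `T_G`
provide, for every `α < κ`, a chain from the zero function to `s` which reaches the sequence of
the ordinals below `α` (`exists_source`). An isomorphism therefore yields, for each `α`, a chain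
from `s` to `t` which maps the ordinals below `α` to their images. Since `κ` has uncountable
cofinality, there is a bound `n` such that for finite sets of ordinals there are chains of length
at most `n`. By induction on `n` this implies `s ∼ t` (`equiv_of_finite_chains`), as follows.

A shortest chain for a finite family may be assumed to be *tight*, no `p_w` with `w` below a node
being defined on the whole family to which this node is applied. Then each node of the chain
*ascends*, taking some entry of the family to a new value of a shift function, or descends, which
is the inverse (`Geo.head`). A new value determines the parameters of the shift function, and by
the choice of the ordinals `β'_w` and of the bookkeeping function these determine the function
`p_x`, the predecessor of `x`, and `x` below `ℶ_β` (`shift_decode`, `pred_unique`, `Up.unique`).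
So an ascending node is never followed by a descending one, and two shortest chains with the same
ends start with nodes of the same kind with the same parameters (`Geo.head_unique`). Consequently
the first nodes for larger and larger finite families cohere and form a branch of length `κ`. Its
initial parts belong to `T_H` and not to `T_G`, because the nodes of `T_G` are not continued
through limit points of cofinality `λ`. Hence the initial parts are elementary submodels of the
union of the branch, which shows that `s` is equivalent to the second component `t'` of the union
(`exists_sat_of_branch`). From `t'` chains that are one node shorter lead to `t`.
-/

noncomputable section

namespace SigmaModels

open Set
open scoped Cardinal

/-! ### Ordinals and beth numbers -/

theorem bethOrd_strictMono : StrictMono bethOrd.{u} :=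
  fun _ _ h => Cardinal.ord_strictMono (Cardinal.beth_strictMono h)

theorem bethOrd_lt {α β : Ordinal.{u}} : bethOrd α < bethOrd β ↔ α < β :=
  bethOrd_strictMono.lt_iff_lt

theorem bethOrd_le {α β : Ordinal.{u}} : bethOrd α ≤ bethOrd β ↔ α ≤ β :=
  bethOrd_strictMono.le_iff_le

theorem le_bethOrd (α : Ordinal.{u}) : α ≤ bethOrd α := bethOrd_strictMono.le_apply

theorem bethOrd_pos (α : Ordinal.{u}) : 0 < bethOrd α := by
  rw [bethOrd, Cardinal.lt_ord]
  simpa using Cardinal.beth_pos α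

theorem bethOrd_lt_ord {κ : Cardinal.{u}} (hκ : κ.IsInaccessible) {α : Ordinal.{u}}
    (h : α < κ.ord) : bethOrd α < κ.ord := by
  have := bethOrd_strictMono h
  rwa [bethOrd, bethOrd, hκ.beth_ord] at this

theorem isSuccLimit_ord_of_inaccessible {κ : Cardinal.{u}} (hκ : κ.IsInaccessible) :
    Order.IsSuccLimit κ.ord := Cardinal.isSuccLimit_ord hκ.aleph0_lt.le

/-- For `ξ` in the interval `[ℶ_β, ℶ_{β+1})` the supremum in the definition of `steady` is the left
end of the interval. -/
theorem sSup_bethOrd_le {β ξ : Ordinal.{u}} (h1 : bethOrd β ≤ ξ)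
    (h2 : ξ < bethOrd (Order.succ β)) :
    sSup {x | x ≤ ξ ∧ ∃ β : Ordinal.{u}, x = bethOrd β} = bethOrd β := by
  refine IsGreatest.csSup_eq ⟨⟨h1, β, rfl⟩, ?_⟩
  rintro _ ⟨hx, γ, rfl⟩
  have := bethOrd_lt.1 (hx.trans_lt h2)
  exact bethOrd_le.2 (Order.lt_succ_iff.1 this)

theorem lt_psup {X : Set Ordinal.{u}} (hX : BddAbove X) {ξ : Ordinal.{u}} :
    ξ < psup X ↔ ∃ α ∈ X, ξ ≤ α := by
  have hb : BddAbove (Order.succ '' X) := by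
    obtain ⟨b, hb⟩ := hX
    refine ⟨Order.succ b, ?_⟩
    rintro _ ⟨a, ha, rfl⟩
    exact Order.succ_le_succ (hb ha)
  rw [psup]
  rcases X.eq_empty_or_nonempty with rfl | hne
  · simp
  rw [lt_csSup_iff hb (hne.image _)]
  simp

theorem shift_lower {β γ ξ : Ordinal.{u}} :
    bethOrd β ≤ bethOrd β * (γ + 1) + ξ := by
  calc bethOrd β = bethOrd β * 1 := (mul_one _).symm
    _ ≤ bethOrd β * (γ + 1) := by gcongr; simp
    _ ≤ _ := le_self_add

theorem shift_upper {β γ ξ : Ordinal.{u}} (hγ : γ < bethOrd (Order.succ β))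
    (hξ : ξ < bethOrd β) :
    bethOrd β * (γ + 1) + ξ < bethOrd (Order.succ β) := by
  have hb : bethOrd β < bethOrd (Order.succ β) := bethOrd_lt.2 (Order.lt_succ β)
  have hl : Order.IsSuccLimit (bethOrd (Order.succ β)) :=
    Cardinal.isSuccLimit_ord (Cardinal.aleph0_le_beth _)
  refine Ordinal.isPrincipal_add_ord (Cardinal.aleph0_le_beth _)
    (Ordinal.isPrincipal_mul_ord (Cardinal.aleph0_le_beth _) hb ?_) (hξ.trans hb)
  exact hl.add_one_lt hγ

theorem beth_interval_unique {β β' ζ : Ordinal.{u}} (h1 : bethOrd β ≤ ζ)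
    (h2 : ζ < bethOrd (Order.succ β)) (h3 : bethOrd β' ≤ ζ) (h4 : ζ < bethOrd (Order.succ β')) :
    β = β' := by
  have a := Order.lt_succ_iff.1 (bethOrd_lt.1 (h1.trans_lt h4))
  have b := Order.lt_succ_iff.1 (bethOrd_lt.1 (h3.trans_lt h2))
  exact le_antisymm a b

/-- The parameters and the argument of a shift function can be recovered from its value. -/
theorem shift_decode {β γ ξ β' γ' ξ' : Ordinal.{u}}
    (hγ : γ < bethOrd (Order.succ β)) (hξ : ξ < bethOrd β)
    (hγ' : γ' < bethOrd (Order.succ β')) (hξ' : ξ' < bethOrd β')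
    (h : bethOrd β * (γ + 1) + ξ = bethOrd β' * (γ' + 1) + ξ') : β = β' ∧ γ = γ' ∧ ξ = ξ' := by
  obtain rfl : β = β' := by
    refine beth_interval_unique (ζ := bethOrd β * (γ + 1) + ξ) shift_lower
      (shift_upper hγ hξ) ?_ ?_
    · rw [h]; exact shift_lower
    · rw [h]; exact shift_upper hγ' hξ'
  refine ⟨rfl, ?_⟩
  have hd := congrArg (· / bethOrd β) h
  simp only [Ordinal.mul_add_div _ (bethOrd_pos β).ne', Ordinal.div_eq_zero_of_lt hξ,
    Ordinal.div_eq_zero_of_lt hξ', add_zero] at hd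
  have hγγ : γ = γ' := by simpa using hd
  subst hγγ
  exact ⟨rfl, by simpa using h⟩

/-- A set of fewer than `c` ordinals omits some limit ordinal between `θ` and `c`: there are `c`
limit ordinals of the form `ω · (θ + 1 + j + 1)` below `c`. -/
theorem exists_limit_not_mem {c : Cardinal.{u}} (hc : ℵ₀ < c) {θ : Ordinal.{u}}
    (hθ : θ < c.ord) {E : Set Ordinal.{u}} (hE : #E < Cardinal.lift.{u + 1} c) :
    ∃ β < c.ord, Order.IsSuccLimit β ∧ θ < β ∧ β ∉ E := by
  have hω : Ordinal.omega0 < c.ord := by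
    rw [← Cardinal.ord_aleph0]; exact Cardinal.ord_strictMono hc
  have hl : Order.IsSuccLimit c.ord := Cardinal.isSuccLimit_ord hc.le
  by_contra! hcon
  let f : Set.Iio c.ord → Ordinal.{u} := fun j => Ordinal.omega0 * (θ + 1 + j.1 + 1)
  have hf : ∀ j, f j ∈ E := by
    intro j
    have h1 : f j < c.ord := by
      refine Ordinal.isPrincipal_mul_ord hc.le hω (hl.add_one_lt ?_)
      exact Ordinal.isPrincipal_add_ord hc.le (hl.add_one_lt hθ) j.2
    refine hcon _ h1 ?_ ?_
    · exact Ordinal.isSuccLimit_mul_left Ordinal.isSuccLimit_omega0 (by simp)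
    · calc θ < θ + 1 := by simp
        _ ≤ θ + 1 + j.1 + 1 := by rw [add_assoc]; exact le_self_add
        _ ≤ f j := Ordinal.le_mul_right _ Ordinal.omega0_pos
  have hinj : Function.Injective f := by
    intro i j hij
    have : θ + 1 + i.1 + 1 = θ + 1 + j.1 + 1 :=
      mul_left_cancel₀ Ordinal.omega0_pos.ne' hij
    have : i.1 = j.1 := by simpa using this
    exact Subtype.ext this
  have := Cardinal.mk_le_of_injective (f := fun j => (⟨f j, hf j⟩ : E))
    (fun i j h => hinj (congrArg Subtype.val h))
  rw [Cardinal.mk_Iio_ordinal, Cardinal.card_ord] at this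
  exact absurd hE (not_lt.2 this)

/-- An injection of an initial ordinal into itself is unbounded. -/
theorem exists_le_of_injective {c : Cardinal.{u}} {f : Set.Iio c.ord → Ordinal.{u}}
    (hf : Function.Injective f) {θ : Ordinal.{u}} (hθ : θ < c.ord) : ∃ i, θ ≤ f i := by
  by_contra! h
  have := Cardinal.mk_le_of_injective (f := fun j => (⟨f j, h j⟩ : Set.Iio θ))
    (fun i j h => hf (congrArg Subtype.val h))
  rw [Cardinal.mk_Iio_ordinal, Cardinal.mk_Iio_ordinal, Cardinal.card_ord,
    Cardinal.lift_le] at this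
  exact absurd hθ (not_lt.2 (Cardinal.ord_le.2 this))

/-- Sets of fewer than `κ` ordinals below a regular `κ` are bounded below `κ`. -/
theorem exists_bound_of_mk_lt {κ : Cardinal.{u}} (hκ : κ.IsRegular) {ι : Type*}
    {f : ι → Ordinal.{u}} (hι : #(range f) < Cardinal.lift.{u + 1} κ) (hf : ∀ i, f i < κ.ord) :
    ∃ α < κ.ord, ∀ i, f i < α := by
  have hlim : Order.IsSuccLimit κ.ord := Cardinal.isSuccLimit_ord hκ.aleph0_le
  have hb : sSup (range f) < κ.ord := by
    refine Ordinal.sSup_lt_of_lt_cof ?_ (by rintro _ ⟨i, rfl⟩; exact hf i)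
    rwa [← Ordinal.lift_cof, hκ.cof_ord]
  refine ⟨_, hlim.add_one_lt hb, fun i => Order.lt_add_one_iff.2 (le_csSup ?_ ⟨i, rfl⟩)⟩
  exact ⟨κ.ord, by rintro _ ⟨i, rfl⟩; exact (hf i).le⟩

theorem exists_bound_of_finite {κ : Cardinal.{u}} (hκ : κ.IsRegular) {ι : Type*} [Finite ι]
    {f : ι → Ordinal.{u}} (hf : ∀ i, f i < κ.ord) : ∃ α < κ.ord, ∀ i, f i < α := by
  refine exists_bound_of_mk_lt hκ ?_ hf
  refine (Cardinal.lt_aleph0_of_finite _).trans_le ?_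
  rw [← Cardinal.lift_aleph0.{u + 1, u}, Cardinal.lift_le]
  exact hκ.aleph0_le

/-! ### Steady functions -/

section Steady

variable {κ : Cardinal.{u}}

theorem ext_of_lt (s : Fun2 κ) {ξ : Ordinal.{u}} (h : ξ < κ.ord) : ext s ξ = s ⟨ξ, h⟩ := by
  simp [ext, h]

theorem ext_of_le (s : Fun2 κ) {ξ : Ordinal.{u}} (h : κ.ord ≤ ξ) : ext s ξ = 0 := by
  simp [ext, not_lt.2 h]

theorem ext_injective : Function.Injective (ext (κ := κ)) := by
  intro s t h
  funext ξ
  rw [← ext_of_lt s ξ.2, h, ext_of_lt t ξ.2]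

theorem ext_steady_of_lt (s : Fun2 κ) {ξ : Ordinal.{u}} (h : ξ < bethOrd 0) :
    ext (steady s) ξ = 0 := by
  by_cases hξ : ξ < κ.ord
  · rw [ext_of_lt _ hξ, steady, if_pos h]
  · exact ext_of_le _ (not_lt.1 hξ)

theorem ext_steady (hκ : κ.IsInaccessible) (s : Fun2 κ) {β ξ : Ordinal.{u}} (hβ : β < κ.ord)
    (h1 : bethOrd β ≤ ξ) (h2 : ξ < bethOrd (Order.succ β)) :
    ext (steady s) ξ = ext s (bethOrd β) := by
  have hξ : ξ < κ.ord :=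
    h2.trans (bethOrd_lt_ord hκ ((isSuccLimit_ord_of_inaccessible hκ).succ_lt hβ))
  rw [ext_of_lt _ hξ, steady, if_neg, sSup_bethOrd_le h1 h2]
  exact not_lt.2 ((bethOrd_le.2 (zero_le)).trans h1)

theorem ext_steady_bethOrd (hκ : κ.IsInaccessible) (s : Fun2 κ) {β : Ordinal.{u}}
    (hβ : β < κ.ord) : ext (steady s) (bethOrd β) = ext s (bethOrd β) :=
  ext_steady hκ s hβ le_rfl (bethOrd_lt.2 (Order.lt_succ β))

theorem uFun_steady (hκ : κ.IsInaccessible) (s : Fun2 κ) {α : Ordinal.{u}} (hα : α < κ.ord) :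
    UFun α (cut (bethOrd α) (ext (steady s))) := by
  constructor
  · intro ξ hξ
    simp only [cut]
    split_ifs
    · exact ext_steady_of_lt s hξ
    · rfl
  · intro β hβ ξ h1 h2
    have h3 : bethOrd (Order.succ β) ≤ bethOrd α := bethOrd_le.2 (Order.succ_le_of_lt hβ)
    rw [cut, cut, if_pos (h2.trans_le h3), if_pos (h1.trans_lt (h2.trans_le h3)),
      ext_steady hκ s (hβ.trans hα) h1 h2, ext_steady_bethOrd hκ s (hβ.trans hα)]

end Steady

section Logic

open FirstOrder Language

/-! ### Elementary submodels of the cumulative hierarchy -/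

section Elementary

variable {κ : Cardinal.{u}} (P : Set ZFSet.{u}) (s t r : Fun2 κ)

/-- Truth in `V_δ` of a formula whose free variables are indexed by `Fin n`. -/
abbrev Tr (δ : Ordinal.{u}) {n : ℕ} (φ : voc.BoundedFormula Empty n) (v : Fin n → VSet δ) : Prop :=
  @BoundedFormula.Realize voc (VSet δ) (str P s t r δ) Empty n φ default v

/-- The inclusion of `V_δ` in `V_ε`. -/
def incl {δ ε : Ordinal.{u}} (h : δ ≤ ε) (x : VSet δ) : VSet ε :=
  ⟨x.1, ZFSet.vonNeumann_subset_of_le h x.2⟩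

/-- The inclusion of `V_δ` in `V_ε` as an embedding of structures. -/
def inclEmb {δ ε : Ordinal.{u}} (h : δ ≤ ε) :
    @FirstOrder.Language.Embedding voc (VSet δ) (VSet ε) (str P s t r δ) (str P s t r ε) :=
  letI := str P s t r δ
  letI := str P s t r ε
  { toFun := incl h
    inj' := fun _ _ hxy => Subtype.ext (congrArg (fun z : VSet ε => z.1) hxy)
    map_fun' := fun f => Empty.elim f
    map_rel' := fun R _ => by cases R <;> rfl }

/-- `V_δ ≺ V_ε`, for the structures expanded by `P`, `s`, `t`, `r`. -/
def IsElem {δ ε : Ordinal.{u}} (h : δ ≤ ε) : Prop :=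
  ∀ (n : ℕ) (φ : voc.BoundedFormula Empty n) (v : Fin n → VSet δ),
    Tr P s t r ε φ (incl h ∘ v) ↔ Tr P s t r δ φ v

variable {P s t r}

theorem realize_incl {δ ε : Ordinal.{u}} (h : δ ≤ ε) {n : ℕ}
    (τ : voc.Term (Empty ⊕ Fin n)) (v : Fin n → VSet δ) :
    @Term.realize voc (VSet ε) (str P s t r ε) _ (Sum.elim default (incl h ∘ v)) τ =
      incl h (@Term.realize voc (VSet δ) (str P s t r δ) _ (Sum.elim default v) τ) := by
  cases τ with
  | var i =>
    rcases i with i | i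
    · exact i.elim
    · rfl
  | func f _ => exact Empty.elim f

theorem elemSub_iff {δ : Ordinal.{u}} : ElemSub P s t r δ ↔ ∃ h : δ ≤ κ.ord, IsElem P s t r h := by
  refine exists_congr fun h => ⟨fun H n φ v => ?_, fun H n ψ v => ?_⟩
  · let emb : @ElementaryEmbedding voc (VSet δ) (VSet κ.ord) (str P s t r δ) (str P s t r κ.ord) :=
      letI := str P s t r δ
      letI := str P s t r κ.ord
      { toFun := incl h
        map_formula' := fun n ψ v => H n ψ v }
    have := @ElementaryEmbedding.map_boundedFormula voc _ _ (str P s t r δ) (str P s t r κ.ord)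
      emb Empty n φ default v
    have e : (emb ∘ default : Empty → VSet κ.ord) = default := Subsingleton.elim _ _
    rw [e] at this
    exact this
  · have := H n (BoundedFormula.relabel Sum.inr ψ) v
    unfold Tr at this
    rw [@Formula.realize_relabel_sumInr, @Formula.realize_relabel_sumInr] at this
    exact this

theorem IsElem.of_trans {δ ε ζ : Ordinal.{u}} {h : δ ≤ ε} {h' : ε ≤ ζ}
    (hδ : IsElem P s t r (h.trans h')) (hε : IsElem P s t r h') : IsElem P s t r h := fun n φ v =>
  (hε n φ (incl h ∘ v)).symm.trans (hδ n φ v)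

/-- Tarski's theorem on unions of elementary chains, for the sets `V_δ`. The set `S` of heights is
cofinal in `σ`, so that `V_σ` is the union of the chain. -/
theorem isElem_of_chain {S : Set Ordinal.{u}} {σ : Ordinal.{u}} (hS : ∀ δ ∈ S, δ ≤ σ)
    (hcov : ∀ α < σ, ∃ δ ∈ S, α < δ)
    (hel : ∀ δ ∈ S, ∀ ε ∈ S, ∀ h : δ ≤ ε, IsElem P s t r h) {δ : Ordinal.{u}} (hδ : δ ∈ S) :
    IsElem P s t r (hS δ hδ) := by
  intro n φ v
  suffices H : ∀ (δ : Ordinal.{u}) (hδ : δ ∈ S) (v : Fin n → VSet δ),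
      Tr P s t r σ φ (incl (hS δ hδ) ∘ v) ↔ Tr P s t r δ φ v from H δ hδ v
  clear v hδ δ
  induction φ with
  | falsum => intros; rfl
  | equal t₁ t₂ =>
    intro δ hδ v
    change _ = _ ↔ _ = _
    rw [realize_incl, realize_incl]
    exact (inclEmb P s t r (hS δ hδ)).inj'.eq_iff
  | @rel n l R ts =>
    intro δ hδ v
    have h1 := @Embedding.map_rel' voc _ _ (str P s t r δ) (str P s t r σ)
      (inclEmb P s t r (hS δ hδ)) _ R
      (fun i => @Term.realize voc (VSet δ) (str P s t r δ) _ (Sum.elim default v) (ts i))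
    refine Iff.trans ?_ h1
    change @Structure.RelMap voc (VSet σ) (str P s t r σ) _ R _ ↔ _
    simp only [realize_incl]
    rfl
  | imp _ _ ih1 ih2 =>
    intro δ hδ v
    exact imp_congr (ih1 δ hδ v) (ih2 δ hδ v)
  | @all n f ih =>
    intro δ hδ v
    have hsnoc : ∀ {δ : Ordinal.{u}} (hδ : δ ∈ S) (v : Fin n → VSet δ) (a : VSet δ),
        (Fin.snoc (incl (hS δ hδ) ∘ v) (incl (hS δ hδ) a) : Fin (n + 1) → VSet σ) =
          incl (hS δ hδ) ∘ (Fin.snoc v a : Fin (n + 1) → VSet δ) := by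
      intro δ hδ v a
      exact (Fin.comp_snoc _ _ _).symm
    constructor
    · intro H a
      have := H (incl (hS δ hδ) a)
      rw [hsnoc hδ v a] at this
      exact (ih δ hδ _).1 this
    · intro H a
      obtain ⟨ε₀, hε₀, ha⟩ := hcov _ (ZFSet.mem_vonNeumann.1 a.2)
      obtain ⟨ε, hε, h1, h2⟩ : ∃ ε ∈ S, δ ≤ ε ∧ ε₀ ≤ ε := by
        rcases le_total δ ε₀ with h | h
        · exact ⟨ε₀, hε₀, h, le_rfl⟩
        · exact ⟨δ, hδ, le_rfl, h⟩
      have haε : a.1 ∈ ZFSet.vonNeumann ε := ZFSet.mem_vonNeumann.2 (ha.trans_le h2)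
      have H2 : Tr P s t r ε f.all (incl h1 ∘ v) := (hel δ hδ ε hε h1 n f.all v).2 H
      have H3 := (ih ε hε _).2 (H2 ⟨a.1, haε⟩)
      rw [← hsnoc hε (incl h1 ∘ v) ⟨a.1, haε⟩] at H3
      exact H3

/-- The structure on `V_δ` depends only on the values of the functions below `δ`. -/
theorem str_congr {s' t' r' : Fun2 κ} {δ : Ordinal.{u}} (hs : ∀ ξ < δ, ext s ξ = ext s' ξ)
    (ht : ∀ ξ < δ, ext t ξ = ext t' ξ) (hr : ∀ ξ < δ, ext r ξ = ext r' ξ) :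
    str P s t r δ = str P s' t' r' δ := by
  have key : ∀ {a b : Fun2 κ}, (∀ ξ < δ, ext a ξ = ext b ξ) → ∀ x y : VSet δ,
      graphRel a x.1 y.1 = graphRel b x.1 y.1 := by
    intro a b hab x y
    refine propext (exists_congr fun ξ => and_congr_right fun hx => ?_)
    have hξ : ξ.1 < δ := by
      have := ZFSet.mem_vonNeumann.1 x.2
      rwa [hx, Ordinal.rank_toZFSet] at this
    have := hab ξ.1 hξ
    rw [ext_of_lt a ξ.2, ext_of_lt b ξ.2] at this
    rw [this]
  refine FirstOrder.Language.Structure.ext ?_ ?_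
  · funext n f
    exact Empty.elim f
  · funext n R v
    cases R
    · rfl
    · rfl
    · exact key hs _ _
    · exact key ht _ _
    · exact key hr _ _

end Elementary

/-! ### Exchange of the symbols `R₁` and `R₂` -/

/-- The exchange of `R₁` and `R₂` on the relation symbols. -/
def swapRel : ∀ {n : ℕ}, VocRel n → VocRel n
  | _, .mem => .mem
  | _, .R0 => .R0
  | _, .R1 => .R2
  | _, .R2 => .R1
  | _, .R3 => .R3

/-- The exchange of `R₁` and `R₂` as a map of languages. -/
def swapHom : voc →ᴸ voc where
  onFunction := fun _ f => Empty.elim f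
  onRelation := fun _ R => swapRel R

theorem ElemSub.swap {κ : Cardinal.{u}} {P : Set ZFSet.{u}} {s t r : Fun2 κ} {δ : Ordinal.{u}}
    (h : ElemSub P s t r δ) : ElemSub P t s r δ := by
  have key : ∀ (δ : Ordinal.{u}) (n : ℕ) (ψ : voc.Formula (Fin n)) (v : Fin n → VSet δ),
      @Formula.Realize voc (VSet δ) (str P t s r δ) (Fin n) ψ v ↔
      @Formula.Realize voc (VSet δ) (str P s t r δ) (Fin n) (swapHom.onFormula ψ) v := by
    intro δ n ψ v
    refine Iff.symm (@LHom.realize_onFormula voc voc (VSet δ) (str P t s r δ) (Fin n)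
      (str P s t r δ) swapHom ?_ ψ v)
    refine @LHom.IsExpansionOn.mk _ _ _ _ (_) (_) ?_ ?_
    · intro n f
      exact Empty.elim f
    · intro n R x
      cases R <;> rfl
  obtain ⟨hle, H⟩ := h
  refine ⟨hle, fun n ψ v => ?_⟩
  rw [key, key]
  exact H n _ v

/-! ### Ordinals `δ` with `V_δ ≺ V_κ` -/

/-- The formula `x_i ∈ x_j`. -/
def vmem {n : ℕ} (i j : Fin n) : voc.BoundedFormula Empty n :=
  Relations.boundedFormula₂ (L := voc) VocRel.mem (Term.var (Sum.inr i)) (Term.var (Sum.inr j))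

/-- The formula `x_i = x_j`. -/
def veq {n : ℕ} (i j : Fin n) : voc.BoundedFormula Empty n :=
  Term.bdEqual (Term.var (Sum.inr i)) (Term.var (Sum.inr j))

/-- Every set is an element of a set. In `V_δ` this says that `δ` is zero or a limit ordinal. -/
def limFormula : voc.BoundedFormula Empty 0 := (vmem (n := 2) 0 1).ex.all

/-- A form of the axiom of infinity: some nonempty set has no `∈`-maximal element. In `V_δ` such a
set has infinite rank, so `δ` is greater than `ω`. -/
def infFormula : voc.BoundedFormula Empty 0 :=
  BoundedFormula.ex ((vmem (n := 2) 1 0).ex ⊓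
    ((vmem (n := 2) 1 0).imp (vmem (n := 3) 2 0 ⊓ vmem 1 2).ex).all)

/-- Every set `x₀` has an injection into an ordinal `x₂`; the injection is coded by a set `x₁` of
unordered pairs. -/
def injFormula : voc.BoundedFormula Empty 0 :=
  BoundedFormula.all <| BoundedFormula.ex <| BoundedFormula.ex <|
    ((vmem (n := 4) 3 2).imp ((vmem (n := 5) 4 3).imp
      (vmem 4 2 ⊓ ((vmem (n := 6) 5 4).imp (vmem 5 3)).all)).all).all ⊓
    (((vmem (n := 4) 3 0).imp (vmem (n := 5) 4 1 ⊓ (vmem (n := 6) 5 2 ⊓ (vmem 3 4 ⊓ (vmem 5 4 ⊓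
      ((vmem (n := 7) 6 4).imp (veq 6 3 ⊔ veq 6 5)).all))).ex).ex).all ⊓
    ((vmem (n := 4) 3 1).imp ((vmem (n := 5) 4 1).imp ((vmem (n := 6) 5 2).imp
      ((vmem 5 3).imp ((vmem 5 4).imp (veq 3 4)))).all).all).all)

section

variable {κ : Cardinal.{u}} {P : Set ZFSet.{u}} {s t r : Fun2 κ} {δ : Ordinal.{u}}

theorem tr_vmem {n : ℕ} (i j : Fin n) (v : Fin n → VSet δ) :
    @BoundedFormula.Realize voc (VSet δ) (str P s t r δ) Empty n (vmem i j) default v ↔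
      (v i).1 ∈ (v j).1 := by
  exact @BoundedFormula.realize_rel₂ voc (VSet δ) (str P s t r δ) Empty n default v
    (VocRel.mem : voc.Relations 2) _ _

theorem tr_veq {n : ℕ} (i j : Fin n) (v : Fin n → VSet δ) :
    @BoundedFormula.Realize voc (VSet δ) (str P s t r δ) Empty n (veq i j) default v ↔
      v i = v j := Iff.rfl

theorem tr_limFormula :
    Tr P s t r δ limFormula default ↔ ∀ x : VSet δ, ∃ y : VSet δ, x.1 ∈ y.1 := by
  let := str P s t r δ
  unfold Tr limFormula
  simp [tr_vmem, Fin.snoc]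

theorem tr_infFormula :
    Tr P s t r δ infFormula default ↔ ∃ x : VSet δ, (∃ y : VSet δ, y.1 ∈ x.1) ∧
      ∀ y : VSet δ, y.1 ∈ x.1 → ∃ z : VSet δ, z.1 ∈ x.1 ∧ y.1 ∈ z.1 := by
  let := str P s t r δ
  unfold Tr infFormula
  simp [tr_vmem, Fin.snoc]

theorem tr_injFormula :
    Tr P s t r δ injFormula default ↔ ∀ x : VSet δ, ∃ g y : VSet δ,
      (∀ a : VSet δ, a.1 ∈ y.1 → ∀ b : VSet δ, b.1 ∈ a.1 → b.1 ∈ y.1 ∧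
        ∀ c : VSet δ, c.1 ∈ b.1 → c.1 ∈ a.1) ∧
      (∀ z : VSet δ, z.1 ∈ x.1 → ∃ w : VSet δ, w.1 ∈ g.1 ∧ ∃ η : VSet δ, η.1 ∈ y.1 ∧
        z.1 ∈ w.1 ∧ η.1 ∈ w.1 ∧ ∀ q : VSet δ, q.1 ∈ w.1 → q = z ∨ q = η) ∧
      ∀ w : VSet δ, w.1 ∈ g.1 → ∀ w' : VSet δ, w'.1 ∈ g.1 → ∀ η : VSet δ, η.1 ∈ y.1 →
        η.1 ∈ w.1 → η.1 ∈ w'.1 → w = w' := by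
  let := str P s t r δ
  unfold Tr injFormula
  simp [tr_vmem, tr_veq, Fin.snoc]

end

theorem mem_VSet_of_mem {δ : Ordinal.{u}} {x y : ZFSet.{u}} (hx : x ∈ ZFSet.vonNeumann δ)
    (h : y ∈ x) : y ∈ ZFSet.vonNeumann δ :=
  ZFSet.isTransitive_vonNeumann δ x hx h

/-- For inaccessible `κ` the structure `V_κ` satisfies `injFormula`. The injection of `x` is `z ↦
rank x + i z`, with values of rank at least that of `x`; hence no value is an element of `x`, and
the unordered pair of `z` and its value determines which of its members is the argument. -/
theorem tr_injFormula_inaccessible {κ : Cardinal.{u}} (hκ : κ.IsInaccessible) {P : Set ZFSet.{u}}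
    {s t r : Fun2 κ} : Tr P s t r κ.ord injFormula default := by
  have hlim := isSuccLimit_ord_of_inaccessible hκ
  rw [tr_injFormula]
  rintro ⟨x, hx⟩
  have hθ : x.rank < κ.ord := ZFSet.mem_vonNeumann.1 hx
  have hcard : x.card < κ := by
    have h1 : x.card ≤ (ZFSet.vonNeumann x.rank).card :=
      ZFSet.card_mono (ZFSet.subset_vonNeumann_self x)
    rw [ZFSet.card_vonNeumann] at h1
    exact h1.trans_lt ((Cardinal.preBeth_strictMono hθ).trans_eq hκ.preBeth_ord)
  set θ := x.rank with hθdef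
  set μ := x.card.ord with hμ
  have hμκ : μ < κ.ord := Cardinal.ord_strictMono hcard
  have hsum : θ + μ < κ.ord := Ordinal.isPrincipal_add_ord hκ.aleph0_lt.le hθ hμκ
  obtain ⟨i, hi⟩ : ∃ i : x → Set.Iio μ, Function.Injective i := by
    have : #x ≤ #(Set.Iio μ) := by
      rw [ZFSet.cardinalMk_coe_sort, Cardinal.mk_Iio_ordinal, hμ, Cardinal.card_ord]
    exact ⟨_, this.some.injective⟩
  let η : x → ZFSet.{u} := fun z => (θ + (i z).1).toZFSet
  have hηrank : ∀ z, (η z).rank = θ + (i z).1 := fun z => Ordinal.rank_toZFSet _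
  have hη_inj : ∀ z z', η z = η z' → z = z' := by
    intro z z' h
    have := congrArg ZFSet.rank h
    rw [hηrank, hηrank] at this
    exact hi (Subtype.ext (add_left_cancel this))
  have hη_ne : ∀ z (z' : x), η z ≠ z'.1 := by
    intro z z' h
    have h1 := congrArg ZFSet.rank h
    rw [hηrank] at h1
    have h2 : z'.1.rank < θ := ZFSet.rank_lt_of_mem z'.2
    rw [← h1] at h2
    exact absurd h2 (not_lt.2 le_self_add)
  let w : x → ZFSet.{u} := fun z => {z.1, η z}
  have hwrank : ∀ z, (w z).rank < θ + μ + 1 := by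
    intro z
    have h2 : θ + (i z).1 < θ + μ := by gcongr; exact (i z).2
    rw [ZFSet.rank_pair, hηrank, Order.lt_add_one_iff, max_le_iff]
    exact ⟨Order.succ_le_of_lt ((ZFSet.rank_lt_of_mem z.2).trans_le le_self_add),
      Order.succ_le_of_lt h2⟩
  let g : ZFSet.{u} := (ZFSet.vonNeumann (θ + μ + 1)).sep fun a => ∃ z, a = w z
  have hg : ∀ a, a ∈ g ↔ ∃ z, a = w z := by
    intro a
    simp only [g, ZFSet.mem_sep, and_iff_right_iff_imp]
    rintro ⟨z, rfl⟩
    exact ZFSet.mem_vonNeumann.2 (hwrank z)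
  have hgκ : g ∈ ZFSet.vonNeumann κ.ord := by
    have h1 : g.rank ≤ θ + μ + 1 := by
      rw [← ZFSet.subset_vonNeumann]; exact ZFSet.sep_subset
    exact ZFSet.mem_vonNeumann.2 (h1.trans_lt (hlim.add_one_lt hsum))
  have hyκ : (θ + μ).toZFSet ∈ ZFSet.vonNeumann κ.ord :=
    ZFSet.mem_vonNeumann.2 (by rwa [Ordinal.rank_toZFSet])
  have hηy : ∀ z, η z ∈ (θ + μ).toZFSet := by
    intro z
    rw [Ordinal.toZFSet_mem_toZFSet_iff]
    gcongr
    exact (i z).2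
  refine ⟨⟨g, hgκ⟩, ⟨_, hyκ⟩, ?_, ?_, ?_⟩
  · have ho := ZFSet.isOrdinal_toZFSet (θ + μ)
    intro a ha b hb
    exact ⟨ho.mem_trans hb ha, fun c hc => (ho.mem ha).mem_trans hc hb⟩
  · rintro ⟨z, _⟩ hzx
    have hwg : w ⟨z, hzx⟩ ∈ g := (hg _).2 ⟨_, rfl⟩
    refine ⟨⟨w ⟨z, hzx⟩, mem_VSet_of_mem hgκ hwg⟩, hwg, ⟨η ⟨z, hzx⟩,
      mem_VSet_of_mem hyκ (hηy _)⟩, hηy _, by simp [w], by simp [w], ?_⟩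
    rintro ⟨q, _⟩ hq
    simpa [w, Subtype.ext_iff] using hq
  · rintro ⟨a, _⟩ ha ⟨b, _⟩ hb ⟨e, _⟩ - h1 h2
    obtain ⟨z, rfl⟩ := (hg _).1 ha
    obtain ⟨z', rfl⟩ := (hg _).1 hb
    suffices z = z' by subst this; rfl
    simp only [w, ZFSet.mem_pair] at h1 h2
    rcases h1 with rfl | rfl <;> rcases h2 with h2 | h2
    · exact Subtype.ext h2
    · exact absurd h2.symm (hη_ne _ _)
    · exact absurd h2 (hη_ne _ _)
    · exact hη_inj _ _ h2

/-- If `injFormula` is true in `V_δ`, then the cardinality of any element of `V_δ` is at most that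
of an ordinal in `V_δ`. -/
theorem card_ord_lt_of_tr_injFormula {κ : Cardinal.{u}} {P : Set ZFSet.{u}} {s t r : Fun2 κ}
    {δ : Ordinal.{u}} (H : Tr P s t r δ injFormula default) {x : ZFSet.{u}}
    (hx : x ∈ ZFSet.vonNeumann δ) : x.card.ord < δ := by
  rw [tr_injFormula] at H
  obtain ⟨⟨g, hg⟩, ⟨y, hy⟩, h1, h2, h3⟩ := H ⟨x, hx⟩
  have hyo : y.IsOrdinal := by
    rw [ZFSet.isOrdinal_iff_forall_mem_isTransitive]
    refine ⟨fun a ha b hb => ?_, fun a ha b hb c hc => ?_⟩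
    · have haδ := mem_VSet_of_mem hy ha
      exact (h1 ⟨a, haδ⟩ ha ⟨b, mem_VSet_of_mem haδ hb⟩ hb).1
    · have haδ := mem_VSet_of_mem hy ha
      have hbδ := mem_VSet_of_mem haδ hb
      exact (h1 ⟨a, haδ⟩ ha ⟨b, hbδ⟩ hb).2 ⟨c, mem_VSet_of_mem hbδ hc⟩ hc
  choose w hwg η hηy hzw hηw hq using fun z : x =>
    h2 ⟨z.1, mem_VSet_of_mem hx z.2⟩ z.2
  have hinj : Function.Injective (fun z : x => (⟨(η z).1, hηy z⟩ : y)) := by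
    intro z z' h
    have hη : η z = η z' := Subtype.ext (congrArg (fun a : y => a.1) h)
    have hw : w z = w z' := h3 _ (hwg z) _ (hwg z') (η z) (hηy z) (hηw z) (by
      rw [hη]; exact hηw z')
    -- here `w z = {z, η z}` and `w z' = {z', η z'}` are equal, and so are `η z` and `η z'`
    have a1 := hq z' ⟨z.1, mem_VSet_of_mem hx z.2⟩ (by rw [← hw]; exact hzw z)
    have a2 := hq z ⟨z'.1, mem_VSet_of_mem hx z'.2⟩ (by rw [hw]; exact hzw z')
    rcases a1 with a1 | a1
    · exact Subtype.ext (congrArg (fun a : VSet δ => a.1) a1)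
    · rcases a2 with a2 | a2
      · exact Subtype.ext (congrArg (fun a : VSet δ => a.1) a2).symm
      · rw [hη] at a2
        exact Subtype.ext (congrArg (fun a : VSet δ => a.1) (a1.trans a2.symm))
  have hle := Cardinal.mk_le_of_injective hinj
  rw [ZFSet.cardinalMk_coe_sort, ZFSet.cardinalMk_coe_sort, Cardinal.lift_le] at hle
  have hyc : y.card = y.rank.card := by
    conv_lhs => rw [← hyo.toZFSet_rank_eq]
    exact Ordinal.card_toZFSet _
  calc x.card.ord ≤ y.card.ord := Cardinal.ord_le_ord.2 hle
    _ ≤ y.rank := by rw [hyc]; exact Cardinal.ord_card_le _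
    _ < δ := ZFSet.mem_vonNeumann.1 hy

/-- The height of an elementary submodel `V_δ ≺ V_κ` is an initial ordinal above `ω` which is closed
under the function `ℶ`. The three sentences above hold in `V_κ`, hence in `V_δ`, and `injFormula`
is applied to the sets `V_α` with `α < δ`. -/
theorem ElemSub.fixed {κ : Cardinal.{u}} (hκ : κ.IsInaccessible) {P : Set ZFSet.{u}}
    {s t r : Fun2 κ} {δ : Ordinal.{u}} (h : ElemSub P s t r δ) :
    Order.IsSuccLimit δ ∧ Ordinal.omega0 < δ ∧ δ.card.ord = δ ∧ ∀ α < δ, bethOrd α < δ := by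
  obtain ⟨hle, H⟩ := elemSub_iff.1 h
  have hlimκ := isSuccLimit_ord_of_inaccessible hκ
  have hωκ : Ordinal.omega0 < κ.ord := by
    rw [← Cardinal.ord_aleph0]; exact Cardinal.ord_strictMono hκ.aleph0_lt
  have hd : ∀ φ : voc.BoundedFormula Empty 0, Tr P s t r κ.ord φ default →
      Tr P s t r δ φ default := by
    intro φ hφ
    refine (H 0 φ default).1 ?_
    rwa [Subsingleton.elim (incl hle ∘ default : Fin 0 → VSet κ.ord) default]
  have hinf := hd infFormula (by
    rw [tr_infFormula]
    refine ⟨⟨Ordinal.omega0.toZFSet, ZFSet.mem_vonNeumann.2 (by rwa [Ordinal.rank_toZFSet])⟩,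
      ⟨⟨(0 : Ordinal.{u}).toZFSet, ZFSet.mem_vonNeumann.2 (by
        rw [Ordinal.rank_toZFSet]; exact hωκ.pos)⟩,
        Ordinal.toZFSet_mem_toZFSet_iff.2 Ordinal.omega0_pos⟩, ?_⟩
    rintro ⟨y, hy⟩ hyω
    obtain ⟨a, ha, rfl⟩ := Ordinal.mem_toZFSet_iff.1 hyω
    have ha' : a + 1 < Ordinal.omega0 := Ordinal.isSuccLimit_omega0.add_one_lt ha
    refine ⟨⟨(a + 1).toZFSet, ZFSet.mem_vonNeumann.2 (by
      rw [Ordinal.rank_toZFSet]; exact ha'.trans hωκ)⟩, ?_, ?_⟩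
    · exact Ordinal.toZFSet_mem_toZFSet_iff.2 ha'
    · simp)
  have hlimf := hd limFormula (by
    rw [tr_limFormula]
    rintro ⟨x, hx⟩
    refine ⟨⟨{x}, ZFSet.mem_vonNeumann.2 ?_⟩, by simp⟩
    rw [ZFSet.rank_singleton]
    exact hlimκ.succ_lt (ZFSet.mem_vonNeumann.1 hx))
  have hinj := hd injFormula (tr_injFormula_inaccessible hκ)
  rw [tr_infFormula] at hinf
  rw [tr_limFormula] at hlimf
  have hsucc : ∀ α < δ, Order.succ α < δ := by
    intro α hα
    obtain ⟨⟨y, hy⟩, hxy⟩ := hlimf ⟨α.toZFSet, ZFSet.mem_vonNeumann.2 (by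
      rwa [Ordinal.rank_toZFSet])⟩
    have h1 := ZFSet.rank_lt_of_mem hxy
    rw [Ordinal.rank_toZFSet] at h1
    exact (Order.succ_le_of_lt h1).trans_lt (ZFSet.mem_vonNeumann.1 hy)
  obtain ⟨⟨X, hX⟩, ⟨⟨y₀, hy₀⟩, hy₀X⟩, hXs⟩ := hinf
  have hXω : Ordinal.omega0 ≤ X.rank := by
    rw [Ordinal.omega0_le]
    have key : ∀ n : ℕ, ∃ y ∈ X, (n : Ordinal.{u}) ≤ y.rank := by
      intro n
      induction n with
      | zero => exact ⟨y₀, hy₀X, by simp⟩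
      | succ n ih =>
        obtain ⟨y, hy, hn⟩ := ih
        obtain ⟨⟨z, hz⟩, hzX, hyz⟩ := hXs ⟨y, mem_VSet_of_mem hX hy⟩ hy
        refine ⟨z, hzX, ?_⟩
        rw [Nat.cast_succ]
        exact Order.add_one_le_of_lt (hn.trans_lt (ZFSet.rank_lt_of_mem hyz))
    intro n
    obtain ⟨y, hy, hn⟩ := key n
    exact hn.trans (ZFSet.rank_lt_of_mem hy).le
  have hωδ : Ordinal.omega0 < δ := hXω.trans_lt (ZFSet.mem_vonNeumann.1 hX)
  have hlim : Order.IsSuccLimit δ := by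
    refine ⟨fun hmin => ?_, ?_⟩
    · exact absurd (hmin.eq_bot) (hωδ.trans_le' zero_le).ne'
    · rw [Order.isSuccPrelimit_iff_succ_lt]
      exact hsucc
  have hpre : ∀ α < δ, (Cardinal.preBeth α).ord < δ := by
    intro α hα
    have := card_ord_lt_of_tr_injFormula hinj (x := ZFSet.vonNeumann α)
      (ZFSet.mem_vonNeumann.2 (by rwa [ZFSet.rank_vonNeumann]))
    rwa [ZFSet.card_vonNeumann] at this
  have hinit : δ.card.ord = δ := by
    refine le_antisymm (Cardinal.ord_card_le δ) (not_lt.1 fun hlt => ?_)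
    have h1 := hpre _ (hsucc _ hlt)
    have h2 : δ.card ≤ Cardinal.preBeth δ.card.ord := by
      have : δ.card.ord ≤ (Cardinal.preBeth δ.card.ord).ord :=
        (Cardinal.ord_strictMono.comp Cardinal.preBeth_strictMono).le_apply
      exact Cardinal.ord_le_ord.1 this
    have h3 : δ.card < Cardinal.preBeth (Order.succ δ.card.ord) :=
      h2.trans_lt (Cardinal.preBeth_strictMono (Order.lt_succ _))
    have h4 := Ordinal.card_le_card h1.le
    rw [Cardinal.card_ord] at h4
    exact absurd h3 (not_lt.2 h4)
  refine ⟨hlim, hωδ, hinit, fun α hα => ?_⟩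
  have h1 : Ordinal.omega0 + α < δ := by
    have h0 : ℵ₀ ≤ δ.card := by
      rw [Ordinal.aleph0_le_card]; exact hωδ.le
    have := Ordinal.isPrincipal_add_ord h0
    rw [hinit] at this
    exact this hωδ hα
  have := hpre _ h1
  rwa [← Cardinal.beth_eq_preBeth] at this

/-! ### Existence of elementary submodels `V_δ` -/

section

variable {κ : Cardinal.{u}} {P : Set ZFSet.{u}} {s t r : Fun2 κ}

theorem voc_card_le : voc.card ≤ ℵ₀ := by
  have : Countable voc.Symbols := by
    have h1 : Countable (Σ n, voc.Functions n) := by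
      have : IsEmpty (Σ n, voc.Functions n) := ⟨fun x => Empty.elim x.2⟩
      infer_instance
    have h2 : Countable (Σ n, voc.Relations n) := by
      let code : (Σ n, VocRel n) → ℕ := fun R =>
        match R with
        | ⟨_, .mem⟩ => 0
        | ⟨_, .R0⟩ => 1
        | ⟨_, .R1⟩ => 2
        | ⟨_, .R2⟩ => 3
        | ⟨_, .R3⟩ => 4
      have hc : Function.Injective code := by
        rintro ⟨_, _ | _ | _ | _ | _⟩ ⟨_, _ | _ | _ | _ | _⟩ h <;> simp_all [code]
      exact hc.countable
    exact instCountableSum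
  exact Cardinal.mk_le_aleph0

theorem mk_VSet (δ : Ordinal.{u}) :
    #(VSet δ) = Cardinal.lift.{u + 1} (Cardinal.preBeth δ) := by
  rw [← ZFSet.card_vonNeumann, ← ZFSet.cardinalMk_coe_sort]

/-- One step of the construction of elementary submodels: by the downward Löwenheim–Skolem theorem
`V_α` is contained in a small elementary submodel, which is contained in some `V_β`. -/
theorem exists_skolem_step (hκ : κ.IsInaccessible) (P : Set ZFSet.{u}) (s t r : Fun2 κ)
    {α : Ordinal.{u}} (hα : α < κ.ord) :
    ∃ S : Set (VSet κ.ord), (∀ x : VSet κ.ord, x.1 ∈ ZFSet.vonNeumann α → x ∈ S) ∧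
      (∀ (n : ℕ) (φ : voc.BoundedFormula Empty (n + 1)) (v : Fin n → VSet κ.ord),
        (∀ i, v i ∈ S) → ∀ a : VSet κ.ord, Tr P s t r κ.ord φ (Fin.snoc v a) →
          ∃ b ∈ S, Tr P s t r κ.ord φ (Fin.snoc v b)) ∧
      ∃ β < κ.ord, α < β ∧ ∀ x ∈ S, x.1 ∈ ZFSet.vonNeumann β := by
  let := str P s t r κ.ord
  have hlim := isSuccLimit_ord_of_inaccessible hκ
  set μ : Cardinal.{u} := max ℵ₀ (Cardinal.preBeth α) with hμ
  have hμκ : μ < κ := by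
    refine max_lt hκ.aleph0_lt ?_
    exact (Cardinal.preBeth_strictMono hα).trans_eq hκ.preBeth_ord
  let A : Set (VSet κ.ord) := {x | x.1 ∈ ZFSet.vonNeumann α}
  have hA : #A ≤ Cardinal.lift.{u + 1} μ := by
    have : #A ≤ #(VSet α) := Cardinal.mk_le_of_injective
      (f := fun x : A => (⟨x.1.1, x.2⟩ : VSet α))
      (fun x y h => Subtype.ext (Subtype.ext (congrArg (fun a : VSet α => a.1) h)))
    rw [mk_VSet] at this
    exact this.trans (Cardinal.lift_le.2 (le_max_right _ _))
  obtain ⟨S, hAS, hS⟩ := exists_elementarySubstructure_card_eq voc A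
    (Cardinal.lift.{u + 1} μ) (by simp [hμ]) (by simpa using hA) (by
      refine (Cardinal.lift_le.2 voc_card_le).trans ?_
      simp [hμ]) (by
      rw [mk_VSet]
      simp only [Cardinal.lift_le, Cardinal.lift_id]
      rw [hκ.preBeth_ord]
      exact hμκ.le)
  refine ⟨(S : Set (VSet κ.ord)), fun x hx => hAS hx, ?_, ?_⟩
  · intro n φ v hv a ha
    have h1 : φ.ex.Realize default v := BoundedFormula.realize_ex.2 ⟨a, ha⟩
    let v' : Fin n → S := fun i => ⟨v i, hv i⟩
    have h2 : φ.ex.Realize (default : Empty → S) v' := by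
      rw [← S.subtype.map_boundedFormula]
      have e : (S.subtype ∘ default : Empty → VSet κ.ord) = default := Subsingleton.elim _ _
      rw [e]
      exact h1
    obtain ⟨b, hb⟩ := BoundedFormula.realize_ex.1 h2
    refine ⟨b.1, b.2, ?_⟩
    rw [← S.subtype.map_boundedFormula] at hb
    have e : (S.subtype ∘ default : Empty → VSet κ.ord) = default := Subsingleton.elim _ _
    rw [e, Fin.comp_snoc] at hb
    exact hb
  · obtain ⟨β, hβ, hβS⟩ := exists_bound_of_mk_lt hκ.isRegular (ι := S)
      (f := fun x => (x.1.1).rank) (by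
        refine Cardinal.mk_range_le.trans_lt ?_
        rw [Cardinal.lift_id, Cardinal.lift_id] at hS
        rw [hS]
        exact Cardinal.lift_lt.2 hμκ) (fun x => ZFSet.mem_vonNeumann.1 x.1.2)
    refine ⟨max β (α + 1), max_lt hβ (hlim.add_one_lt hα), by simp, fun x hx => ?_⟩
    exact ZFSet.mem_vonNeumann.2 ((hβS ⟨x, hx⟩).trans_le (le_max_left _ _))

/-- The set of `δ < κ` with `V_δ ≺ V_κ` is unbounded: `δ` is the supremum of the sequence obtained
by iterating `exists_skolem_step`, and `V_δ` satisfies the Tarski–Vaught criterion. -/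
theorem exists_elemSub (hκ : κ.IsInaccessible) (P : Set ZFSet.{u}) (s t r : Fun2 κ)
    {α : Ordinal.{u}} (hα : α < κ.ord) : ∃ δ < κ.ord, α < δ ∧ ElemSub P s t r δ := by
  choose! S hS1 hS2 β hβ hαβ hSβ using
    fun (α : Ordinal.{u}) (hα : α < κ.ord) => exists_skolem_step hκ P s t r hα
  let a : ℕ → Ordinal.{u} := fun n => β^[n] α
  have ha : ∀ n, a n < κ.ord := by
    intro n
    induction n with
    | zero => exact hα
    | succ n ih =>
      simp only [a, Function.iterate_succ_apply'] at ih ⊢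
      exact hβ _ ih
  have hstep : ∀ n, a (n + 1) = β (a n) := fun n => Function.iterate_succ_apply' _ _ _
  have hmono : Monotone a := monotone_nat_of_le_succ fun n => by
    rw [hstep]; exact (hαβ _ (ha n)).le
  obtain ⟨b, hb, hab⟩ := exists_bound_of_mk_lt hκ.isRegular (f := a) (by
    refine (Cardinal.le_aleph0_iff_set_countable.2 (countable_range a)).trans_lt ?_
    rw [← Cardinal.lift_aleph0.{u + 1, u}, Cardinal.lift_lt]
    exact hκ.aleph0_lt) ha
  have hbdd : BddAbove (range a) := ⟨b, by rintro _ ⟨n, rfl⟩; exact (hab n).le⟩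
  set δ := ⨆ n, a n with hδdef
  have hδ : δ < κ.ord := (ciSup_le fun n => (hab n).le).trans_lt hb
  have haδ : ∀ n, a n < δ := fun n => by
    refine lt_of_lt_of_le ?_ (le_ciSup hbdd (n + 1))
    rw [hstep]; exact hαβ _ (ha n)
  have hlt : ∀ x, x < δ → ∃ n, x < a n := fun x hx => exists_lt_of_lt_ciSup hx
  refine ⟨δ, hδ, haδ 0, elemSub_iff.2 ⟨hδ.le, ?_⟩⟩
  let emb := inclEmb P s t r hδ.le
  have htv := @Embedding.isElementary_of_exists voc (VSet δ) (VSet κ.ord) (str P s t r δ)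
    (str P s t r κ.ord) emb (by
    intro n φ x c hc
    obtain ⟨m, hm⟩ : ∃ m, ∀ i, (x i).1 ∈ ZFSet.vonNeumann (a m) := by
      choose k hk using fun i => hlt _ (ZFSet.mem_vonNeumann.1 (x i).2)
      refine ⟨Finset.univ.sup k, fun i => ZFSet.mem_vonNeumann.2 ((hk i).trans_le ?_)⟩
      exact hmono (Finset.le_sup (Finset.mem_univ i))
    obtain ⟨d, hd, hdφ⟩ := hS2 _ (ha m) n φ (incl hδ.le ∘ x)
      (fun i => hS1 _ (ha m) _ (hm i)) c hc
    have hdδ : d.1 ∈ ZFSet.vonNeumann δ := by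
      have h1 := ZFSet.mem_vonNeumann.1 (hSβ _ (ha m) d hd)
      rw [← hstep] at h1
      exact ZFSet.mem_vonNeumann.2 (h1.trans (haδ _))
    exact ⟨⟨d.1, hdδ⟩, hdφ⟩)
  have hE : ElemSub P s t r δ := ⟨hδ.le, fun n ψ v => htv ψ v⟩
  exact (elemSub_iff.1 hE).2

/-- The set of `δ` with `V_δ ≺ V_κ` is closed. -/
theorem ElemSub.of_cofinal {σ : Ordinal.{u}} (h0 : 0 < σ) (hσ : σ ≤ κ.ord)
    (h : ∀ α < σ, ∃ δ, α < δ ∧ δ < σ ∧ ElemSub P s t r δ) : ElemSub P s t r σ := by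
  refine elemSub_iff.2 ⟨hσ, ?_⟩
  let S : Set Ordinal.{u} := {δ | δ < σ ∧ ElemSub P s t r δ}
  have hch := fun {δ} (hδ : δ ∈ S) => isElem_of_chain (P := P) (s := s) (t := t) (r := r) (S := S)
    (σ := σ) (fun δ hδ => hδ.1.le)
    (fun α hα => by
      obtain ⟨δ, h1, h2, h3⟩ := h α hα
      exact ⟨δ, ⟨h2, h3⟩, h1⟩)
    (fun δ hδ ε hε hle => by
      obtain ⟨a1, a2⟩ := elemSub_iff.1 hδ.2
      obtain ⟨b1, b2⟩ := elemSub_iff.1 hε.2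
      exact IsElem.of_trans (h' := b1) a2 b2) hδ
  intro n φ v
  obtain ⟨δ, hδS, hv⟩ : ∃ δ ∈ S, ∀ i, (v i).1 ∈ ZFSet.vonNeumann δ := by
    choose d hd1 hd2 hd3 using fun i => h _ (ZFSet.mem_vonNeumann.1 (v i).2)
    rcases Nat.eq_zero_or_pos n with rfl | hn
    · obtain ⟨δ, h1, h2, h3⟩ := h 0 (h0)
      exact ⟨δ, ⟨h2, h3⟩, fun i => i.elim0⟩
    · have : Nonempty (Fin n) := ⟨⟨0, hn⟩⟩
      obtain ⟨i₀, hi₀⟩ := Finite.exists_max d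
      exact ⟨d i₀, ⟨hd2 i₀, hd3 i₀⟩, fun i =>
        ZFSet.mem_vonNeumann.2 ((hd1 i).trans_le (hi₀ i))⟩
  obtain ⟨a1, a2⟩ := elemSub_iff.1 hδS.2
  let w : Fin n → VSet δ := fun i => ⟨(v i).1, hv i⟩
  exact (a2 n φ w).trans (hch hδS n φ w).symm

end

end Logic

/-! ### Nodes, restriction and the tree order -/

namespace Node

variable {x y z : Node.{u}} {β γ : Ordinal.{u}}

@[simp] theorem inv_inv (x : Node.{u}) : x.inv.inv = x := rfl

@[simp] theorem inv_ord (x : Node.{u}) : x.inv.ord = x.ord := rfl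

theorem inv_eq_root : x.inv = root ↔ x = root :=
  ⟨fun h => by rw [← x.inv_inv, h]; rfl, fun h => by rw [h]; rfl⟩

theorem res_zero (x : Node.{u}) : x.res 0 = root := by simp [res]

theorem res_of_ne (x : Node.{u}) (h : β ≠ 0) :
    x.res β = ⟨β, cut (bethOrd β) x.fst, cut (bethOrd β) x.snd, cut (bethOrd β) x.trd,
      x.cub ∩ Set.Iio β⟩ := if_neg h

@[simp] theorem res_ord (x : Node.{u}) (β : Ordinal.{u}) : (x.res β).ord = β := by
  by_cases h : β = 0
  · subst h; rw [res_zero]; rfl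
  · rw [res_of_ne x h]

theorem res_cub (x : Node.{u}) (β : Ordinal.{u}) : (x.res β).cub = x.cub ∩ Set.Iio β := by
  by_cases h : β = 0
  · subst h; rw [res_zero]; simp [root]
  · rw [res_of_ne x h]

theorem cut_cut (h : γ ≤ β) (η : Ordinal.{u} → Fin 2) : cut γ (cut β η) = cut γ η := by
  funext ξ
  simp only [cut]
  split_ifs with h1 h2
  · rfl
  · exact absurd (h1.trans_le h) h2
  · rfl

theorem res_res (x : Node.{u}) (h : γ ≤ β) : (x.res β).res γ = x.res γ := by
  by_cases hγ : γ = 0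
  · subst hγ; rw [res_zero, res_zero]
  have hβ : β ≠ 0 := fun h0 => hγ (by subst h0; simpa using h)
  rw [res_of_ne x hβ, res_of_ne _ hγ, res_of_ne x hγ]
  simp only [cut_cut (bethOrd_le.2 h)]
  congr 1
  rw [inter_assoc, Iio_inter_Iio, min_eq_right h]

theorem inv_res (x : Node.{u}) (β : Ordinal.{u}) : x.inv.res β = (x.res β).inv := by
  by_cases h : β = 0
  · subst h; rw [res_zero, res_zero]; rfl
  · rw [res_of_ne x h, res_of_ne _ h]; rfl

theorem res_fst (x : Node.{u}) (hβ : β ≠ 0) {ξ : Ordinal.{u}} (h : ξ < bethOrd β) :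
    (x.res β).fst ξ = x.fst ξ := by
  rw [res_of_ne x hβ]; simp [cut, h]

theorem res_snd (x : Node.{u}) (hβ : β ≠ 0) {ξ : Ordinal.{u}} (h : ξ < bethOrd β) :
    (x.res β).snd ξ = x.snd ξ := by
  rw [res_of_ne x hβ]; simp [cut, h]

theorem res_trd (x : Node.{u}) (hβ : β ≠ 0) {ξ : Ordinal.{u}} (h : ξ < bethOrd β) :
    (x.res β).trd ξ = x.trd ξ := by
  rw [res_of_ne x hβ]; simp [cut, h]

theorem Below.inv (h : y.Below x) : y.inv.Below x.inv :=
  ⟨by rw [inv_ord, inv_res, ← h.1], h.2⟩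

theorem Below.trans (h : z.Below y) (h' : y.Below x) (hle : z.ord ≤ y.ord) : z.Below x := by
  obtain ⟨h1, h2⟩ := h
  obtain ⟨h3, h4⟩ := h'
  rw [h3, res_cub] at h2
  refine ⟨?_, h2.1⟩
  rw [← res_res x hle, ← h3]
  exact h1

theorem below_of_lt (hy : y.Below x) (hz : z.Below x) (h : y.ord < z.ord) : y.Below z := by
  refine ⟨?_, ?_⟩
  · rw [hz.1, res_res x h.le]; exact hy.1
  · rw [hz.1, res_cub]; exact ⟨hy.2, h⟩

theorem eq_of_ord_eq (hy : y.Below x) (hz : z.Below x) (h : y.ord = z.ord) : y = z := by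
  rw [hy.1, hz.1, h]

theorem res_below (h : γ ∈ x.cub) : (x.res γ).Below x := ⟨by simp, by simpa using h⟩

/-- The first two components differ below `ℶ_γ`. -/
def Split (x : Node.{u}) (γ : Ordinal.{u}) : Prop := ∃ ξ < bethOrd γ, x.fst ξ ≠ x.snd ξ

theorem Split.mono (h : x.Split γ) (hγ : γ ≤ β) : x.Split β := by
  obtain ⟨ξ, h1, h2⟩ := h
  exact ⟨ξ, h1.trans_le (bethOrd_le.2 hγ), h2⟩

theorem split_inv : x.inv.Split γ ↔ x.Split γ :=
  exists_congr fun _ => and_congr_right fun _ => ne_comm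

end Node

open Node

/-! ### Membership in the tree `T` -/

section Tree

variable {x y : Node.{u}} {α β γ : Ordinal.{u}} {κ : Cardinal.{u}}

theorem ClosedIn.inter {C : Set Ordinal.{u}} (h : ClosedIn C α) (hβ : β ≤ α) :
    ClosedIn (C ∩ Iio β) β := by
  refine ⟨fun ξ hξ => hξ.2, fun S hS hne hlt => ⟨h.2 S (fun s hs => (hS hs).1) hne ?_, hlt⟩⟩
  exact hlt.trans_le hβ

theorem root_mem_T (hκ : κ ≠ 0) : root ∈ T κ :=
  ⟨0, by simpa [Cardinal.lt_ord, pos_iff_ne_zero] using hκ, Or.inl ⟨rfl, rfl⟩⟩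

theorem mem_TLevel_ord (h : x ∈ TLevel α) : x.ord = α := by
  rcases h with ⟨rfl, rfl⟩ | ⟨_, h, _⟩
  · rfl
  · exact h

theorem mem_T_iff : x ∈ T κ ↔ x.ord < κ.ord ∧ x ∈ TLevel x.ord := by
  constructor
  · rintro ⟨α, hα, h⟩
    have := mem_TLevel_ord h
    subst this
    exact ⟨hα, h⟩
  · rintro ⟨h1, h2⟩
    exact ⟨_, h1, h2⟩

theorem ord_lt_of_mem_T (h : x ∈ T κ) : x.ord < κ.ord := (mem_T_iff.1 h).1

theorem mem_T_ne_root (h : x ∈ T κ) (hx : x ≠ root) : x.ord ≠ 0 ∧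
    (∀ ξ, bethOrd x.ord ≤ ξ → x.fst ξ = 0 ∧ x.snd ξ = 0 ∧ x.trd ξ = 0) ∧
      x.fst ≠ x.snd ∧ ClosedIn x.cub x.ord := by
  rcases (mem_T_iff.1 h).2 with ⟨_, h⟩ | ⟨h0, _, h⟩
  · exact absurd h hx
  · exact ⟨h0, h⟩

theorem lt_ord_of_mem_cub (h : x ∈ T κ) (hγ : γ ∈ x.cub) : γ < x.ord := by
  by_cases hx : x = root
  · subst hx; exact absurd hγ (by simp [root])
  · exact (mem_T_ne_root h hx).2.2.2.1 γ hγ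

theorem Node.Below.ord_lt (hyx : y.Below x) (h : x ∈ T κ) : y.ord < x.ord :=
  lt_ord_of_mem_cub h hyx.2

theorem cut_eq_self {θ : Ordinal.{u}} {η : Ordinal.{u} → Fin 2} (h : ∀ ξ, θ ≤ ξ → η ξ = 0) :
    cut θ η = η := by
  funext ξ
  simp only [cut]
  split_ifs with h1
  · rfl
  · exact (h ξ (not_lt.1 h1)).symm

theorem res_self (h : x ∈ T κ) : x.res x.ord = x := by
  by_cases hx : x = root
  · subst hx; exact res_zero _
  obtain ⟨h0, h1, -, h2⟩ := mem_T_ne_root h hx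
  rw [res_of_ne x h0, cut_eq_self fun ξ hξ => (h1 ξ hξ).1,
    cut_eq_self fun ξ hξ => (h1 ξ hξ).2.1, cut_eq_self fun ξ hξ => (h1 ξ hξ).2.2,
    inter_eq_left.2 (show x.cub ⊆ Iio x.ord from fun ξ hξ => h2.1 ξ hξ)]

theorem split_of_mem_T (h : x ∈ T κ) (hx : x ≠ root) : x.Split x.ord := by
  obtain ⟨-, h1, h2, -⟩ := mem_T_ne_root h hx
  by_contra hcon
  refine h2 (funext fun ξ => ?_)
  by_cases hξ : ξ < bethOrd x.ord
  · by_contra hne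
    exact hcon ⟨ξ, hξ, hne⟩
  · rw [(h1 ξ (not_lt.1 hξ)).1, (h1 ξ (not_lt.1 hξ)).2.1]

theorem res_mem_TLevel (h : x ∈ T κ) (hβ : β ≤ x.ord) (h0 : β ≠ 0) (hs : x.Split β) :
    x.res β ∈ TLevel β := by
  have hx : x ≠ root := by
    rintro rfl
    exact h0 (by simpa [root] using hβ)
  obtain ⟨-, -, -, h3⟩ := mem_T_ne_root h hx
  refine Or.inr ⟨h0, res_ord _ _, ?_, ?_, ?_⟩
  · intro ξ hξ
    rw [res_of_ne x h0]
    simp [cut, not_lt.2 hξ]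
  · obtain ⟨ξ, hξ, hne⟩ := hs
    intro he
    have := congrFun he ξ
    rw [res_fst x h0 hξ, res_snd x h0 hξ] at this
    exact hne this
  · rw [res_cub]
    exact h3.inter hβ

theorem res_mem_T (h : x ∈ T κ) (hβ : β ≤ x.ord) (h0 : β ≠ 0) (hs : x.Split β) : x.res β ∈ T κ :=
  ⟨β, hβ.trans_lt (ord_lt_of_mem_T h), res_mem_TLevel h hβ h0 hs⟩

theorem split_of_res_mem_TLevel (h0 : β ≠ 0) (h : x.res β ∈ TLevel β) : x.Split β := by
  rcases h with ⟨h, _⟩ | ⟨-, -, h1, h2, -⟩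
  · exact absurd h h0
  · by_contra hcon
    refine h2 (funext fun ξ => ?_)
    by_cases hξ : ξ < bethOrd β
    · rw [res_fst x h0 hξ, res_snd x h0 hξ]
      by_contra hne
      exact hcon ⟨ξ, hξ, hne⟩
    · rw [(h1 ξ (not_lt.1 hξ)).1, (h1 ξ (not_lt.1 hξ)).2.1]

theorem split_of_res_mem_T (h0 : β ≠ 0) (h : x.res β ∈ T κ) : x.Split β :=
  split_of_res_mem_TLevel h0 (by simpa using (mem_T_iff.1 h).2)

theorem inv_mem_T (h : x ∈ T κ) : x.inv ∈ T κ := by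
  by_cases hx : x = root
  · subst hx; exact h
  obtain ⟨h0, h1, h2, h3⟩ := mem_T_ne_root h hx
  exact ⟨x.ord, ord_lt_of_mem_T h, Or.inr ⟨h0, rfl,
    fun ξ hξ => ⟨(h1 ξ hξ).2.1, (h1 ξ hξ).1, (h1 ξ hξ).2.2⟩, h2.symm, h3⟩⟩

theorem mem_TLex_or (h : x ∈ T κ) (hx : x ≠ root) : x ∈ TLex κ ∨ x.inv ∈ TLex κ := by
  obtain ⟨ξ₀, hξ₀, hne₀⟩ := split_of_mem_T h hx
  let A : Set Ordinal.{u} := {ξ | x.fst ξ ≠ x.snd ξ}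
  have hA : A.Nonempty := ⟨ξ₀, hne₀⟩
  have hm : sInf A ∈ A := csInf_mem hA
  have hlt : sInf A < bethOrd x.ord := (csInf_le' hne₀).trans_lt hξ₀
  have hbel : ∀ ζ < sInf A, x.fst ζ = x.snd ζ := fun ζ hζ => by
    by_contra hcon
    exact notMem_of_lt_csInf' hζ hcon
  rcases lt_or_gt_of_ne hm with h1 | h1
  · exact Or.inl ⟨h, _, hlt, h1, hbel⟩
  · exact Or.inr ⟨inv_mem_T h, _, hlt, h1, fun ζ hζ => (hbel ζ hζ).symm⟩

theorem not_mem_TLex_inv (h : x ∈ TLex κ) : x.inv ∉ TLex κ := by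
  rintro ⟨-, ξ', -, h1', h2'⟩
  obtain ⟨-, ξ, -, h1, h2⟩ := h
  rcases lt_trichotomy ξ ξ' with h3 | h3 | h3
  · exact h1.ne (h2' ξ h3).symm
  · subst h3; exact lt_asymm h1 h1'
  · exact h1'.ne (h2 ξ' h3).symm

theorem ne_root_of_mem_TLex (h : x ∈ TLex κ) : x ≠ root := by
  rintro rfl
  obtain ⟨-, ξ, -, h1, -⟩ := h
  exact lt_irrefl _ h1

/-- The lexicographic order of the first two components is decided by any restriction on which they
differ. -/
theorem res_mem_TLex_iff (h : x ∈ T κ) (hβ : β ≤ x.ord) (h0 : β ≠ 0) (hs : x.Split β) :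
    x.res β ∈ TLex κ ↔ x ∈ TLex κ := by
  have key : ∀ x : Node.{u}, x ∈ T κ → β ≤ x.ord → x.Split β → x ∈ TLex κ →
      x.res β ∈ TLex κ := by
    rintro x h hβ ⟨ξ', hξ', hne⟩ ⟨-, ξ, hξ, h1, h2⟩
    have hle : ξ ≤ ξ' := not_lt.1 fun hlt => hne (h2 ξ' hlt)
    have hξβ : ξ < bethOrd β := hle.trans_lt hξ'
    refine ⟨res_mem_T h hβ h0 ⟨ξ', hξ', hne⟩, ξ, by rwa [res_ord], ?_, fun ζ hζ => ?_⟩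
    · rwa [res_fst x h0 hξβ, res_snd x h0 hξβ]
    · rw [res_fst x h0 (hζ.trans hξβ), res_snd x h0 (hζ.trans hξβ)]
      exact h2 ζ hζ
  refine ⟨fun hres => ?_, key x h hβ hs⟩
  have hx : x ≠ root := by
    rintro rfl
    exact h0 (by simpa [root] using hβ)
  rcases mem_TLex_or h hx with h1 | h1
  · exact h1
  · have := key x.inv (inv_mem_T h) hβ (split_inv.2 hs) h1
    rw [inv_res] at this
    exact absurd this (not_mem_TLex_inv hres)

theorem UFun.cut {η : Ordinal.{u} → Fin 2} (h : UFun α η) (hβ : β ≤ α) :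
    UFun β (cut (bethOrd β) η) := by
  constructor
  · intro ξ hξ
    simp only [SigmaModels.cut]
    split_ifs
    · exact h.1 ξ hξ
    · rfl
  · intro δ hδ ξ h1 h2
    have h3 : bethOrd (Order.succ δ) ≤ bethOrd β := bethOrd_le.2 (Order.succ_le_of_lt hδ)
    rw [SigmaModels.cut, SigmaModels.cut, if_pos (h2.trans_le h3),
      if_pos (h1.trans_lt (h2.trans_le h3))]
    exact h.2 δ (hδ.trans_le hβ) ξ h1 h2

end Tree

/-! ### The trees `T_H`, `T_G` and `U` -/

/-- The standing assumptions on the data of the construction. -/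
structure Data.Admissible (D : Data.{u}) : Prop where
  inacc : D.κ.IsInaccessible
  regular : D.lam.IsRegular
  lam_lt : D.lam < D.κ
  equiv : D.DefinesEquivalence
  symm : D.Symmetric
  beth : D.BethInvariant
  witness : D.WitnessBethInvariant
  book : D.IsBookkeeping
  order : D.IsLevelOrder
  enum : D.IsEnumeration

namespace Data

variable {D : Data.{u}} {x y z v : Node.{u}} {α β γ : Ordinal.{u}}

/-- The set `C_{str}` is symmetric in `s` and `t`, by the symmetry of the sentence and since the
exchange of two relation symbols does not affect elementarity. -/
theorem club_symm (H : D.Admissible) (s t r : Fun2 D.κ) : D.club s t r = D.club t s r := by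
  have key : ∀ s t : Fun2 D.κ, D.club s t r ⊆ D.club t s r := by
    rintro s t δ (hδ | ⟨h1, h2, h3⟩)
    · exact Or.inl hδ
    · exact Or.inr ⟨h1, h2.swap, (H.symm s t r).1 h3⟩
  exact Subset.antisymm (key s t) (key t s)

theorem zero_mem_club (s t r : Fun2 D.κ) : 0 ∈ D.club s t r := Or.inl rfl

theorem root_mem_TH (H : D.Admissible) : root ∈ D.TH := by
  refine ⟨root_mem_T H.inacc.ne_zero, fun _ => 0, fun _ => 0, fun _ => 0, ?_, Or.inl rfl, ?_⟩
  · intro ξ _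
    simp [root, ext]
  · simp [root]

theorem inv_mem_TH (H : D.Admissible) (h : x ∈ D.TH) : x.inv ∈ D.TH := by
  obtain ⟨h1, s, t, r, h2, h3, h4⟩ := h
  refine ⟨inv_mem_T h1, t, s, r, fun ξ hξ => ⟨(h2 ξ hξ).2.1, (h2 ξ hξ).1, (h2 ξ hξ).2.2⟩, ?_, ?_⟩
  · rw [club_symm H]; exact h3
  · rw [club_symm H]; exact h4

theorem fixed_of_mem_club (H : D.Admissible) {s t r : Fun2 D.κ} (h : γ ∈ D.club s t r)
    (h0 : γ ≠ 0) : Order.IsSuccLimit γ ∧ Ordinal.omega0 < γ ∧ γ.card.ord = γ ∧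
      ∀ α < γ, bethOrd α < γ := by
  rcases h with h | ⟨-, h, -⟩
  · exact absurd h h0
  · exact h.fixed H.inacc

theorem fixed_of_mem_TH (H : D.Admissible) (h : x ∈ D.TH) (hx : x ≠ root) :
    Order.IsSuccLimit x.ord ∧ Ordinal.omega0 < x.ord ∧ x.ord.card.ord = x.ord ∧
      ∀ α < x.ord, bethOrd α < x.ord := by
  obtain ⟨h1, s, t, r, -, h3, -⟩ := h
  exact fixed_of_mem_club H h3 (mem_T_ne_root h1 hx).1

theorem zero_mem_cub_TH (h : x ∈ D.TH) (hx : x ≠ root) : 0 ∈ x.cub := by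
  obtain ⟨h1, s, t, r, -, -, h4⟩ := h
  rw [h4]
  exact ⟨zero_mem_club s t r, pos_iff_ne_zero.2 (mem_T_ne_root h1 hx).1⟩

theorem res_mem_TH (h : x ∈ D.TH) (hγ : γ ∈ x.cub) (h0 : γ ≠ 0) (hs : x.Split γ) :
    x.res γ ∈ D.TH := by
  obtain ⟨h1, s, t, r, h2, h3, h4⟩ := h
  have hlt := lt_ord_of_mem_cub h1 hγ
  refine ⟨res_mem_T h1 hlt.le h0 hs, s, t, r, ?_, ?_, ?_⟩
  · intro ξ hξ
    rw [res_ord] at hξ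
    rw [res_fst x h0 hξ, res_snd x h0 hξ, res_trd x h0 hξ]
    exact h2 ξ (hξ.trans (bethOrd_lt.2 hlt))
  · rw [res_ord]
    rw [h4] at hγ
    exact hγ.1
  · rw [res_cub, res_ord, h4, inter_assoc, Iio_inter_Iio, min_eq_right hlt.le]

/-- The conditions under which an element of `T^<` is put into `T_G`, relative to a set `S` of
nodes already there. -/
def GenCond (D : Data.{u}) (S : Set Node.{u}) (x : Node.{u}) : Prop :=
  (sSup x.cub < x.ord → x.ord ∈ GInds D.κ ∧
    ∃ γ, IsGreatest x.cub γ ∧ D.bk x.ord = x.res γ ∧ x.res γ ∈ D.TH ∪ S) ∧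
  (sSup x.cub = x.ord → (x.cub ∩ GInds D.κ).Nonempty ∧ x.ord.cof < D.lam ∧
    ∀ β ∈ x.cub, x.res β ∈ D.TH ∪ S)

theorem GenCond.mono {S S' : Set Node.{u}} (hS : S ⊆ S') (h : D.GenCond S x) :
    D.GenCond S' x := by
  have hu : D.TH ∪ S ⊆ D.TH ∪ S' := union_subset_union_right _ hS
  refine ⟨fun hlt => ?_, fun he => ?_⟩
  · obtain ⟨h1, γ, h2, h3, h4⟩ := h.1 hlt
    exact ⟨h1, γ, h2, h3, hu h4⟩
  · obtain ⟨h1, h2, h3⟩ := h.2 he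
    exact ⟨h1, h2, fun β hβ => hu (h3 β hβ)⟩

theorem tgClosed_univ (H : D.Admissible) : D.TGClosed (T D.κ) :=
  ⟨Subset.rfl, root_mem_T H.inacc.ne_zero, fun _ h => inv_mem_T h, fun _ h _ _ => h.1⟩

theorem TG_subset_T (H : D.Admissible) : D.TG ⊆ T D.κ := sInter_subset_of_mem (tgClosed_univ H)

theorem root_mem_TG : root ∈ D.TG := fun _ hS => hS.2.1

theorem inv_mem_TG (h : x ∈ D.TG) : x.inv ∈ D.TG := fun S hS => hS.2.2.1 x (h S hS)

theorem mem_TG_of_genCond (hx : x ∈ TLex D.κ) (h : D.GenCond D.TG x) : x ∈ D.TG := by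
  intro S hS
  have := h.mono (show D.TG ⊆ S from sInter_subset_of_mem hS)
  exact hS.2.2.2 x hx this.1 this.2

/-- Every element of `T_G` was put there by one of the closure conditions. -/
theorem TG_cases (H : D.Admissible) (h : x ∈ D.TG) : x = root ∨
    (x ∈ TLex D.κ ∧ D.GenCond D.TG x) ∨ (x.inv ∈ TLex D.κ ∧ D.GenCond D.TG x.inv) := by
  let S : Set Node.{u} := {x | x ∈ D.TG ∧ (x = root ∨
    (x ∈ TLex D.κ ∧ D.GenCond D.TG x) ∨ (x.inv ∈ TLex D.κ ∧ D.GenCond D.TG x.inv))}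
  suffices hS : D.TGClosed S from (h S hS).2
  refine ⟨fun x hx => TG_subset_T H hx.1, ⟨root_mem_TG, Or.inl rfl⟩, ?_, ?_⟩
  · rintro x ⟨hx, h1 | h1 | h1⟩
    · exact ⟨inv_mem_TG hx, Or.inl (by rw [h1]; rfl)⟩
    · exact ⟨inv_mem_TG hx, Or.inr (Or.inr h1)⟩
    · exact ⟨inv_mem_TG hx, Or.inr (Or.inl h1)⟩
  · intro x hx h1 h2
    have hc : D.GenCond D.TG x := GenCond.mono (S := S) (fun _ hy => hy.1) ⟨h1, h2⟩
    exact ⟨mem_TG_of_genCond hx hc, Or.inr (Or.inl ⟨hx, hc⟩)⟩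

theorem inv_mem_TH_union_TG (H : D.Admissible) (h : x ∈ D.TH ∪ D.TG) : x.inv ∈ D.TH ∪ D.TG :=
  h.imp (inv_mem_TH H) inv_mem_TG

theorem TH_union_TG_subset_T (H : D.Admissible) : D.TH ∪ D.TG ⊆ T D.κ :=
  union_subset (fun _ h => h.1) (TG_subset_T H)

theorem sSup_cub_le (h : x ∈ T D.κ) : sSup x.cub ≤ x.ord :=
  csSup_le' fun _ hγ => (lt_ord_of_mem_cub h hγ).le

/-- The two kinds of elements of `T_G`, in a form symmetric in the first two components. -/
theorem TG_kinds (H : D.Admissible) (h : x ∈ D.TG) (hx : x ≠ root) :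
    (x.ord ∈ GInds D.κ ∧ ∃ γ, IsGreatest x.cub γ ∧ (x ∈ TLex D.κ → D.bk x.ord = x.res γ) ∧
      x.res γ ∈ D.TH ∪ D.TG) ∨
    (sSup x.cub = x.ord ∧ (x.cub ∩ GInds D.κ).Nonempty ∧ x.ord.cof < D.lam ∧
      ∀ β ∈ x.cub, x.res β ∈ D.TH ∪ D.TG) := by
  have key : ∀ x ∈ T D.κ, D.GenCond D.TG x →
    (x.ord ∈ GInds D.κ ∧ ∃ γ, IsGreatest x.cub γ ∧ D.bk x.ord = x.res γ ∧
      x.res γ ∈ D.TH ∪ D.TG) ∨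
    (sSup x.cub = x.ord ∧ (x.cub ∩ GInds D.κ).Nonempty ∧ x.ord.cof < D.lam ∧
      ∀ β ∈ x.cub, x.res β ∈ D.TH ∪ D.TG) := by
    intro x hxT hc
    rcases (sSup_cub_le hxT).lt_or_eq with h1 | h1
    · exact Or.inl (hc.1 h1)
    · exact Or.inr ⟨h1, hc.2 h1⟩
  rcases TG_cases H h with h1 | ⟨h1, h2⟩ | ⟨h1, h2⟩
  · exact absurd h1 hx
  · rcases key x h1.1 h2 with ⟨h3, γ, h4, h5, h6⟩ | h3
    · exact Or.inl ⟨h3, γ, h4, fun _ => h5, h6⟩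
    · exact Or.inr h3
  · rcases key x.inv h1.1 h2 with ⟨h3, γ, h4, h5, h6⟩ | ⟨h3, h4, h5, h6⟩
    · refine Or.inl ⟨h3, γ, h4, fun hl => absurd h1 (not_mem_TLex_inv hl), ?_⟩
      have := inv_mem_TH_union_TG H h6
      rwa [inv_res] at this
    · refine Or.inr ⟨h3, h4, h5, fun β hβ => ?_⟩
      have := inv_mem_TH_union_TG H (h6 β hβ)
      rwa [inv_res] at this

/-- Restrictions of elements of `T_H ∪ T_G` to members of their closed sets. -/
theorem res_mem_TH_union_TG (H : D.Admissible) (h : x ∈ D.TH ∪ D.TG) (hγ : γ ∈ x.cub)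
    (h0 : γ ≠ 0) (hs : x.Split γ) : x.res γ ∈ D.TH ∪ D.TG := by
  induction hα : x.ord using WellFoundedLT.induction generalizing x with
  | _ α ih =>
  subst hα
  have hT := TH_union_TG_subset_T H h
  have hx : x ≠ root := by rintro rfl; exact absurd hγ (by simp [root])
  rcases h with h | h
  · exact Or.inl (res_mem_TH h hγ h0 hs)
  rcases TG_kinds H h hx with ⟨h3, γ', h4, -, h6⟩ | ⟨-, -, -, h6⟩
  · rcases (h4.2 hγ).lt_or_eq with hlt | rfl
    · have h' := ih _ (by rw [res_ord]; exact lt_ord_of_mem_cub hT h4.1) h6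
        (by rw [res_cub]; exact ⟨hγ, hlt⟩) (by
          obtain ⟨ξ, hξ, hne⟩ := hs
          have hγ'0 : γ' ≠ 0 := (pos_of_gt hlt).ne'
          have hξ' := hξ.trans (bethOrd_lt.2 hlt)
          exact ⟨ξ, hξ, by rwa [res_fst x hγ'0 hξ', res_snd x hγ'0 hξ']⟩) rfl
      rwa [res_res x hlt.le] at h'
    · exact h6
  · exact h6 γ hγ

theorem zero_mem_cub (H : D.Admissible) (h : x ∈ D.TH ∪ D.TG) (hx : x ≠ root) : 0 ∈ x.cub := by
  induction hα : x.ord using WellFoundedLT.induction generalizing x with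
  | _ α ih =>
  subst hα
  have hT := TH_union_TG_subset_T H h
  rcases h with h | h
  · exact zero_mem_cub_TH h hx
  -- if `0` lies in the closed set of a restriction of `x`, then it lies in that of `x`
  have key : ∀ γ ∈ x.cub, x.res γ ∈ D.TH ∪ D.TG → 0 ∈ x.cub := by
    intro γ hγ hres
    rcases eq_or_ne γ 0 with rfl | h0
    · exact hγ
    have := ih _ (by rw [res_ord]; exact lt_ord_of_mem_cub hT hγ) hres (by
      intro he
      have := congrArg Node.ord he
      rw [res_ord] at this
      exact h0 this) rfl
    rw [res_cub] at this
    exact this.1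
  rcases TG_kinds H h hx with ⟨h3, γ', h4, -, h6⟩ | ⟨-, ⟨γ, hγ, -⟩, -, h6⟩
  · exact key γ' h4.1 h6
  · exact key γ hγ (h6 γ hγ)

/-! ### The restricted tree `U` -/

theorem U_subset_T (H : D.Admissible) : D.U ⊆ T D.κ := fun _ h => TH_union_TG_subset_T H h.1

theorem root_mem_U (H : D.Admissible) : root ∈ D.U := ⟨Or.inl (root_mem_TH H), Or.inl rfl⟩

theorem inv_mem_U (H : D.Admissible) (h : x ∈ D.U) : x.inv ∈ D.U := by
  refine ⟨inv_mem_TH_union_TG H h.1, h.2.imp (fun h => by rw [h]; rfl) fun h => ?_⟩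
  exact ⟨h.2.1, h.1, h.2.2⟩

theorem inv_mem_U_iff (H : D.Admissible) : x.inv ∈ D.U ↔ x ∈ D.U :=
  ⟨fun h => inv_mem_U H h, inv_mem_U H⟩

theorem res_mem_U_of_mem (h : x ∈ D.U) (hγ : γ ≤ x.ord) (hres : x.res γ ∈ D.TH ∪ D.TG) :
    x.res γ ∈ D.U := by
  refine ⟨hres, ?_⟩
  rcases eq_or_ne γ 0 with rfl | h0
  · exact Or.inl (res_zero x)
  rcases h.2 with rfl | ⟨h1, h2, h3⟩
  · exact absurd (by simpa [root] using hγ) h0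
  · rw [res_ord, res_of_ne x h0]
    exact Or.inr ⟨h1.cut hγ, h2.cut hγ, h3.cut hγ⟩

theorem res_mem_U (H : D.Admissible) (h : x ∈ D.U) (hγ : γ ∈ x.cub) (h0 : γ ≠ 0)
    (hs : x.Split γ) : x.res γ ∈ D.U :=
  res_mem_U_of_mem h (lt_ord_of_mem_cub (U_subset_T H h) hγ).le
    (res_mem_TH_union_TG H h.1 hγ h0 hs)

theorem not_below_root : ¬ y.Below root := fun h => by simpa [root] using h.2

theorem SuccOf.unique (h : D.SuccOf x y) (h' : D.SuccOf x z) : y = z := by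
  rcases lt_trichotomy y.ord z.ord with h1 | h1 | h1
  · exact absurd ⟨z, h'.2.1, below_of_lt h.2.2.1 h'.2.2.1 h1, h'.2.2.1⟩ h.2.2.2
  · exact eq_of_ord_eq h.2.2.1 h'.2.2.1 h1
  · exact absurd ⟨y, h.2.1, below_of_lt h'.2.2.1 h.2.2.1 h1, h.2.2.1⟩ h'.2.2.2

theorem SuccOf.eq_or_below (h : D.SuccOf x v) (hy : y ∈ D.U) (hyx : y.Below x) :
    y = v ∨ y.Below v := by
  rcases lt_trichotomy y.ord v.ord with h1 | h1 | h1
  · exact Or.inr (below_of_lt hyx h.2.2.1 h1)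
  · exact Or.inl (eq_of_ord_eq hyx h.2.2.1 h1)
  · exact absurd ⟨y, hy, below_of_lt h.2.2.1 hyx h1, hyx⟩ h.2.2.2

theorem SuccOf.ord_lt (H : D.Admissible) (h : D.SuccOf x y) : y.ord < x.ord :=
  h.2.2.1.ord_lt (U_subset_T H h.1)

theorem SuccOf.ne_root (h : D.SuccOf x y) : x ≠ root := by
  rintro rfl
  exact not_below_root h.2.2.1

theorem SuccOf.inv (H : D.Admissible) (h : D.SuccOf x y) : D.SuccOf x.inv y.inv := by
  refine ⟨inv_mem_U H h.1, inv_mem_U H h.2.1, h.2.2.1.inv, ?_⟩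
  rintro ⟨z, hz, h1, h2⟩
  exact h.2.2.2 ⟨z.inv, inv_mem_U H hz, h1.inv, h2.inv⟩

/-- A restriction to the greatest admissible member of the closed set is the predecessor. -/
theorem succOf_of_isGreatest (H : D.Admissible) (h : x ∈ D.U)
    (hγ : IsGreatest {γ | γ ∈ x.cub ∧ x.res γ ∈ D.U} γ) : D.SuccOf x (x.res γ) := by
  refine ⟨h, hγ.1.2, res_below hγ.1.1, ?_⟩
  rintro ⟨z, hz, h1, h2⟩
  have h3 := h1.ord_lt (U_subset_T H hz)
  rw [res_ord] at h3
  exact absurd (hγ.2 ⟨h2.2, by rw [← h2.1]; exact hz⟩) (not_le.2 h3)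

/-- Every element of `U` other than the root is a successor or a limit in the tree `U`. -/
theorem succ_or_limit (H : D.Admissible) (h : x ∈ D.U) (hx : x ≠ root) :
    (∃ y, D.SuccOf x y) ∨ ∀ α < x.ord, ∃ y ∈ D.U, y.Below x ∧ α < y.ord := by
  have hT := U_subset_T H h
  let A : Set Ordinal.{u} := {γ | γ ∈ x.cub ∧ x.res γ ∈ D.U}
  have h0 : 0 ∈ A := ⟨zero_mem_cub H h.1 hx, by rw [res_zero]; exact root_mem_U H⟩
  have hAlt : ∀ γ ∈ A, γ < x.ord := fun γ hγ => lt_ord_of_mem_cub hT hγ.1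
  have hbdd : BddAbove A := ⟨x.ord, fun γ hγ => (hAlt γ hγ).le⟩
  by_cases hmem : sSup A ∈ A
  · exact Or.inl ⟨_, succOf_of_isGreatest H h ⟨hmem, fun γ hγ => le_csSup hbdd hγ⟩⟩
  right
  have hAne : A.Nonempty := ⟨0, h0⟩
  have hle : sSup A ≤ x.ord := csSup_le hAne fun γ hγ => (hAlt γ hγ).le
  rcases hle.lt_or_eq with hlt | he
  · exfalso
    have hcub : sSup A ∈ x.cub :=
      (mem_T_ne_root hT hx).2.2.2.2 A (fun γ hγ => hγ.1) hAne hlt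
    have hpos : 0 < sSup A := by
      rcases (le_csSup hbdd h0).lt_or_eq with h1 | h1
      · exact h1
      · rw [← h1] at hmem; exact absurd h0 hmem
    obtain ⟨γ, hγ, hγ0⟩ := exists_lt_of_lt_csSup hAne hpos
    have hs : x.Split γ := split_of_res_mem_T hγ0.ne' (U_subset_T H hγ.2)
    exact hmem ⟨hcub, res_mem_U H h hcub hpos.ne' (hs.mono (le_csSup hbdd hγ))⟩
  · intro α hα
    rw [← he] at hα
    obtain ⟨γ, hγ, hαγ⟩ := exists_lt_of_lt_csSup hAne hα
    exact ⟨_, hγ.2, res_below hγ.1, by rwa [res_ord]⟩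

theorem not_succ_of_limit (h : ∀ α < x.ord, ∃ y ∈ D.U, y.Below x ∧ α < y.ord)
    (H : D.Admissible) : ¬ ∃ y, D.SuccOf x y := by
  rintro ⟨y, hy⟩
  obtain ⟨z, hz, h1, h2⟩ := h _ (hy.ord_lt H)
  exact hy.2.2.2 ⟨z, hz, below_of_lt hy.2.2.1 h1 h2, h1⟩

/-- Elements of `U` below an element of `T^<` are the root or in `T^<`. -/
theorem below_root_or_TLex (H : D.Admissible) (hx : x ∈ TLex D.κ) (hy : y ∈ D.U)
    (h : y.Below x) : y = root ∨ y ∈ TLex D.κ := by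
  by_cases hr : y = root
  · exact Or.inl hr
  right
  have hyT := U_subset_T H hy
  have h0 := (mem_T_ne_root hyT hr).1
  rw [h.1] at hyT ⊢
  exact (res_mem_TLex_iff hx.1 (h.ord_lt hx.1).le h0 (split_of_res_mem_T h0 hyT)).2 hx

end Data

/-! ### The ordinals chosen at successors -/

namespace Data

variable {D : Data.{u}} {x x' y y' z v w : Node.{u}} {α β β' γ : Ordinal.{u}}

theorem mk_Iio_bethOrd (α : Ordinal.{u}) : #(Iio (bethOrd α)) = Cardinal.lift.{u + 1} (ℶ_ α) := by
  rw [Cardinal.mk_Iio_ordinal, bethOrd, Cardinal.card_ord]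

/-- There are fewer than `c` elements of `U` of height at most `α`, when `c` is a limit of beth
numbers above `α`. -/
theorem mk_U_le_lt (H : D.Admissible) {c : Cardinal.{u}} (hc : ∀ α < c.ord, bethOrd α < c.ord)
    (hlim : Order.IsSuccLimit c.ord) (hcκ : c ≤ D.κ) (hα : α < c.ord) :
    #{w : Node.{u} | w ∈ D.U ∧ w.ord ≤ α} < Cardinal.lift.{u + 1} c := by
  have hακ : α < D.κ.ord := hα.trans_le (Cardinal.ord_le_ord.2 hcκ)
  let f : Iio (Order.succ α) × Iio (bethOrd (Order.succ α)) → Node.{u} := fun p =>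
    D.enum p.1.1 p.2.1
  have hsub : {w : Node.{u} | w ∈ D.U ∧ w.ord ≤ α} ⊆ range f := by
    rintro w ⟨hw, hle⟩
    have hT := (mem_T_iff.1 (U_subset_T H hw)).2
    obtain ⟨h1, h2⟩ := H.enum w.ord (hle.trans_lt hακ)
    obtain ⟨i, hi, hiw⟩ := h2.surjOn hT
    refine ⟨⟨⟨w.ord, Order.lt_succ_iff.2 hle⟩, ⟨i, ?_⟩⟩, hiw⟩
    exact (lt_of_lt_of_le hi h1).trans_le (bethOrd_le.2 (Order.succ_le_succ hle))
  refine (Cardinal.mk_le_mk_of_subset hsub).trans_lt (Cardinal.mk_range_le.trans_lt ?_)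
  rw [Cardinal.mk_prod, Cardinal.lift_id, Cardinal.lift_id, mk_Iio_bethOrd,
    Cardinal.mk_Iio_ordinal, ← Cardinal.lift_mul, Cardinal.lift_lt]
  have h1 : (Order.succ α).card * ℶ_ (Order.succ α) ≤ ℶ_ (Order.succ α) := by
    refine (mul_le_mul_left (Ordinal.card_le_beth _) _).trans ?_
    rw [Cardinal.mul_eq_self (Cardinal.aleph0_le_beth _)]
  refine h1.trans_lt (Cardinal.ord_lt_ord.1 ?_)
  exact hc _ (hlim.succ_lt hα)

theorem wf_prec (H : D.Admissible) :
    WellFounded (fun x y : D.U => D.Prec x.1 y.1) := by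
  rw [WellFounded.wellFounded_iff_has_min]
  intro S hS
  let O : Set Ordinal.{u} := (fun x : D.U => x.1.ord) '' S
  have hO : O.Nonempty := hS.image _
  obtain ⟨x₀, hx₀, hx₀O⟩ := csInf_mem hO
  have hmin : ∀ x ∈ S, sInf O ≤ x.1.ord := fun x hx => csInf_le' ⟨x, hx, rfl⟩
  have hwo := H.order (sInf O) (by
    rw [← hx₀O]; exact ord_lt_of_mem_T (U_subset_T H x₀.2))
  let S' : Set {x : Node.{u} // x ∈ D.U ∧ x.ord = sInf O} := {x | (⟨x.1, x.2.1⟩ : D.U) ∈ S}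
  obtain ⟨m, hm, hmm⟩ := hwo.toIsWellFounded.wf.has_min S' ⟨⟨x₀.1, x₀.2, hx₀O⟩, hx₀⟩
  refine ⟨⟨m.1, m.2.1⟩, hm, ?_⟩
  rintro x hx (h | ⟨h1, h2⟩)
  · rw [m.2.2] at h
    exact absurd h (not_lt.2 (hmin x hx))
  · have h3 : x.1.ord = sInf O := h1.trans m.2.2
    rw [h3] at h2
    exact hmm ⟨x.1, x.2, h3⟩ hx h2

theorem prec_trichotomy (H : D.Admissible) (hx : x ∈ D.U) (hy : y ∈ D.U) :
    D.Prec x y ∨ x = y ∨ D.Prec y x := by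
  rcases lt_trichotomy x.ord y.ord with h | h | h
  · exact Or.inl (Or.inl h)
  · have hwo := H.order x.ord (ord_lt_of_mem_T (U_subset_T H hx))
    rcases hwo.toTrichotomous.rel_or_eq_or_rel_swap (a := ⟨x, hx, rfl⟩)
      (b := ⟨y, hy, h.symm⟩) with h1 | h1 | h1
    · exact Or.inl (Or.inr ⟨h, h1⟩)
    · exact Or.inr (Or.inl (congrArg (fun z : {x' : Node.{u} // x' ∈ D.U ∧ x'.ord = x.ord} =>
        z.1) h1))
    · exact Or.inr (Or.inr (Or.inr ⟨h.symm, by rw [← h]; exact h1⟩))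
  · exact Or.inr (Or.inr (Or.inl h))

theorem Prec.ord_le (h : D.Prec x y) : x.ord ≤ y.ord := h.elim (fun h => h.le) fun h => h.1.le

/-- The set of which `b w` is the least element, in the recursion along the well-ordering
of `U`. -/
def reflSet (D : Data.{u}) (x : Node.{u}) (b : Node.{u} → Ordinal.{u}) (w : Node.{u}) :
    Set Ordinal.{u} :=
  {β | β < D.κ.ord ∧ Order.IsSuccLimit β ∧ β ∉ dom (idPart x) ∧ w.ord < β ∧
    ∀ w' ∈ D.U, D.Prec w' w → b w' ≠ β}

theorem exists_mem_reflSet (H : D.Admissible) {c : Cardinal.{u}} (hω : ℵ₀ < c)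
    (hc : ∀ α < c.ord, bethOrd α < c.ord) (hcκ : c ≤ D.κ) {θ : Ordinal.{u}} (hθ : θ < c.ord)
    (hx : dom (idPart x) ⊆ Iio θ) (hw : w.ord < c.ord) (b : Node.{u} → Ordinal.{u}) :
    ∃ β < c.ord, β ∈ D.reflSet x b w := by
  have hlim : Order.IsSuccLimit c.ord := Cardinal.isSuccLimit_ord hω.le
  obtain ⟨β, h1, h2, h3, h4⟩ := exists_limit_not_mem hω (θ := max θ w.ord) (max_lt hθ hw)
    (E := b '' {w' | w' ∈ D.U ∧ w'.ord ≤ w.ord})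
    (Cardinal.mk_image_le.trans_lt (mk_U_le_lt H hc hlim hcκ hw))
  obtain ⟨h3, h5⟩ := max_lt_iff.1 h3
  refine ⟨β, h1, h1.trans_le (Cardinal.ord_le_ord.2 hcκ), h2, fun hd => lt_asymm h3 (hx hd), h5,
    fun w' hw' hp he => h4 ⟨w', ⟨hw', hp.ord_le⟩, he⟩⟩

theorem bethOrd_lt_kappa (H : D.Admissible) : ∀ α < D.κ.ord, bethOrd α < D.κ.ord :=
  fun _ hα => bethOrd_lt_ord H.inacc hα

theorem exists_reflection (H : D.Admissible) {θ : Ordinal.{u}} (hθ : θ < D.κ.ord)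
    (hx : dom (idPart x) ⊆ Iio θ) : ∃ b, D.IsReflection x b := by
  classical
  let F : ∀ w : D.U, (∀ w' : D.U, D.Prec w'.1 w.1 → Ordinal.{u}) → Ordinal.{u} := fun w f =>
    sInf {β | β < D.κ.ord ∧ Order.IsSuccLimit β ∧ β ∉ dom (idPart x) ∧ w.1.ord < β ∧
      ∀ (w' : D.U) (h : D.Prec w'.1 w.1), f w' h ≠ β}
  let g : D.U → Ordinal.{u} := (wf_prec H).fix F
  have hg : ∀ w, g w = F w fun w' _ => g w' := fun w => (wf_prec H).fix_eq F w
  let b : Node.{u} → Ordinal.{u} := fun w => if h : w ∈ D.U then g ⟨w, h⟩ else 0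
  have hb : ∀ w : D.U, b w.1 = g w := fun w => dif_pos w.2
  refine ⟨b, fun w hw => ?_⟩
  have hset : D.reflSet x b w = {β | β < D.κ.ord ∧ Order.IsSuccLimit β ∧ β ∉ dom (idPart x) ∧
      w.ord < β ∧ ∀ (w' : D.U), D.Prec w'.1 w → g w' ≠ β} := by
    ext β
    simp only [reflSet, mem_ofPred_eq]
    refine and_congr_right fun _ => and_congr_right fun _ => and_congr_right fun _ =>
      and_congr_right fun _ => ⟨fun h w' hp => ?_, fun h w' hw' hp => ?_⟩
    · rw [← hb]; exact h w'.1 w'.2 hp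
    · have := h ⟨w', hw'⟩ hp
      rwa [← hb] at this
  change IsLeast (D.reflSet x b w) (b w)
  have hbw : b w = sInf (D.reflSet x b w) := by
    rw [hset, hb ⟨w, hw⟩, hg]
  rw [hbw]
  obtain ⟨β, -, hβ⟩ := exists_mem_reflSet H H.inacc.aleph0_lt (bethOrd_lt_kappa H) le_rfl hθ hx
    (ord_lt_of_mem_T (U_subset_T H hw)) b
  exact ⟨csInf_mem ⟨β, hβ⟩, fun β hβ => csInf_le' hβ⟩

variable {b b' : Node.{u} → Ordinal.{u}}

theorem IsReflection.unique (H : D.Admissible) (h : D.IsReflection x b)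
    (h' : D.IsReflection x' b') (hd : dom (idPart x) = dom (idPart x')) (hw : w ∈ D.U) :
    b w = b' w := by
  suffices ∀ w : D.U, b w.1 = b' w.1 from this ⟨w, hw⟩
  intro w
  induction w using (wf_prec H).induction with
  | _ w ih =>
  have h1 := h w.1 w.2
  have h2 := h' w.1 w.2
  refine h1.unique ?_
  convert h2 using 1
  ext β
  simp only [mem_ofPred_eq, hd]
  refine and_congr_right fun _ => and_congr_right fun _ => and_congr_right fun _ =>
      and_congr_right fun _ => ⟨fun h w' hw' hp => ?_, fun h w' hw' hp => ?_⟩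
  · rw [← ih ⟨w', hw'⟩ hp]; exact h w' hw' hp
  · rw [ih ⟨w', hw'⟩ hp]; exact h w' hw' hp

theorem IsReflection.injOn (H : D.Admissible) (h : D.IsReflection x b) (hw : w ∈ D.U)
    (hv : v ∈ D.U) (he : b w = b v) : w = v := by
  rcases prec_trichotomy H hw hv with h1 | h1 | h1
  · exact absurd he ((h v hv).1.2.2.2.2 w hw h1)
  · exact h1
  · exact absurd he.symm ((h w hw).1.2.2.2.2 v hv h1)

theorem dom_idPart_subset {ξ : Ordinal.{u}} (h : x.fst ξ ≠ x.snd ξ) :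
    dom (idPart x) ⊆ Iio ξ := by
  rintro ζ ⟨ζ', h1, h2, h3⟩
  exact not_le.1 fun hle => h (h3 ξ hle)

theorem mem_idPart {ξ ζ : Ordinal.{u}} :
    (ξ, ζ) ∈ idPart x ↔ ξ = ζ ∧ ξ < bethOrd x.ord ∧ ∀ ζ ≤ ξ, x.fst ζ = x.snd ζ := Iff.rfl

/-- The identity part of a node is that of any restriction on which the first two components
differ. -/
theorem idPart_res (hβ : β ≤ x.ord) (h0 : β ≠ 0) (hs : x.Split β) :
    idPart (x.res β) = idPart x := by
  obtain ⟨ξ₀, hξ₀, hne⟩ := hs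
  ext ⟨ξ, ζ⟩
  rw [mem_idPart, mem_idPart, res_ord]
  refine and_congr_right fun _ => ⟨fun ⟨h1, h2⟩ => ⟨h1.trans_le (bethOrd_le.2 hβ), ?_⟩,
    fun ⟨h1, h2⟩ => ?_⟩
  · intro ζ hζ
    have := h2 ζ hζ
    rwa [res_fst x h0 (hζ.trans_lt h1), res_snd x h0 (hζ.trans_lt h1)] at this
  · have h3 : ξ < bethOrd β := by
      refine lt_trans (not_le.1 fun hle => hne (h2 ξ₀ hle)) hξ₀
    refine ⟨h3, fun ζ hζ => ?_⟩
    rw [res_fst x h0 (hζ.trans_lt h3), res_snd x h0 (hζ.trans_lt h3)]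
    exact h2 ζ hζ

/-- For an element `x` of `U_H` the reflection ordinals of nodes of smaller height lie
below `ord x`, because `ord x` is a cardinal closed under `ℶ`: below it there are too few nodes to
exhaust the limit ordinals. -/
theorem IsReflection.lt_ord (H : D.Admissible) (hx : x ∈ D.UH) (hr : x ≠ root)
    (h : D.IsReflection x b) (hw : w ∈ D.U) (hwx : w.ord < x.ord) : b w < x.ord := by
  obtain ⟨-, hω, hc, hb⟩ := fixed_of_mem_TH H hx.1 hr
  have hT : x ∈ T D.κ := hx.1.1
  obtain ⟨ξ, hξ, hne⟩ := split_of_mem_T hT hr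
  have hlim := (fixed_of_mem_TH H hx.1 hr).1
  have hξx : ξ < x.ord := by
    have hn : Order.IsNormal bethOrd.{u} := Cardinal.isNormal_ord.comp Cardinal.isNormal_beth
    rw [hn.lt_iff_exists_lt hlim] at hξ
    obtain ⟨α, hα, hξα⟩ := hξ
    exact hξα.trans (hb α hα)
  have hcκ : x.ord.card ≤ D.κ := by
    rw [← Cardinal.ord_le_ord, hc]
    exact (ord_lt_of_mem_T hT).le
  obtain ⟨β, h1, h2⟩ := exists_mem_reflSet H (c := x.ord.card) (x := x) (w := w)
    (by rw [← Cardinal.ord_lt_ord, hc, Cardinal.ord_aleph0]; exact hω)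
    (by rwa [hc]) hcκ (θ := ξ) (by rwa [hc]) (dom_idPart_subset hne) (by rwa [hc]) b
  rw [hc] at h1
  exact ((h w hw).2 h2).trans_lt h1

/-! ### The ordinal fixed for a successor in the tree -/

/-- For successors in `U_H` the fixed ordinal is a limit, and for those in `U_G` it is a successor;
in the second case the bookkeeping function recovers the predecessor from it. -/
theorem reflectsAt_kinds (H : D.Admissible) (hs : D.SuccOf x y) (h : D.ReflectsAt x y β) :
    (x ∈ D.UH ∧ Order.IsSuccLimit β ∧ y.ord < β ∧ β < x.ord) ∨
    (x ∈ D.UG ∧ x.ord = Order.succ β ∧ (∃ γ, β = Order.succ γ) ∧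
      (x ∈ TLex D.κ → D.bk (Order.succ β) = y)) := by
  rcases h with ⟨h1, b, hb, rfl⟩ | ⟨h1, h2⟩
  · obtain ⟨-, h3, -, h4, -⟩ := (hb y hs.2.1).1
    exact Or.inl ⟨h1, h3, h4, hb.lt_ord H h1 hs.ne_root hs.2.1 (hs.ord_lt H)⟩
  · right
    refine ⟨h1, h2, ?_⟩
    have hT := U_subset_T H hs.1
    rcases TG_kinds H h1.1 hs.ne_root with ⟨⟨-, γ, hγ⟩, γ', hg, hbk, hres⟩ | ⟨he, hne, -, -⟩
    · refine ⟨⟨γ, Order.succ_injective (h2.symm.trans hγ)⟩, fun hl => ?_⟩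
      have hU := res_mem_U_of_mem hs.1 (lt_ord_of_mem_cub hT hg.1).le hres
      have := succOf_of_isGreatest H hs.1 (γ := γ') ⟨⟨hg.1, hU⟩, fun δ hδ => hg.2 hδ.1⟩
      rw [← h2, hbk hl]
      exact this.unique hs
    · exfalso
      have : sSup x.cub ≤ β := csSup_le' fun γ hγ =>
        Order.lt_succ_iff.1 (by rw [← h2]; exact lt_ord_of_mem_cub hT hγ)
      rw [he, h2] at this
      exact absurd (Order.lt_succ β) (not_lt.2 this)

theorem exists_reflectsAt (H : D.Admissible) (hs : D.SuccOf x y) : ∃ β, D.ReflectsAt x y β := by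
  have hT := U_subset_T H hs.1
  rcases hs.1.1 with h | h
  · obtain ⟨ξ, hξ, hne⟩ := split_of_mem_T hT hs.ne_root
    have hξκ : ξ < D.κ.ord := hξ.trans (bethOrd_lt_kappa H _ (ord_lt_of_mem_T hT))
    obtain ⟨b, hb⟩ := exists_reflection H hξκ (dom_idPart_subset hne)
    exact ⟨b y, Or.inl ⟨⟨h, hs.1⟩, b, hb, rfl⟩⟩
  · rcases TG_kinds H h hs.ne_root with ⟨⟨-, γ, hγ⟩, -⟩ | ⟨he, hne, -, hall⟩
    · exact ⟨Order.succ γ, Or.inr ⟨⟨h, hs.1⟩, hγ⟩⟩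
    · exfalso
      refine not_succ_of_limit (fun α hα => ?_) H ⟨y, hs⟩
      rw [← he] at hα
      obtain ⟨γ, hγ, hαγ⟩ := exists_lt_of_lt_csSup (hne.mono inter_subset_left) hα
      exact ⟨x.res γ, res_mem_U_of_mem hs.1 (lt_ord_of_mem_cub hT hγ).le (hall γ hγ),
        res_below hγ, by rwa [res_ord]⟩

theorem limit_ne_succ (h : Order.IsSuccLimit (Order.succ γ)) : False :=
  h.isSuccPrelimit.succ_ne γ rfl

theorem reflectsAt_unique (H : D.Admissible) (hs : D.SuccOf x y) (h : D.ReflectsAt x y β)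
    (h' : D.ReflectsAt x y β') : β = β' := by
  have excl : x ∈ D.UH → ∀ γ, x.ord ≠ Order.succ γ := fun h1 γ h2 => by
    have := (fixed_of_mem_TH H h1.1 hs.ne_root).1
    rw [h2] at this
    exact limit_ne_succ this
  rcases h with ⟨h1, b, hb, rfl⟩ | ⟨h1, h2⟩ <;> rcases h' with ⟨h1', b', hb', rfl⟩ | ⟨h1', h2'⟩
  · exact hb.unique H hb' rfl hs.2.1
  · exact absurd h2' (excl h1 _)
  · exact absurd h2 (excl h1' _)
  · exact Order.succ_injective (h2.symm.trans h2')

theorem reflectsAt_lt (H : D.Admissible) (hs : D.SuccOf x y) (h : D.ReflectsAt x y β) :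
    y.ord ≤ β ∧ β < x.ord ∧ β ≠ 0 := by
  rcases reflectsAt_kinds H hs h with ⟨-, h1, h2, h3⟩ | ⟨-, h1, ⟨γ, h2⟩, -⟩
  · exact ⟨h2.le, h3, fun h0 => h1.ne_bot h0⟩
  · have := hs.ord_lt H
    rw [h1] at this ⊢
    refine ⟨Order.lt_succ_iff.1 this, Order.lt_succ β, ?_⟩
    rw [h2]
    exact (Order.bot_lt_succ γ).ne'

/-- The predecessor of a successor `x` can be recovered from the ordinal `β` fixed for it and the
restriction `x ↾ β`: this restriction determines `Id_x`, hence the reflection ordinals, which are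
distinct for distinct nodes. -/
theorem pred_unique (H : D.Admissible) (hs : D.SuccOf x y) (hs' : D.SuccOf x' y')
    (hx : x ∈ TLex D.κ) (hx' : x' ∈ TLex D.κ)
    (h : D.ReflectsAt x y β) (h' : D.ReflectsAt x' y' β) (hres : x.res β = x'.res β)
    (hsp : x.Split β) (hsp' : x'.Split β) : y = y' := by
  obtain ⟨-, hlt, h0⟩ := reflectsAt_lt H hs h
  obtain ⟨-, hlt', -⟩ := reflectsAt_lt H hs' h'
  have k := reflectsAt_kinds H hs h
  have k' := reflectsAt_kinds H hs' h'
  have hid : idPart x = idPart x' := by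
    rw [← idPart_res hlt.le h0 hsp, hres, idPart_res hlt'.le h0 hsp']
  rcases k with ⟨k1, k2, -⟩ | ⟨k1, k2, ⟨γ, k3⟩, k4⟩ <;>
  rcases k' with ⟨k1', k2', -⟩ | ⟨k1', k2', ⟨γ', k3'⟩, k4'⟩
  · have e1 : ∀ {x y}, D.SuccOf x y → x ∈ D.UH → D.ReflectsAt x y β →
        ∃ b, D.IsReflection x b ∧ b y = β := by
      intro x y hs hU h
      rcases h with ⟨-, h⟩ | ⟨-, h2⟩
      · exact h
      · have := (fixed_of_mem_TH H hU.1 hs.ne_root).1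
        rw [h2] at this
        exact (limit_ne_succ this).elim
    obtain ⟨b, hb, hby⟩ := e1 hs k1 h
    obtain ⟨b', hb', hby'⟩ := e1 hs' k1' h'
    refine hb.injOn H hs.2.1 hs'.2.1 ?_
    rw [hby, hb.unique H hb' (by rw [hid]) hs'.2.1, hby']
  · rw [k3'] at k2
    exact (limit_ne_succ k2).elim
  · rw [k3] at k2'
    exact (limit_ne_succ k2').elim
  · rw [← k4 hx, ← k4' hx']

end Data

/-! ### The functions `p_x` -/

/-- The set of pairs `g` is the graph of a partial injection. -/
def PInj (g : Gr.{u}) : Prop :=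
  (∀ ξ ζ ζ', (ξ, ζ) ∈ g → (ξ, ζ') ∈ g → ζ = ζ') ∧ ∀ ξ ξ' ζ, (ξ, ζ) ∈ g → (ξ', ζ) ∈ g → ξ = ξ'

section Graphs

variable {g p e : Gr.{u}} {ξ ζ β γ : Ordinal.{u}}

theorem mem_gInv : (ξ, ζ) ∈ gInv g ↔ (ζ, ξ) ∈ g := Iff.rfl

@[simp] theorem gInv_gInv : gInv (gInv g) = g := rfl

@[simp] theorem dom_gInv : dom (gInv g) = ran g := rfl

@[simp] theorem ran_gInv : ran (gInv g) = dom g := rfl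

theorem gInv_mono (h : p ⊆ g) : gInv p ⊆ gInv g := fun _ hz => h hz

theorem PInj.gInv (h : PInj g) : PInj (gInv g) :=
  ⟨fun _ _ _ h1 h2 => h.2 _ _ _ h1 h2, fun _ _ _ h1 h2 => h.1 _ _ _ h1 h2⟩

theorem pInj_empty : PInj (∅ : Gr.{u}) := ⟨fun _ _ _ h => h.elim, fun _ _ _ h => h.elim⟩

theorem mem_fUnion : (ξ, ζ) ∈ fUnion p e ↔
    (ξ, ζ) ∈ p ∨ ((ξ, ζ) ∈ e ∧ ξ ∉ dom p ∧ ζ ∉ ran p) := Iff.rfl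

theorem subset_fUnion : p ⊆ fUnion p e := fun _ h => Or.inl h

theorem gInv_fUnion : gInv (fUnion p e) = fUnion (gInv p) (gInv e) := by
  ext ⟨ξ, ζ⟩
  rw [mem_gInv, mem_fUnion, mem_fUnion, mem_gInv, mem_gInv, dom_gInv, ran_gInv,
    and_comm (a := ζ ∉ dom p)]

theorem fUnion_empty_left : fUnion ∅ e = e := by
  ext ⟨ξ, ζ⟩
  simp [mem_fUnion, dom, ran]

theorem fUnion_empty_right : fUnion p ∅ = p := by
  ext ⟨ξ, ζ⟩
  simp [mem_fUnion]

theorem PInj.fUnion (hp : PInj p) (he : PInj e) : PInj (fUnion p e) := by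
  constructor
  · rintro ξ ζ ζ' (h | ⟨h, h1, h2⟩) (h' | ⟨h', h1', h2'⟩)
    · exact hp.1 _ _ _ h h'
    · exact absurd ⟨_, h⟩ h1'
    · exact absurd ⟨_, h'⟩ h1
    · exact he.1 _ _ _ h h'
  · rintro ξ ζ ζ' (h | ⟨h, h1, h2⟩) (h' | ⟨h', h1', h2'⟩)
    · exact hp.2 _ _ _ h h'
    · exact absurd ⟨_, h⟩ h2'
    · exact absurd ⟨_, h'⟩ h2
    · exact he.2 _ _ _ h h'

theorem fUnion_eq_of_subset (hg : PInj g) (h : p ⊆ g) : fUnion p g = g := by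
  ext ⟨ξ, ζ⟩
  rw [mem_fUnion]
  refine ⟨fun h' => h'.elim (fun h1 => h h1) fun h1 => h1.1, fun h' => ?_⟩
  by_cases hp : (ξ, ζ) ∈ p
  · exact Or.inl hp
  · refine Or.inr ⟨h', ?_, ?_⟩
    · rintro ⟨ζ', hζ'⟩
      rw [hg.1 _ _ _ (h hζ') h'] at hζ'
      exact hp hζ'
    · rintro ⟨ξ', hξ'⟩
      rw [hg.2 _ _ _ (h hξ') h'] at hξ'
      exact hp hξ'

theorem mem_shift : (ξ, ζ) ∈ shift β γ ↔ ξ < bethOrd β ∧ ζ = bethOrd β * (γ + 1) + ξ := Iff.rfl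

theorem pInj_shift : PInj (shift β γ) := by
  constructor
  · rintro ξ ζ ζ' ⟨-, h⟩ ⟨-, h'⟩
    exact h.trans h'.symm
  · rintro ξ ξ' ζ ⟨-, h⟩ ⟨-, h'⟩
    exact add_left_cancel (h.symm.trans h')

end Graphs

namespace Data

variable {D : Data.{u}} {x x' y y' z v w : Node.{u}} {α β β' γ γ' ξ ζ : Ordinal.{u}}

theorem pInj_idPart : PInj (idPart x) := by
  constructor
  · rintro ξ ζ ζ' ⟨h, -⟩ ⟨h', -⟩
    exact h.symm.trans h'
  · rintro ξ ξ' ζ ⟨h, -⟩ ⟨h', -⟩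
    exact h.trans h'.symm

theorem gInv_idPart : gInv (idPart x) = idPart x.inv := by
  ext ⟨ξ, ζ⟩
  rw [mem_gInv, mem_idPart, mem_idPart]
  constructor
  · rintro ⟨rfl, h1, h2⟩
    exact ⟨rfl, h1, fun η hη => (h2 η hη).symm⟩
  · rintro ⟨rfl, h1, h2⟩
    exact ⟨rfl, h1, fun η hη => (h2 η hη).symm⟩

/-- `γ` is the index of `x ↾ β` in the enumeration of `T_β`. -/
def CodeAt (D : Data.{u}) (x : Node.{u}) (β γ : Ordinal.{u}) : Prop :=
  γ < D.len β ∧ D.enum β γ = x.res β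

theorem CodeAt.lt (H : D.Admissible) (hβ : β < D.κ.ord) (h : D.CodeAt x β γ) :
    γ < bethOrd (Order.succ β) := h.1.trans_le (H.enum β hβ).1

theorem CodeAt.mem_TLevel (H : D.Admissible) (hβ : β < D.κ.ord) (h : D.CodeAt x β γ) :
    x.res β ∈ TLevel β := by
  rw [← h.2]
  exact (H.enum β hβ).2.mapsTo h.1

theorem CodeAt.codeShift_eq (H : D.Admissible) (hβ : β < D.κ.ord) (h : D.CodeAt x β γ) :
    D.codeShift x β = shift β γ := by
  ext ⟨ξ, ζ⟩
  constructor
  · rintro ⟨γ', h1, h2, h3⟩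
    rwa [(H.enum β hβ).2.injOn h1 h.1 (h2.trans h.2.symm)] at h3
  · exact fun h3 => ⟨γ, h.1, h.2, h3⟩

theorem exists_codeAt (H : D.Admissible) (hx : x ∈ T D.κ) (hβ : β ≤ x.ord) (h0 : β ≠ 0)
    (hs : x.Split β) : ∃ γ, D.CodeAt x β γ := by
  obtain ⟨γ, hγ, he⟩ := (H.enum β (hβ.trans_lt (ord_lt_of_mem_T hx))).2.surjOn
    (res_mem_TLevel hx hβ h0 hs)
  exact ⟨γ, hγ, he⟩

theorem codeShift_eq_empty (H : D.Admissible) (hβ : β < D.κ.ord) (h0 : β ≠ 0)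
    (hs : ¬ x.Split β) : D.codeShift x β = ∅ := by
  ext ⟨ξ, ζ⟩
  simp only [mem_empty_iff_false, iff_false]
  rintro ⟨γ, h1, h2, -⟩
  exact hs (split_of_res_mem_TLevel h0 (CodeAt.mem_TLevel H hβ ⟨h1, h2⟩))

theorem pLex_succ (H : D.Admissible) (hs : D.SuccOf x y) (hr : D.ReflectsAt x y β) :
    D.pLex x = D.succStep x (D.pLex y) β := by
  ext z
  rw [pLex]
  constructor
  · rintro (⟨y', -, h1, β', h2, h3⟩ | ⟨h, -⟩)
    · obtain rfl := h1.unique hs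
      rwa [reflectsAt_unique H hs h2 hr] at h3
    · exact absurd ⟨y, hs⟩ h
  · exact fun h => Or.inl ⟨y, hs.ord_lt H, hs, β, hr, h⟩

theorem pLex_limit (H : D.Admissible) (hx : x ∈ D.U) (hs : ¬ ∃ y, D.SuccOf x y) {z} :
    z ∈ D.pLex x ↔ ∃ y ∈ D.U, y.Below x ∧ z ∈ D.pLex y := by
  rw [pLex]
  constructor
  · rintro (⟨y', -, h1, -⟩ | ⟨-, y, -, h1, h2, h3⟩)
    · exact absurd ⟨_, h1⟩ hs
    · exact ⟨y, h1, h2, h3⟩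
  · rintro ⟨y, h1, h2, h3⟩
    exact Or.inr ⟨hs, y, h2.ord_lt (U_subset_T H hx), h1, h2, h3⟩

theorem pLex_root (H : D.Admissible) : D.pLex root = ∅ := by
  ext z
  rw [pLex_limit H (root_mem_U H) (by rintro ⟨y, hy⟩; exact hy.ne_root rfl)]
  simp only [mem_empty_iff_false, iff_false]
  rintro ⟨y, -, h, -⟩
  exact not_below_root h

/-- The first two components of a node differ below the height of any element of `U` below it,
except for the root. -/
theorem split_of_below (H : D.Admissible) (hy : y ∈ D.U) (h : y.Below x)
    (hr : y ≠ root) : x.Split y.ord := by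
  have hyT := U_subset_T H hy
  have h0 := (mem_T_ne_root hyT hr).1
  rw [h.1] at hyT
  exact split_of_res_mem_T h0 hyT

theorem idPart_of_below (H : D.Admissible) (hx : x ∈ D.U) (hy : y ∈ D.U) (h : y.Below x)
    (hr : y ≠ root) : idPart y = idPart x := by
  have h1 := idPart_res (h.ord_lt (U_subset_T H hx)).le
    (mem_T_ne_root (U_subset_T H hy) hr).1 (split_of_below H hy h hr)
  rwa [← h.1] at h1

/-- The properties of `p_x` which are carried along the recursion: `p_x` is a partial injection of
`ℶ_{ord x}` into itself, extends the identity part of `x`, and extends `p_y` for `y` below `x`. -/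
structure Inv (D : Data.{u}) (x : Node.{u}) : Prop where
  pinj : PInj (D.pLex x)
  id_sub : x ≠ root → idPart x ⊆ D.pLex x
  bound : ∀ ξ ζ, (ξ, ζ) ∈ D.pLex x → ξ < bethOrd x.ord ∧ ζ < bethOrd x.ord
  mono : ∀ y ∈ D.U, y.Below x → D.pLex y ⊆ D.pLex x

/-- The old part of `p_x` at a successor: if `x` splits at `β`, then the identity part together with
`p_y` is a partial injection of `ℶ_β` into itself, and the two operations `⊎` in the definition of
`p_x` amount to a single one. -/
theorem base_facts (H : D.Admissible) (hs : D.SuccOf x y) (hr : D.ReflectsAt x y β)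
    (hI : D.Inv y) (hsp : x.Split β) :
    PInj (idPart x ∪ D.pLex y) ∧
    (∀ ξ ζ, (ξ, ζ) ∈ idPart x ∪ D.pLex y → ξ < bethOrd β ∧ ζ < bethOrd β) ∧
    ∀ e, PInj e → fUnion (idPart x) (fUnion (D.pLex y) e) = fUnion (idPart x ∪ D.pLex y) e := by
  obtain ⟨h1, h2, h3⟩ := reflectsAt_lt H hs hr
  have hidb : ∀ ξ ζ, (ξ, ζ) ∈ idPart x → ξ < bethOrd β ∧ ζ < bethOrd β := by
    intro ξ ζ h
    rw [← idPart_res h2.le h3 hsp] at h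
    obtain ⟨rfl, h4, -⟩ := mem_idPart.1 h
    rw [res_ord] at h4
    exact ⟨h4, h4⟩
  have hyb : ∀ ξ ζ, (ξ, ζ) ∈ D.pLex y → ξ < bethOrd β ∧ ζ < bethOrd β := by
    intro ξ ζ h
    obtain ⟨h4, h5⟩ := hI.bound ξ ζ h
    exact ⟨h4.trans_le (bethOrd_le.2 h1), h5.trans_le (bethOrd_le.2 h1)⟩
  have hbound : ∀ ξ ζ, (ξ, ζ) ∈ idPart x ∪ D.pLex y → ξ < bethOrd β ∧ ζ < bethOrd β :=
    fun ξ ζ h => h.elim (hidb ξ ζ) (hyb ξ ζ)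
  by_cases hy : y = root
  · subst hy
    rw [pLex_root H, union_empty]
    exact ⟨pInj_idPart, hidb, fun e _ => by rw [fUnion_empty_left]⟩
  · have hsub : idPart x ⊆ D.pLex y := by
      rw [← idPart_of_below H hs.1 hs.2.1 hs.2.2.1 hy]
      exact hI.id_sub hy
    rw [union_eq_right.2 hsub] at hbound ⊢
    exact ⟨hI.pinj, hbound, fun e he =>
      fUnion_eq_of_subset (hI.pinj.fUnion he) (hsub.trans subset_fUnion)⟩

open Classical in
/-- The shift function, or its inverse, from which the new pairs of `p_x` are taken for a successor
`x` of `y`. -/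
def newPart (D : Data.{u}) (y : Node.{u}) (β γ : Ordinal.{u}) : Gr.{u} :=
  if IsOrd (ran (D.pLex y)) then shift β γ else gInv (shift β γ)

theorem pInj_newPart : PInj (D.newPart y β γ) := by
  unfold newPart
  split_ifs
  · exact pInj_shift
  · exact pInj_shift.gInv

theorem pLex_succ_eq (H : D.Admissible) (hs : D.SuccOf x y) (hr : D.ReflectsAt x y β)
    (hI : D.Inv y) (hc : D.CodeAt x β γ) :
    D.pLex x = fUnion (idPart x ∪ D.pLex y) (D.newPart y β γ) := by
  obtain ⟨h1, h2, h3⟩ := reflectsAt_lt H hs hr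
  have hβ := h2.trans (ord_lt_of_mem_T (U_subset_T H hs.1))
  have hsp : x.Split β := split_of_res_mem_TLevel h3 (hc.mem_TLevel H hβ)
  rw [← (base_facts H hs hr hI hsp).2.2 _ pInj_newPart, pLex_succ H hs hr, succStep, newPart,
    hc.codeShift_eq H hβ]

theorem pLex_succ_eq_idPart (H : D.Admissible) (hs : D.SuccOf x y) (hr : D.ReflectsAt x y β)
    (hsp : ¬ x.Split β) : y = root ∧ D.pLex x = idPart x := by
  obtain ⟨h1, h2, h3⟩ := reflectsAt_lt H hs hr
  have hβ := h2.trans (ord_lt_of_mem_T (U_subset_T H hs.1))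
  have hy : y = root := by
    by_contra hy
    exact hsp ((split_of_below H hs.2.1 hs.2.2.1 hy).mono h1)
  subst hy
  refine ⟨rfl, ?_⟩
  have e : gInv (∅ : Gr.{u}) = ∅ := rfl
  rw [pLex_succ H hs hr, succStep, codeShift_eq_empty H hβ h3 hsp, pLex_root H, e, ite_self,
    fUnion_empty_right, fUnion_empty_right]

theorem newPart_bound (hγ : γ < bethOrd (Order.succ β)) (h : (ξ, ζ) ∈ D.newPart y β γ) :
    ξ < bethOrd (Order.succ β) ∧ ζ < bethOrd (Order.succ β) := by
  have hlt : bethOrd β < bethOrd (Order.succ β) := bethOrd_lt.2 (Order.lt_succ β)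
  unfold newPart at h
  split_ifs at h
  · obtain ⟨h1, h2⟩ := mem_shift.1 h
    subst h2
    exact ⟨h1.trans hlt, shift_upper hγ h1⟩
  · obtain ⟨h1, h2⟩ := mem_shift.1 (mem_gInv.1 h)
    subst h2
    exact ⟨shift_upper hγ h1, h1.trans hlt⟩

theorem inv_pLex (H : D.Admissible) (hx : x ∈ D.U) : D.Inv x := by
  induction hα : x.ord using WellFoundedLT.induction generalizing x with
  | _ α ih =>
  subst hα
  have hT := U_subset_T H hx
  have IH : ∀ y ∈ D.U, y.Below x → D.Inv y := fun y hy h => ih _ (h.ord_lt hT) hy rfl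
  have mono_lt : ∀ y ∈ D.U, y.Below x → bethOrd y.ord ≤ bethOrd x.ord := fun y _ h =>
    (bethOrd_lt.2 (h.ord_lt hT)).le
  by_cases hroot : x = root
  · subst hroot
    exact ⟨by rw [pLex_root H]; exact pInj_empty, fun h => absurd rfl h,
      by rw [pLex_root H]; exact fun _ _ h => h.elim, fun y _ h => absurd h not_below_root⟩
  by_cases hsucc : ∃ y, D.SuccOf x y
  · obtain ⟨y, hs⟩ := hsucc
    obtain ⟨β, hr⟩ := exists_reflectsAt H hs
    obtain ⟨h1, h2, h3⟩ := reflectsAt_lt H hs hr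
    have hI := IH y hs.2.1 hs.2.2.1
    have hmono : D.pLex y ⊆ D.pLex x → ∀ z ∈ D.U, z.Below x → D.pLex z ⊆ D.pLex x := by
      intro h z hz hzx
      rcases hs.eq_or_below hz hzx with rfl | h4
      · exact h
      · exact (hI.mono z hz h4).trans h
    by_cases hsp : x.Split β
    · obtain ⟨γ, hc⟩ := exists_codeAt H hT h2.le h3 hsp
      have heq := pLex_succ_eq H hs hr hI hc
      obtain ⟨k1, k2, -⟩ := base_facts H hs hr hI hsp
      have hγ := hc.lt H (h2.trans (ord_lt_of_mem_T hT))
      have hb : bethOrd (Order.succ β) ≤ bethOrd x.ord := bethOrd_le.2 (Order.succ_le_of_lt h2)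
      have hb' : bethOrd β ≤ bethOrd x.ord := bethOrd_le.2 h2.le
      refine ⟨?_, fun _ => ?_, ?_, hmono ?_⟩
      · rw [heq]; exact k1.fUnion pInj_newPart
      · rw [heq]; exact subset_union_left.trans subset_fUnion
      · rw [heq]
        rintro ξ ζ (h | ⟨h, -⟩)
        · exact ⟨(k2 ξ ζ h).1.trans_le hb', (k2 ξ ζ h).2.trans_le hb'⟩
        · have := newPart_bound hγ h
          exact ⟨this.1.trans_le hb, this.2.trans_le hb⟩
      · rw [heq]; exact subset_union_right.trans subset_fUnion
    · obtain ⟨rfl, heq⟩ := pLex_succ_eq_idPart H hs hr hsp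
      refine ⟨by rw [heq]; exact pInj_idPart, fun _ => by rw [heq], ?_,
        hmono (by rw [pLex_root H]; exact empty_subset _)⟩
      rw [heq]
      intro ξ ζ h
      obtain ⟨rfl, h4, -⟩ := mem_idPart.1 h
      exact ⟨h4, h4⟩
  · have hlim := (succ_or_limit H hx hroot).resolve_left hsucc
    have hmem := fun {z} => pLex_limit (z := z) H hx hsucc
    have hmono : ∀ y ∈ D.U, y.Below x → D.pLex y ⊆ D.pLex x :=
      fun y hy h z hz => hmem.2 ⟨y, hy, h, hz⟩
    have hdir : ∀ {z z'}, z ∈ D.pLex x → z' ∈ D.pLex x →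
        ∃ y ∈ D.U, y.Below x ∧ z ∈ D.pLex y ∧ z' ∈ D.pLex y := by
      intro z z' hz hz'
      obtain ⟨y, hy, hyx, h1⟩ := hmem.1 hz
      obtain ⟨y', hy', hyx', h1'⟩ := hmem.1 hz'
      rcases lt_trichotomy y.ord y'.ord with h | h | h
      · exact ⟨y', hy', hyx', (IH y' hy' hyx').mono y hy (below_of_lt hyx hyx' h) h1, h1'⟩
      · obtain rfl := eq_of_ord_eq hyx hyx' h
        exact ⟨y, hy, hyx, h1, h1'⟩
      · exact ⟨y, hy, hyx, h1, (IH y hy hyx).mono y' hy' (below_of_lt hyx' hyx h) h1'⟩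
    refine ⟨⟨?_, ?_⟩, fun _ => ?_, ?_, hmono⟩
    · intro ξ ζ ζ' h h'
      obtain ⟨y, hy, hyx, h1, h1'⟩ := hdir h h'
      exact (IH y hy hyx).pinj.1 _ _ _ h1 h1'
    · intro ξ ζ ζ' h h'
      obtain ⟨y, hy, hyx, h1, h1'⟩ := hdir h h'
      exact (IH y hy hyx).pinj.2 _ _ _ h1 h1'
    · obtain ⟨y, hy, hyx, hpos⟩ := hlim 0 (pos_iff_ne_zero.2 (mem_T_ne_root hT hroot).1)
      have hyr : y ≠ root := by rintro rfl; exact lt_irrefl _ hpos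
      rw [← idPart_of_below H hx hy hyx hyr]
      exact ((IH y hy hyx).id_sub hyr).trans (hmono y hy hyx)
    · intro ξ ζ h
      obtain ⟨y, hy, hyx, h1⟩ := hmem.1 h
      have := (IH y hy hyx).bound ξ ζ h1
      exact ⟨this.1.trans_le (mono_lt y hy hyx), this.2.trans_le (mono_lt y hy hyx)⟩

/-! ### Extension of `p_x` along the tree order -/

theorem p_of_TLex (h : x ∈ TLex D.κ) : D.p x = D.pLex x := if_pos h

theorem p_of_inv_TLex (h : x.inv ∈ TLex D.κ) : D.p x = gInv (D.pLex x.inv) :=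
  if_neg fun h' => not_mem_TLex_inv h' h

theorem p_root (H : D.Admissible) : D.p root = ∅ := by
  rw [p, if_neg fun h => ne_root_of_mem_TLex h rfl]
  change gInv (D.pLex root) = ∅
  rw [pLex_root H]
  rfl

theorem p_inv (H : D.Admissible) (hx : x ∈ D.U) : D.p x.inv = gInv (D.p x) := by
  by_cases hr : x = root
  · subst hr
    rw [show root.inv = root.{u} from rfl, p_root H]
    rfl
  rcases mem_TLex_or (U_subset_T H hx) hr with h | h
  · rw [p_of_TLex h, p_of_inv_TLex (x := x.inv) h, inv_inv]
  · rw [p_of_TLex h, p_of_inv_TLex h, gInv_gInv]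

/-- A property of `p_x` may be verified for `x ∈ T^<`, if it is invariant under inversion. -/
theorem p_induction (H : D.Admissible) {C : Node.{u} → Prop} (hroot : C root)
    (hlex : ∀ x ∈ D.U, x ∈ TLex D.κ → C x) (hinv : ∀ x ∈ D.U, C x → C x.inv) (hx : x ∈ D.U) :
    C x := by
  by_cases hr : x = root
  · rw [hr]; exact hroot
  rcases mem_TLex_or (U_subset_T H hx) hr with h | h
  · exact hlex x hx h
  · have := hinv x.inv (inv_mem_U H hx) (hlex x.inv (inv_mem_U H hx) h)
    rwa [inv_inv] at this

theorem pInj_p (H : D.Admissible) (hx : x ∈ D.U) : PInj (D.p x) := by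
  refine p_induction (C := fun x => PInj (D.p x)) H ?_ (fun x hx h => ?_) (fun x hx h => ?_) hx
  · rw [p_root H]; exact pInj_empty
  · rw [p_of_TLex h]; exact (inv_pLex H hx).pinj
  · rw [p_inv H hx]; exact h.gInv

theorem p_bound (H : D.Admissible) (hx : x ∈ D.U) (h : (ξ, ζ) ∈ D.p x) :
    ξ < bethOrd x.ord ∧ ζ < bethOrd x.ord := by
  refine p_induction (C := fun x => ∀ ξ ζ, (ξ, ζ) ∈ D.p x → ξ < bethOrd x.ord ∧ ζ < bethOrd x.ord)
    H ?_ (fun x hx h => ?_) (fun x hx h => ?_) hx ξ ζ h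
  · rw [p_root H]; exact fun _ _ h => h.elim
  · rw [p_of_TLex h]; exact (inv_pLex H hx).bound
  · rw [p_inv H hx]; exact fun ξ ζ hz => (h ζ ξ hz).symm

theorem idPart_subset_p (H : D.Admissible) (hx : x ∈ D.U) (hr : x ≠ root) :
    idPart x ⊆ D.p x := by
  refine p_induction (C := fun x => x ≠ root → idPart x ⊆ D.p x)
    H (fun h => absurd rfl h) (fun x hx h => ?_) (fun x hx h hr => ?_) hx hr
  · rw [p_of_TLex h]; exact (inv_pLex H hx).id_sub
  · rw [p_inv H hx, ← gInv_idPart]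
    exact gInv_mono (h fun he => hr (by rw [he]; rfl))

theorem p_mono (H : D.Admissible) (hx : x ∈ D.U) (hy : y ∈ D.U) (h : y.Below x) :
    D.p y ⊆ D.p x := by
  refine p_induction (C := fun x => ∀ y ∈ D.U, y.Below x → D.p y ⊆ D.p x)
    H (fun y _ h => absurd h not_below_root) (fun x hx h y hy hyx => ?_)
    (fun x hx h y hy hyx => ?_) hx y hy h
  · rcases below_root_or_TLex H h hy hyx with rfl | h1
    · rw [p_root H]; exact empty_subset _
    · rw [p_of_TLex h, p_of_TLex h1]
      exact (inv_pLex H hx).mono y hy hyx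
  · have h1 := gInv_mono (h y.inv (inv_mem_U H hy) hyx.inv)
    rwa [p_inv H hy, gInv_gInv, ← p_inv H hx] at h1

theorem p_limit (H : D.Admissible) (hx : x ∈ D.U) (hs : ¬ ∃ y, D.SuccOf x y)
    (h : (ξ, ζ) ∈ D.p x) : ∃ y ∈ D.U, y.Below x ∧ (ξ, ζ) ∈ D.p y := by
  refine p_induction (C := fun x => (¬ ∃ y, D.SuccOf x y) → ∀ ξ ζ, (ξ, ζ) ∈ D.p x →
      ∃ y ∈ D.U, y.Below x ∧ (ξ, ζ) ∈ D.p y)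
    H ?_ (fun x hx h hs ξ ζ hz => ?_) (fun x hx h hs ξ ζ hz => ?_) hx hs ξ ζ h
  · rw [p_root H]; exact fun _ _ _ h => h.elim
  · rw [p_of_TLex h] at hz
    obtain ⟨y, hy, hyx, h1⟩ := (pLex_limit H hx hs).1 hz
    rcases below_root_or_TLex H h hy hyx with rfl | h2
    · rw [pLex_root H] at h1; exact h1.elim
    · exact ⟨y, hy, hyx, by rwa [p_of_TLex h2]⟩
  · rw [p_inv H hx] at hz
    obtain ⟨y, hy, hyx, h1⟩ := h (fun ⟨y, hy⟩ => hs ⟨y.inv, hy.inv H⟩) ζ ξ hz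
    exact ⟨y.inv, inv_mem_U H hy, hyx.inv, by rwa [p_inv H hy]⟩

end Data

/-! ### Ascending nodes -/

namespace Data

variable {D : Data.{u}} {x x' y y' z v w : Node.{u}} {β β' γ γ' ξ ξ' ζ : Ordinal.{u}}

/-- `y` is an ascending node with parameters `β` and `γ`: it is a successor in `U`, and the pairs
which `p_y` has in addition to those of the predecessor are taken from the shift function with
these parameters. The second case is that of the inverse of an element of `T^<` at which the
inverse of the shift function is used. A node whose inverse is ascending is called descending. -/
def Up (D : Data.{u}) (y : Node.{u}) (β γ : Ordinal.{u}) : Prop :=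
  ∃ v, (y ∈ TLex D.κ ∧ D.SuccOf y v ∧ D.ReflectsAt y v β ∧ D.CodeAt y β γ ∧
      IsOrd (ran (D.pLex v))) ∨
    (y.inv ∈ TLex D.κ ∧ D.SuccOf y.inv v ∧ D.ReflectsAt y.inv v β ∧ D.CodeAt y.inv β γ ∧
      ¬ IsOrd (ran (D.pLex v)))

theorem pLex_pred (H : D.Admissible) (hx : x ∈ TLex D.κ) (hs : D.SuccOf x v) :
    D.pLex v = D.p v := by
  rcases below_root_or_TLex H hx hs.2.1 hs.2.2.1 with rfl | h
  · rw [pLex_root H, p_root H]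
  · rw [p_of_TLex h]

theorem codeAt_lt_kappa (H : D.Admissible) (hs : D.SuccOf x v) (hr : D.ReflectsAt x v β) :
    β < D.κ.ord :=
  (reflectsAt_lt H hs hr).2.1.trans (ord_lt_of_mem_T (U_subset_T H hs.1))

theorem CodeAt.split (H : D.Admissible) (hs : D.SuccOf x v) (hr : D.ReflectsAt x v β)
    (hc : D.CodeAt x β γ) : x.Split β :=
  split_of_res_mem_TLevel (reflectsAt_lt H hs hr).2.2
    (hc.mem_TLevel H (codeAt_lt_kappa H hs hr))

theorem Up.basic (H : D.Admissible) (h : D.Up y β γ) :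
    y ∈ D.U ∧ y ≠ root ∧ β ≠ 0 ∧ β < y.ord ∧ y.Split β ∧ γ < bethOrd (Order.succ β) := by
  obtain ⟨v, ⟨-, h2, h3, h4, -⟩ | ⟨-, h2, h3, h4, -⟩⟩ := h
  · exact ⟨h2.1, h2.ne_root, (reflectsAt_lt H h2 h3).2.2, (reflectsAt_lt H h2 h3).2.1,
      h4.split H h2 h3, h4.lt H (codeAt_lt_kappa H h2 h3)⟩
  · exact ⟨(inv_mem_U_iff H).1 h2.1, fun he => h2.ne_root (inv_eq_root.2 he),
      (reflectsAt_lt H h2 h3).2.2, (reflectsAt_lt H h2 h3).2.1, split_inv.1 (h4.split H h2 h3),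
      h4.lt H (codeAt_lt_kappa H h2 h3)⟩

/-- The form of `p_y` for an ascending node `y`. -/
theorem Up.eq (H : D.Admissible) (h : D.Up y β γ) : ∃ v, D.SuccOf y v ∧ v.ord ≤ β ∧
    D.p y = fUnion (idPart y ∪ D.p v) (shift β γ) ∧
    ∀ ξ ζ, (ξ, ζ) ∈ idPart y ∪ D.p v → ξ < bethOrd β ∧ ζ < bethOrd β := by
  obtain ⟨v, ⟨h1, h2, h3, h4, h5⟩ | ⟨h1, h2, h3, h4, h5⟩⟩ := h
  · have hI := inv_pLex H h2.2.1
    refine ⟨v, h2, (reflectsAt_lt H h2 h3).1, ?_⟩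
    rw [← pLex_pred H h1 h2]
    refine ⟨?_, (base_facts H h2 h3 hI (h4.split H h2 h3)).2.1⟩
    rw [p_of_TLex h1, pLex_succ_eq H h2 h3 hI h4, newPart, if_pos h5]
  · have hI := inv_pLex H h2.2.1
    have hb := (base_facts H h2 h3 hI (h4.split H h2 h3)).2.1
    rw [pLex_pred H h1 h2] at hb
    have e : idPart y ∪ D.p v.inv = gInv (idPart y.inv ∪ D.p v) := by
      rw [p_inv H h2.2.1]
      change _ = gInv (idPart y.inv) ∪ _
      rw [gInv_idPart, inv_inv]
      rfl
    refine ⟨v.inv, h2.inv H, (reflectsAt_lt H h2 h3).1, ?_, fun ξ ζ hz => ?_⟩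
    · rw [p_of_inv_TLex h1, pLex_succ_eq H h2 h3 hI h4, newPart, if_neg h5, gInv_fUnion,
        gInv_gInv, e, pLex_pred H h1 h2]
    · rw [e] at hz
      exact (hb ζ ξ hz).symm

theorem Up.lt_dom (H : D.Admissible) (h : D.Up y β γ) (hz : (ξ, ζ) ∈ D.p y) :
    ξ < bethOrd β := by
  obtain ⟨v, -, -, he, hb⟩ := h.eq H
  rw [he] at hz
  rcases hz with hz | ⟨hz, -⟩
  · exact (hb _ _ hz).1
  · exact (mem_shift.1 hz).1

theorem Up.lt_ran (H : D.Admissible) (h : D.Up y β γ) (hz : (ξ, ζ) ∈ D.p y) :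
    ζ < bethOrd (Order.succ β) := by
  obtain ⟨v, -, -, he, hb⟩ := h.eq H
  rw [he] at hz
  rcases hz with hz | ⟨hz, -⟩
  · exact (hb _ _ hz).2.trans (bethOrd_lt.2 (Order.lt_succ β))
  · obtain ⟨h1, rfl⟩ := mem_shift.1 hz
    exact shift_upper (h.basic H).2.2.2.2.2 h1

theorem Up.dom_eq (H : D.Admissible) (h : D.Up y β γ) : dom (D.p y) = Iio (bethOrd β) := by
  refine Subset.antisymm (fun ξ ⟨ζ, hz⟩ => h.lt_dom H hz) fun ξ hξ => ?_
  obtain ⟨v, -, -, he, hb⟩ := h.eq H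
  rw [he]
  by_cases hd : ξ ∈ dom (idPart y ∪ D.p v)
  · obtain ⟨ζ, hz⟩ := hd
    exact ⟨ζ, Or.inl hz⟩
  · refine ⟨bethOrd β * (γ + 1) + ξ, Or.inr ⟨⟨hξ, rfl⟩, hd, ?_⟩⟩
    rintro ⟨ξ', hz⟩
    exact not_lt.2 shift_lower (hb _ _ hz).2

theorem Up.big (H : D.Admissible) (h : D.Up y β γ) (hz : (ξ, ζ) ∈ D.p y)
    (hζ : bethOrd β ≤ ζ) : ζ = bethOrd β * (γ + 1) + ξ := by
  obtain ⟨v, -, -, he, hb⟩ := h.eq H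
  rw [he] at hz
  rcases hz with hz | ⟨hz, -⟩
  · exact absurd (hb _ _ hz).2 (not_lt.2 hζ)
  · exact (mem_shift.1 hz).2

/-- The parameters of an ascending node can be recovered from any of its new values, since the
ranges of distinct shift functions are disjoint. -/
theorem Up.decode (H : D.Admissible) (h : D.Up y β γ) (h' : D.Up y' β' γ')
    (hz : (ξ, ζ) ∈ D.p y) (hz' : (ξ', ζ) ∈ D.p y') (hζ : bethOrd β ≤ ζ)
    (hζ' : bethOrd β' ≤ ζ) : β = β' ∧ γ = γ' := by
  have := shift_decode (h.basic H).2.2.2.2.2 (h.lt_dom H hz) (h'.basic H).2.2.2.2.2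
    (h'.lt_dom H hz') ((h.big H hz hζ).symm.trans (h'.big H hz' hζ'))
  exact ⟨this.1, this.2.1⟩

/-- An ascending node is determined, up to `ℶ_β` and as far as `p_y` is concerned, by its
parameters. -/
theorem Up.unique (H : D.Admissible) (h : D.Up y β γ) (h' : D.Up y' β γ) :
    D.p y = D.p y' ∧ y.res β = y'.res β := by
  have key : ∀ {y y' v v' : Node.{u}}, y ∈ TLex D.κ → y' ∈ TLex D.κ → D.SuccOf y v →
      D.SuccOf y' v' → D.ReflectsAt y v β → D.ReflectsAt y' v' β → D.CodeAt y β γ →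
      D.CodeAt y' β γ → v = v' ∧ D.p y = D.p y' ∧ y.res β = y'.res β := by
    intro y y' v v' l l' s s' r r' c c'
    have hres : y.res β = y'.res β := c.2.symm.trans c'.2
    have e := pred_unique H s s' l l' r r' hres (c.split H s r) (c'.split H s' r')
    subst e
    have hid : idPart y = idPart y' := by
      rw [← idPart_res (reflectsAt_lt H s r).2.1.le (reflectsAt_lt H s r).2.2 (c.split H s r),
        hres, idPart_res (reflectsAt_lt H s' r').2.1.le (reflectsAt_lt H s' r').2.2
          (c'.split H s' r')]
    refine ⟨rfl, ?_, hres⟩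
    rw [p_of_TLex l, p_of_TLex l', pLex_succ_eq H s r (inv_pLex H s.2.1) c,
      pLex_succ_eq H s' r' (inv_pLex H s.2.1) c', hid]
  obtain ⟨v, ⟨h1, h2, h3, h4, h5⟩ | ⟨h1, h2, h3, h4, h5⟩⟩ := h <;>
  obtain ⟨v', ⟨h1', h2', h3', h4', h5'⟩ | ⟨h1', h2', h3', h4', h5'⟩⟩ := h'
  · exact (key h1 h1' h2 h2' h3 h3' h4 h4').2
  · have := (key h1 h1' h2 h2' h3 h3' h4 h4').1
    subst this
    exact absurd h5 h5'
  · have := (key h1 h1' h2 h2' h3 h3' h4 h4').1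
    subst this
    exact absurd h5' h5
  · have := (key h1 h1' h2 h2' h3 h3' h4 h4').2
    rw [p_inv H ((inv_mem_U_iff H).1 h2.1), p_inv H ((inv_mem_U_iff H).1 h2'.1), inv_res,
      inv_res] at this
    exact ⟨congrArg gInv this.1, congrArg Node.inv this.2⟩

/-- Successors are ascending, or have ascending inverses, unless they are successors of the root
without new values. -/
theorem succ_kinds (H : D.Admissible) (hs : D.SuccOf y v) :
    (∃ β γ, D.Up y β γ ∨ D.Up y.inv β γ) ∨ (v = root ∧ D.p y = idPart y) := by
  have key : ∀ y ∈ TLex D.κ, ∀ v, D.SuccOf y v →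
      (∃ β γ, D.Up y β γ ∨ D.Up y.inv β γ) ∨ (v = root ∧ D.p y = idPart y) := by
    intro y hy v hs
    obtain ⟨β, hr⟩ := exists_reflectsAt H hs
    obtain ⟨h1, h2, h3⟩ := reflectsAt_lt H hs hr
    by_cases hsp : y.Split β
    · obtain ⟨γ, hc⟩ := exists_codeAt H hy.1 h2.le h3 hsp
      left
      refine ⟨β, γ, ?_⟩
      by_cases ho : IsOrd (ran (D.pLex v))
      · exact Or.inl ⟨v, Or.inl ⟨hy, hs, hr, hc, ho⟩⟩
      · exact Or.inr ⟨v, Or.inr ⟨hy, hs, hr, hc, ho⟩⟩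
    · right
      obtain ⟨e1, e2⟩ := pLex_succ_eq_idPart H hs hr hsp
      exact ⟨e1, by rw [p_of_TLex hy, e2]⟩
  rcases mem_TLex_or (U_subset_T H hs.1) hs.ne_root with h | h
  · exact key y h v hs
  · rcases key y.inv h v.inv (hs.inv H) with ⟨β, γ, h1⟩ | ⟨h1, h2⟩
    · exact Or.inl ⟨β, γ, h1.symm⟩
    · refine Or.inr ⟨inv_eq_root.1 h1, ?_⟩
      have := congrArg gInv h2
      rwa [p_inv H hs.1, gInv_gInv, gInv_idPart, inv_inv] at this

section Steps

variable {ι : Type*} {c c' : ι → Ordinal.{u}}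

/-- No `p_w` with `w` strictly below `x` is defined on the whole of `c`. -/
def Tight (D : Data.{u}) (x : Node.{u}) (c : ι → Ordinal.{u}) : Prop :=
  ∀ w ∈ D.U, w.Below x → ¬ ∀ j, c j ∈ dom (D.p w)

theorem mem_of_mem_dom (H : D.Admissible) (hx : x ∈ D.U) (hw : w ∈ D.U) (h : w.Below x)
    (hz : (ξ, ζ) ∈ D.p x) (hd : ξ ∈ dom (D.p w)) : (ξ, ζ) ∈ D.p w := by
  obtain ⟨ζ', hz'⟩ := hd
  rwa [(pInj_p H hx).1 _ _ _ hz (p_mono H hx hw h hz')]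

theorem Tight.inv (H : D.Admissible) (hx : x ∈ D.U) (h : D.Tight x c)
    (hp : ∀ j, (c j, c' j) ∈ D.p x) : D.Tight x.inv c' := by
  intro w hw hb hall
  have hw' := inv_mem_U H hw
  refine h w.inv hw' hb.inv fun j => ⟨c' j, ?_⟩
  have := mem_of_mem_dom H (inv_mem_U H hx) hw hb
    (by rw [p_inv H hx]; exact hp j) (hall j)
  rw [p_inv H hw]
  exact this

/-- A node defined on `c` may be replaced by one below or equal to it which is tight for `c`. -/
theorem exists_tight (H : D.Admissible) [Nonempty ι] (hx : x ∈ D.U)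
    (hp : ∀ j, (c j, c' j) ∈ D.p x) : ∃ y ∈ D.U, y ≠ root ∧ (y = x ∨ y.Below x) ∧ D.Tight y c ∧
      ∀ j, (c j, c' j) ∈ D.p y := by
  induction hα : x.ord using WellFoundedLT.induction generalizing x with
  | _ α ih =>
  subst hα
  by_cases ht : D.Tight x c
  · refine ⟨x, hx, ?_, Or.inl rfl, ht, hp⟩
    rintro rfl
    obtain ⟨j⟩ := ‹Nonempty ι›
    have := hp j
    rw [p_root H] at this
    exact this.elim
  · unfold Tight at ht
    push Not at ht
    obtain ⟨w, hw, hb, hall⟩ := ht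
    have hlt := hb.ord_lt (U_subset_T H hx)
    obtain ⟨y, h1, h2, h3, h4, h5⟩ := ih _ hlt hw
      (fun j => mem_of_mem_dom H hx hw hb (hp j) (hall j)) rfl
    refine ⟨y, h1, h2, Or.inr ?_, h4, h5⟩
    rcases h3 with rfl | h3
    · exact hb
    · exact h3.trans hb (h3.ord_lt (U_subset_T H hw)).le

/-- `x` is ascending with parameters `β`, `γ`, it maps `c` to `c'`, and some entry is moved by the
new pairs of `p_x`. -/
structure Ascends (D : Data.{u}) (x : Node.{u}) (c c' : ι → Ordinal.{u}) (β γ : Ordinal.{u}) :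
    Prop where
  up : D.Up x β γ
  map : ∀ j, (c j, c' j) ∈ D.p x
  big : ∃ j, bethOrd β ≤ c' j

/-- A tight node which is not trivial on `c` moves some entry of `c` by its new pairs. -/
theorem ascends_or (H : D.Admissible) [Finite ι] (hx : x ∈ D.U)
    (hp : ∀ j, (c j, c' j) ∈ D.p x) (ht : D.Tight x c)
    (ha : ¬ ∀ j, c j = c' j ∧ ∀ ξ ≤ c j, x.fst ξ = x.snd ξ) :
    ∃ β γ, D.Ascends x c c' β γ ∨ D.Ascends x.inv c' c β γ := by
  have key : ∀ (y : Node.{u}) (e e' : ι → Ordinal.{u}) (β γ : Ordinal.{u}), D.Up y β γ →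
      (∀ j, (e j, e' j) ∈ D.p y) → D.Tight y e →
      (¬ ∀ j, e j = e' j ∧ ∀ ξ ≤ e j, y.fst ξ = y.snd ξ) → D.Ascends y e e' β γ := by
    intro y e e' β γ hu hp ht ha
    refine ⟨hu, hp, ?_⟩
    by_contra! hsm
    obtain ⟨v, hs, -, he, -⟩ := hu.eq H
    have hbase : ∀ j, (e j, e' j) ∈ idPart y ∪ D.p v := fun j => by
      have := hp j
      rw [he] at this
      rcases this with h | ⟨h, -⟩
      · exact h
      · exact absurd (hsm j) (not_lt.2 (by rw [(mem_shift.1 h).2]; exact shift_lower))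
    by_cases hv : v = root
    · subst hv
      rw [p_root H, union_empty] at hbase
      exact ha fun j => ⟨(mem_idPart.1 (hbase j)).1, (mem_idPart.1 (hbase j)).2.2⟩
    · have hsub : idPart y ⊆ D.p v := by
        rw [← idPart_of_below H hs.1 hs.2.1 hs.2.2.1 hv]
        exact idPart_subset_p H hs.2.1 hv
      rw [union_eq_right.2 hsub] at hbase
      exact ht v hs.2.1 hs.2.2.1 fun j => ⟨_, hbase j⟩
  by_cases hsucc : ∃ v, D.SuccOf x v
  · obtain ⟨v, hs⟩ := hsucc
    rcases succ_kinds H hs with ⟨β, γ, h | h⟩ | ⟨-, h2⟩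
    · exact ⟨β, γ, Or.inl (key x c c' β γ h hp ht ha)⟩
    · refine ⟨β, γ, Or.inr (key x.inv c' c β γ h (fun j => ?_) (ht.inv H hx hp) fun h => ha ?_)⟩
      · rw [p_inv H hx]; exact hp j
      · intro j
        obtain ⟨h1, h2⟩ := h j
        exact ⟨h1.symm, fun ξ hξ => (h2 ξ (by rwa [h1])).symm⟩
    · refine absurd (fun j => ?_) ha
      have := hp j
      rw [h2] at this
      exact ⟨(mem_idPart.1 this).1, (mem_idPart.1 this).2.2⟩
  -- at a limit node a finite family is already in the domain of some `p_w` with `w` below `x`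
  · exfalso
    have hne : Nonempty ι := by
      by_contra hemp
      exact ha fun j => absurd ⟨j⟩ hemp
    choose w hw hb hm using fun j => p_limit H hx hsucc (hp j)
    obtain ⟨j₀, hj₀⟩ := Finite.exists_max fun j => (w j).ord
    refine ht (w j₀) (hw j₀) (hb j₀) fun j => ⟨c' j, ?_⟩
    rcases (hj₀ j).lt_or_eq with hlt | he
    · exact p_mono H (hw j₀) (hw j) (below_of_lt (hb j) (hb j₀) hlt) (hm j)
    · rw [← eq_of_ord_eq (hb j) (hb j₀) he]
      exact hm j

variable {d : ι → Ordinal.{u}}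

theorem Ascends.exists_lt (H : D.Admissible) (h : D.Ascends x c c' β γ) :
    ∃ j, ∀ i, c i < c' j := by
  obtain ⟨j, hj⟩ := h.big
  exact ⟨j, fun i => (h.up.lt_dom H (h.map i)).trans_le hj⟩

/-- The parameters of an ascending step are determined by the target. -/
theorem Ascends.unique (H : D.Admissible) [Finite ι] (h : D.Ascends x c c' β γ)
    (h' : D.Ascends x' d c' β' γ') :
    β = β' ∧ γ = γ' ∧ D.p x = D.p x' ∧ x.res β = x'.res β ∧ c = d := by
  obtain ⟨i, hi⟩ := h.big
  have : Nonempty ι := ⟨i⟩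
  obtain ⟨j, hj⟩ := Finite.exists_max c'
  obtain ⟨i', hi'⟩ := h'.big
  obtain ⟨rfl, rfl⟩ := h.up.decode H h'.up (h.map j) (h'.map j) (hi.trans (hj i))
    (hi'.trans (hj i'))
  obtain ⟨e1, e2⟩ := h.up.unique H h'.up
  refine ⟨rfl, rfl, e1, e2, funext fun k => ?_⟩
  have h2 := h'.map k
  rw [← e1] at h2
  exact (pInj_p H (h.up.basic H).1).2 _ _ _ (h.map k) h2

end Steps

/-- For three successive nodes `v₀`, `v₁`, `v₂`, domain and range of the last function contain
`ℶ_{ord v₀}`. If the range of `p_{v₀}` is an ordinal, the first step makes the domain an ordinal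
`ℶ_β`, and the second one takes care of the range; otherwise it is the other way round. -/
theorem subset_dom_ran_of_two_steps (H : D.Admissible) {v₀ v₁ v₂ : Node.{u}}
    (h₁ : D.SuccOf v₁ v₀) (h₂ : D.SuccOf v₂ v₁) (hl : v₂ ∈ TLex D.κ) (h0 : v₀ ≠ root)
    (hlt : ∀ β, D.ReflectsAt v₁ v₀ β → v₀.ord < β) (hξ : ξ < bethOrd v₀.ord) :
    ξ ∈ dom (D.p v₂) ∧ ξ ∈ ran (D.p v₂) := by
  have hv₁ : v₁ ∈ TLex D.κ :=
    (below_root_or_TLex H hl h₂.2.1 h₂.2.2.1).resolve_left h₁.ne_root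
  have hinv : ∀ {y}, y ∈ D.U → dom (D.p y.inv) = ran (D.p y) := fun hy => by
    rw [p_inv H hy, dom_gInv]
  have hm := p_mono H h₂.1 h₂.2.1 h₂.2.2.1
  obtain ⟨β₁, hr₁⟩ := exists_reflectsAt H h₁
  obtain ⟨β₂, hr₂⟩ := exists_reflectsAt H h₂
  obtain ⟨-, g2, g3⟩ := reflectsAt_lt H h₁ hr₁
  obtain ⟨k1, k2, k3⟩ := reflectsAt_lt H h₂ hr₂
  have hβ₁ := hlt β₁ hr₁
  have hβ₂ : v₀.ord < β₂ := (h₁.ord_lt H).trans_le k1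
  have hs0 : v₁.Split v₀.ord := split_of_below H h₁.2.1 h₁.2.2.1 h0
  obtain ⟨γ₁, hc₁⟩ := exists_codeAt H hv₁.1 g2.le g3 (hs0.mono hβ₁.le)
  have hs1 : v₂.Split v₁.ord := split_of_below H h₂.2.1 h₂.2.2.1 h₁.ne_root
  obtain ⟨γ₂, hc₂⟩ := exists_codeAt H hl.1 k2.le k3 (hs1.mono k1)
  have big : ∀ {β}, v₀.ord < β → ξ < bethOrd β := fun h => hξ.trans (bethOrd_lt.2 h)
  by_cases o1 : IsOrd (ran (D.pLex v₀))
  · have u1 : D.Up v₁ β₁ γ₁ := ⟨v₀, Or.inl ⟨hv₁, h₁, hr₁, hc₁, o1⟩⟩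
    refine ⟨?_, ?_⟩
    · have : ξ ∈ dom (D.p v₁) := by rw [u1.dom_eq H]; exact big hβ₁
      obtain ⟨ζ, hz⟩ := this
      exact ⟨ζ, hm hz⟩
    · by_cases o2 : IsOrd (ran (D.pLex v₁))
      · obtain ⟨θ, hθ⟩ := o2
        rw [← p_of_TLex hv₁] at hθ
        -- the point `ℶ_{ord v₀}` is not in the domain of the old part, so it has a new value
        obtain ⟨v, hs, -, he, hb⟩ := u1.eq H
        obtain rfl := hs.unique h₁
        have hnew : (bethOrd v.ord, bethOrd β₁ * (γ₁ + 1) + bethOrd v.ord) ∈ D.p v₁ := by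
          rw [he]
          refine Or.inr ⟨⟨bethOrd_lt.2 hβ₁, rfl⟩, ?_, ?_⟩
          · rintro ⟨ζ, hz | hz⟩
            · rw [← idPart_of_below H h₁.1 h₁.2.1 h₁.2.2.1 h0] at hz
              exact lt_irrefl _ (mem_idPart.1 hz).2.1
            · exact lt_irrefl _ (p_bound H h₁.2.1 hz).1
          · rintro ⟨ξ', hz⟩
            exact not_lt.2 shift_lower (hb _ _ hz).2
        have hmem : bethOrd β₁ * (γ₁ + 1) + bethOrd v.ord ∈ ran (D.p v₁) := ⟨_, hnew⟩
        rw [hθ] at hmem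
        have : ξ ∈ ran (D.p v₁) := by
          rw [hθ]
          exact ((big hβ₁).trans_le shift_lower).trans hmem
        obtain ⟨ζ, hz⟩ := this
        exact ⟨ζ, hm hz⟩
      · have u2 : D.Up v₂.inv β₂ γ₂ := ⟨v₁, Or.inr ⟨hl, h₂, hr₂, hc₂, o2⟩⟩
        rw [← hinv h₂.1, u2.dom_eq H]
        exact big hβ₂
  · have u1 : D.Up v₁.inv β₁ γ₁ := ⟨v₀, Or.inr ⟨hv₁, h₁, hr₁, hc₁, o1⟩⟩
    have hran : ran (D.p v₁) = Iio (bethOrd β₁) := by rw [← hinv h₁.1, u1.dom_eq H]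
    refine ⟨?_, ?_⟩
    · have u2 : D.Up v₂ β₂ γ₂ := ⟨v₁, Or.inl ⟨hl, h₂, hr₂, hc₂, bethOrd β₁, by
        rw [← p_of_TLex hv₁]; exact hran⟩⟩
      rw [u2.dom_eq H]
      exact big hβ₂
    · have : ξ ∈ ran (D.p v₁) := by rw [hran]; exact big hβ₁
      obtain ⟨ζ, hz⟩ := this
      exact ⟨ζ, hm hz⟩

end Data

/-! ### Chains of nodes -/

/-- `η` and `ν` agree at all ordinals up to the entries of `c`. -/
def Agree {ι : Type*} (η ν : Ordinal.{u} → Fin 2) (c : ι → Ordinal.{u}) : Prop :=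
  ∀ j, ∀ ξ ≤ c j, η ξ = ν ξ

namespace Agree

variable {ι : Type*} {c : ι → Ordinal.{u}} {η ν θ : Ordinal.{u} → Fin 2}

theorem refl : Agree η η c := fun _ _ _ => rfl

theorem symm (h : Agree η ν c) : Agree ν η c := fun j ξ hξ => (h j ξ hξ).symm

theorem trans (h : Agree η ν c) (h' : Agree ν θ c) : Agree η θ c :=
  fun j ξ hξ => (h j ξ hξ).trans (h' j ξ hξ)

theorem of_lt {δ : Ordinal.{u}} (h : ∀ ξ < δ, η ξ = ν ξ) (hc : ∀ j, c j < δ) : Agree η ν c :=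
  fun j ξ hξ => h ξ (hξ.trans_lt (hc j))

end Agree

namespace Data

/-- The list `l` of nodes of `U` leads from `η` and the family `c` of ordinals to `ν` and `d`: the
functions `p_x`, for `x` in the list, successively map `c` to `d`, and at each stage the second
component of one node agrees with the first component of the next. -/
inductive Conn (D : Data.{u}) {ι : Type*} : (Ordinal.{u} → Fin 2) → (ι → Ordinal.{u}) →
    List Node.{u} → (Ordinal.{u} → Fin 2) → (ι → Ordinal.{u}) → Prop
  | nil {η ν : Ordinal.{u} → Fin 2} {c : ι → Ordinal.{u}} : Agree η ν c → Conn D η c [] ν c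
  | cons {η ν : Ordinal.{u} → Fin 2} {c c' d : ι → Ordinal.{u}} {x : Node.{u}}
      {l : List Node.{u}} : x ∈ D.U → x ≠ root → Agree η x.fst c →
      (∀ j, (c j, c' j) ∈ D.p x) → Conn D x.snd c' l ν d → Conn D η c (x :: l) ν d

variable {D : Data.{u}} {x x' y y' z v w : Node.{u}} {β β' γ γ' ξ ξ' ζ : Ordinal.{u}}
  {ι : Type*} {c c' d d' e e' : ι → Ordinal.{u}} {η η' ν ν' θ : Ordinal.{u} → Fin 2}
  {l l' m m' k k' : List Node.{u}}

theorem conn_nil_iff : D.Conn η c [] ν d ↔ c = d ∧ Agree η ν c := by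
  constructor
  · rintro (h | _)
    exact ⟨rfl, h⟩
  · rintro ⟨rfl, h⟩
    exact .nil h

theorem conn_cons_iff : D.Conn η c (x :: l) ν d ↔ x ∈ D.U ∧ x ≠ root ∧ Agree η x.fst c ∧
    ∃ c', (∀ j, (c j, c' j) ∈ D.p x) ∧ D.Conn x.snd c' l ν d := by
  constructor
  · rintro (_ | ⟨h1, h2, h3, h4, h5⟩)
    exact ⟨h1, h2, h3, _, h4, h5⟩
  · rintro ⟨h1, h2, h3, c', h4, h5⟩
    exact .cons h1 h2 h3 h4 h5

namespace Conn

theorem congr_left (h : D.Conn η c l ν d) (ha : Agree η' η c) : D.Conn η' c l ν d := by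
  cases l with
  | nil =>
    obtain ⟨rfl, h'⟩ := conn_nil_iff.1 h
    exact .nil (ha.trans h')
  | cons x l =>
    obtain ⟨h1, h2, h3, c', h4, h5⟩ := conn_cons_iff.1 h
    exact .cons h1 h2 (ha.trans h3) h4 h5

theorem append (h : D.Conn η c l θ e) (h' : D.Conn θ e l' ν d) : D.Conn η c (l ++ l') ν d := by
  induction h with
  | nil ha => exact h'.congr_left ha
  | cons h1 h2 h3 h4 _ ih => exact .cons h1 h2 h3 h4 (ih h')

theorem exists_of_append (h : D.Conn η c (l ++ l') ν d) :
    ∃ θ e, D.Conn η c l θ e ∧ D.Conn θ e l' ν d := by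
  induction l generalizing η c with
  | nil => exact ⟨η, c, .nil .refl, h⟩
  | cons x l ih =>
    obtain ⟨h1, h2, h3, c', h4, h5⟩ := conn_cons_iff.1 h
    obtain ⟨θ, e, h6, h7⟩ := ih h5
    exact ⟨θ, e, .cons h1 h2 h3 h4 h6, h7⟩

theorem congr_right (h : D.Conn η c l ν d) (ha : Agree ν ν' d) : D.Conn η c l ν' d := by
  have := h.append (.nil ha)
  rwa [List.append_nil] at this

theorem single (hx : x ∈ D.U) (hr : x ≠ root) (h : ∀ j, (c j, d j) ∈ D.p x)
    (ha : Agree η x.fst c) (ha' : Agree x.snd ν d) : D.Conn η c [x] ν d :=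
  .cons hx hr ha h (.nil ha')

theorem inv (H : D.Admissible) (h : D.Conn η c l ν d) :
    D.Conn ν d (l.map Node.inv).reverse η c := by
  induction h with
  | nil ha => exact .nil ha.symm
  | cons h1 h2 h3 h4 _ ih =>
    rw [List.map_cons, List.reverse_cons]
    exact ih.append (single (inv_mem_U H h1) (fun he => h2 (inv_eq_root.1 he))
      (fun j => by rw [p_inv H h1]; exact h4 j) .refl h3.symm)

theorem restrict {ι' : Type*} (h : D.Conn η c l ν d) (f : ι' → ι) :
    D.Conn η (c ∘ f) l ν (d ∘ f) := by
  induction h with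
  | nil ha => exact .nil fun j => ha (f j)
  | cons h1 h2 h3 h4 _ ih => exact .cons h1 h2 (fun j => h3 (f j)) (fun j => h4 (f j)) ih

theorem unique (H : D.Admissible) (h : D.Conn η c l ν d) (h' : D.Conn η' c l ν' d') : d = d' := by
  induction l generalizing η η' c with
  | nil =>
    rw [← (conn_nil_iff.1 h).1, ← (conn_nil_iff.1 h').1]
  | cons x l ih =>
    obtain ⟨h1, -, -, c', h4, h5⟩ := conn_cons_iff.1 h
    obtain ⟨-, -, -, c'', h4', h5'⟩ := conn_cons_iff.1 h'
    obtain rfl : c' = c'' := funext fun j => (pInj_p H h1).1 _ _ _ (h4 j) (h4' j)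
    exact ih h5 h5'

end Conn

/-- A geodesic: a chain whose length is minimal among all chains with the same ends, and whose
nodes are tight for the families of ordinals to which they are applied. -/
structure Geo (D : Data.{u}) {ι : Type*} (η : Ordinal.{u} → Fin 2) (c : ι → Ordinal.{u})
    (l : List Node.{u}) (ν : Ordinal.{u} → Fin 2) (d : ι → Ordinal.{u}) : Prop where
  conn : D.Conn η c l ν d
  le : ∀ l', D.Conn η c l' ν d → l.length ≤ l'.length
  tight : ∀ k x m θ e, l = k ++ x :: m → D.Conn η c k θ e → D.Tight x e

theorem agree_of_below (H : D.Admissible) (hx : x ∈ D.U) (hy : y ∈ D.U) (hr : y ≠ root)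
    (h : y = x ∨ y.Below x) (hp : ∀ j, (c j, c' j) ∈ D.p y) :
    Agree x.fst y.fst c ∧ Agree x.snd y.snd c' := by
  have h0 := (mem_T_ne_root (U_subset_T H hy) hr).1
  have he : y = x.res y.ord := by
    rcases h with rfl | h
    · exact (res_self (U_subset_T H hx)).symm
    · exact h.1
  have h1 : ∀ ξ < bethOrd y.ord, x.fst ξ = y.fst ξ := fun ξ hξ => by
    conv_rhs => rw [he]
    rw [res_fst x h0 hξ]
  have h2 : ∀ ξ < bethOrd y.ord, x.snd ξ = y.snd ξ := fun ξ hξ => by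
    conv_rhs => rw [he]
    rw [res_snd x h0 hξ]
  exact ⟨.of_lt h1 fun j => (p_bound H hy (hp j)).1, .of_lt h2 fun j => (p_bound H hy (hp j)).2⟩

/-- Any chain may be replaced by one of the same length with tight nodes, each of them below or
equal to the corresponding original node. -/
theorem exists_tight_chain (H : D.Admissible) [Nonempty ι] (h : D.Conn η c l ν d) :
    ∃ l', List.Forall₂ (fun y x => y = x ∨ y.Below x) l' l ∧ D.Conn η c l' ν d ∧
      ∀ k x m θ e, l' = k ++ x :: m → D.Conn η c k θ e → D.Tight x e := by
  induction h with
  | nil ha => exact ⟨[], .nil, .nil ha, fun k x m θ e h => by simp at h⟩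
  | @cons η c x c' l ν d h1 h2 h3 h4 _ ih =>
    obtain ⟨l', i1, i2, i3⟩ := ih
    obtain ⟨y, j1, j2, j3, j4, j5⟩ := exists_tight H h1 h4
    obtain ⟨a1, a2⟩ := agree_of_below H h1 j1 j2 j3 j5
    refine ⟨y :: l', .cons j3 i1, .cons j1 j2 (h3.trans a1) j5 (i2.congr_left a2.symm), ?_⟩
    intro k z m θ e he hk
    cases k with
    | nil =>
      obtain ⟨rfl, -⟩ := conn_nil_iff.1 hk
      obtain ⟨rfl, -⟩ := List.cons.inj he
      exact j4
    | cons z' k =>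
      obtain ⟨rfl, he'⟩ := List.cons.inj he
      obtain ⟨-, -, -, c'', h4', h5'⟩ := conn_cons_iff.1 hk
      obtain rfl : c' = c'' := funext fun j => (pInj_p H j1).1 _ _ _ (j5 j) (h4' j)
      exact i3 k z m θ e he' (h5'.congr_left a2)

theorem exists_geo (H : D.Admissible) [Nonempty ι] (h : D.Conn η c l ν d)
    (hmin : ∀ l', D.Conn η c l' ν d → l.length ≤ l'.length) :
    ∃ l', List.Forall₂ (fun y x => y = x ∨ y.Below x) l' l ∧ D.Geo η c l' ν d := by
  obtain ⟨l', h1, h2, h3⟩ := exists_tight_chain H h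
  exact ⟨l', h1, h2, by rwa [h1.length_eq], h3⟩

namespace Geo

theorem tail (h : D.Geo η c (x :: m) ν d) : x ∈ D.U ∧ x ≠ root ∧ Agree η x.fst c ∧ D.Tight x c ∧
    ∃ c', (∀ j, (c j, c' j) ∈ D.p x) ∧ D.Geo x.snd c' m ν d := by
  obtain ⟨h1, h2, h3, c', h4, h5⟩ := conn_cons_iff.1 h.conn
  refine ⟨h1, h2, h3, h.tight [] x m η c rfl (.nil .refl), c', h4, h5, fun l' hl' => ?_, ?_⟩
  · have := h.le (x :: l') (.cons h1 h2 h3 h4 hl')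
    simpa using this
  · intro k y m' θ e he hk
    exact h.tight (x :: k) y m' θ e (by rw [he]; rfl) (.cons h1 h2 h3 h4 hk)

theorem init (h : D.Geo η c (m ++ [y]) ν d) : ∃ e, D.Geo η c m y.fst e ∧
    (∀ j, (e j, d j) ∈ D.p y) ∧ Agree y.snd ν d := by
  obtain ⟨θ, e, h1, h2⟩ := h.conn.exists_of_append
  obtain ⟨h3, h4, h5, c', h6, h7⟩ := conn_cons_iff.1 h2
  obtain ⟨rfl, h8⟩ := conn_nil_iff.1 h7
  refine ⟨e, ⟨h1.congr_right h5, fun l' hl' => ?_, ?_⟩, h6, h8⟩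
  · have := h.le (l' ++ [y]) (hl'.append (.single h3 h4 h6 .refl h8))
    simpa using this
  · intro k z m' θ e he hk
    exact h.tight k z (m' ++ [y]) θ e (by rw [he]; simp) hk

theorem congr_right (h : D.Geo η c l ν d) (ha : Agree ν ν' d) : D.Geo η c l ν' d :=
  ⟨h.conn.congr_right ha, fun l' hl' => h.le l' (hl'.congr_right ha.symm), h.tight⟩

theorem inv (H : D.Admissible) (h : D.Geo η c l ν d) :
    D.Geo ν d (l.map Node.inv).reverse η c := by
  have hii : ∀ l : List Node.{u}, (((l.map Node.inv).reverse).map Node.inv).reverse = l := by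
    intro l
    rw [List.map_reverse, List.reverse_reverse, List.map_map]
    exact List.map_id l
  refine ⟨h.conn.inv H, fun l' hl' => ?_, ?_⟩
  · have := h.le _ (hl'.inv H)
    simpa using this
  · intro k x m θ e he hk
    have hl : l = (m.map Node.inv).reverse ++ x.inv :: (k.map Node.inv).reverse := by
      rw [← hii l, he]
      simp
    have hc := h.conn
    rw [hl] at hc
    obtain ⟨θ', e', h1, h2⟩ := hc.exists_of_append
    obtain ⟨h3, h4, h5, e'', h6, h7⟩ := conn_cons_iff.1 h2
    have ht := (h.tight _ _ _ θ' e' hl h1).inv H h3 h6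
    have h8 := h7.inv H
    rw [hii] at h8
    rw [hk.unique H h8]
    exact ht

variable [Finite ι]

/-- The first node of a geodesic, or its inverse, is ascending. -/
theorem head (H : D.Admissible) (h : D.Geo η c (x :: m) ν d) : ∃ c' β γ,
    (D.Ascends x c c' β γ ∨ D.Ascends x.inv c' c β γ) ∧ D.Geo x.snd c' m ν d := by
  obtain ⟨h1, h2, h3, h4, c', h5, h6⟩ := h.tail
  obtain ⟨β, γ, hA⟩ := ascends_or H h1 h5 h4 (fun ha => by
    obtain rfl : c = c' := funext fun j => (ha j).1
    have := h.le m (h6.conn.congr_left (h3.trans fun j => (ha j).2))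
    simp at this)
  exact ⟨c', β, γ, hA, h6⟩

/-- In a geodesic an ascending node is not followed by a descending one, since the two would be
inverse to each other. Hence a geodesic starting with an ascending node ends with one. -/
theorem last_ascends (H : D.Admissible) (h : D.Geo η c (x :: m) ν d)
    (hA : D.Ascends x c c' β γ) : ∃ k y e β γ, x :: m = k ++ [y] ∧ D.Geo η c k y.fst e ∧
      D.Ascends y e d β γ ∧ ∃ j, ∀ i, c i < d j := by
  induction m generalizing η c x c' β γ with
  | nil =>
    obtain ⟨e, h1, h2, h3⟩ := Geo.init (m := []) h
    obtain ⟨rfl, h4⟩ := conn_nil_iff.1 h1.conn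
    obtain ⟨-, -, -, -, c'', h5, h6⟩ := h.tail
    obtain rfl : c' = c'' := funext fun j => (pInj_p H (hA.up.basic H).1).1 _ _ _ (hA.map j) (h5 j)
    obtain ⟨rfl, -⟩ := conn_nil_iff.1 h6.conn
    exact ⟨[], x, c, β, γ, rfl, h1, hA, hA.exists_lt H⟩
  | cons y m ih =>
    obtain ⟨h1, h2, h3, h4, c'', h5, h6⟩ := h.tail
    obtain rfl : c' = c'' := funext fun j => (pInj_p H h1).1 _ _ _ (hA.map j) (h5 j)
    obtain ⟨c₂, β₂, γ₂, h7 | h7, h8⟩ := h6.head H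
    · obtain ⟨k, z, e, β', γ', e1, e2, e3, j, e4⟩ := ih h6 h7
      obtain ⟨j', hj'⟩ := hA.exists_lt H
      refine ⟨x :: k, z, e, β', γ', by rw [e1]; rfl, ?_, e3, j, fun i => (hj' i).trans (e4 j')⟩
      obtain ⟨e', g1, g2, -⟩ := Geo.init (m := x :: k) (y := z)
        (by rw [List.cons_append, ← e1]; exact h)
      obtain rfl : e = e' := funext fun j =>
        (pInj_p H (e3.up.basic H).1).2 _ _ _ (e3.map j) (g2 j)
      exact g1
    -- an ascending node followed by a descending one can be cut out of the chain
    · exfalso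
      obtain ⟨rfl, rfl, g1, g2, rfl⟩ := hA.unique H h7
      have ha : Agree x.fst y.snd c := by
        refine .of_lt (δ := bethOrd β) (fun ξ hξ => ?_) fun j => hA.up.lt_dom H (hA.map j)
        have h0 := (hA.up.basic H).2.2.1
        have := congrArg (fun z : Node.{u} => z.fst ξ) g2
        simp only [res_fst _ h0 hξ] at this
        exact this
      have := h.le m (h8.conn.congr_left (h3.trans ha))
      simp at this

/-- A geodesic ends with an ascending node, unless its last node is descending, in which case the
entries of `d` are smaller than some entry of `c`. -/
theorem last (H : D.Admissible) (h : D.Geo η c (x :: m) ν d) :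
    (∃ k y e β γ, x :: m = k ++ [y] ∧ D.Geo η c k y.fst e ∧ D.Ascends y e d β γ) ∨
      ∃ j, ∀ i, d i < c j := by
  obtain ⟨k, y, hk⟩ : ∃ k y, x :: m = k ++ [y] :=
    ⟨_, _, (List.dropLast_append_getLast (List.cons_ne_nil x m)).symm⟩
  rw [hk] at h
  have hi := h.inv H
  rw [List.map_append, List.reverse_append] at hi
  change D.Geo ν d (y.inv :: (k.map Node.inv).reverse) η c at hi
  obtain ⟨e, h1, h2, -⟩ := h.init
  obtain ⟨e', β, γ, h3 | h3, -⟩ := hi.head H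
  · obtain ⟨-, -, -, -, -, -, -, -, h4⟩ := hi.last_ascends H h3
    exact Or.inr h4
  · rw [inv_inv] at h3
    obtain rfl : e = e' := funext fun j =>
      (pInj_p H (h3.up.basic H).1).2 _ _ _ (h2 j) (h3.map j)
    exact Or.inl ⟨k, y, e, β, γ, hk, h1, h3⟩

/-- The first nodes of two geodesics with the same ends are of the same kind and have the same
parameters. If both geodesics end with ascending nodes, the last steps have the same parameters and
the same source, and can be removed. Otherwise both start with descending nodes, which are
determined by `c`. -/
theorem head_unique (H : D.Admissible) (h : D.Geo η c (x :: m) ν d)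
    (h' : D.Geo η c (x' :: m') ν d) : ∃ β γ c₁ c₁',
      (D.Ascends x c c₁ β γ ∧ D.Ascends x' c c₁' β γ) ∨
      (D.Ascends x.inv c₁ c β γ ∧ D.Ascends x'.inv c₁' c β γ) := by
  induction hn : m.length using Nat.strong_induction_on generalizing m m' ν d with
  | _ n ih =>
  have hlen : m.length = m'.length := by
    have a := h.le _ h'.conn
    have b := h'.le _ h.conn
    simp only [List.length_cons] at a b
    omega
  have strip : (∃ k y e β γ, x :: m = k ++ [y] ∧ D.Geo η c k y.fst e ∧ D.Ascends y e d β γ) →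
      (∃ k y e β γ, x' :: m' = k ++ [y] ∧ D.Geo η c k y.fst e ∧ D.Ascends y e d β γ) →
      ∃ β γ c₁ c₁', (D.Ascends x c c₁ β γ ∧ D.Ascends x' c c₁' β γ) ∨
      (D.Ascends x.inv c₁ c β γ ∧ D.Ascends x'.inv c₁' c β γ) := by
    rintro ⟨k, y, e, β, γ, e1, e2, e3⟩ ⟨k', y', e', β', γ', e1', e2', e3'⟩
    obtain ⟨rfl, rfl, -, hres, rfl⟩ := e3.unique H e3'
    have hl : k.length = k'.length := by
      have a := congrArg List.length e1
      have b := congrArg List.length e1'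
      simp only [List.length_cons, List.length_append, List.length_nil] at a b
      omega
    cases k with
    | nil =>
      obtain rfl : k' = [] := List.length_eq_zero_iff.1 hl.symm
      obtain ⟨rfl, -⟩ := List.cons.inj e1
      obtain ⟨rfl, -⟩ := List.cons.inj e1'
      obtain ⟨rfl, -⟩ := conn_nil_iff.1 e2.conn
      exact ⟨β, γ, d, d, Or.inl ⟨e3, e3'⟩⟩
    | cons z k =>
      cases k' with
      | nil => simp at hl
      | cons z' k' =>
        obtain ⟨rfl, f1⟩ := List.cons.inj e1
        obtain ⟨rfl, f1'⟩ := List.cons.inj e1'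
        have ha : Agree y'.fst y.fst e := by
          refine .of_lt (δ := bethOrd β) (fun ξ hξ => ?_) fun j => e3.up.lt_dom H (e3.map j)
          have h0 := (e3.up.basic H).2.2.1
          have := congrArg (fun z : Node.{u} => z.fst ξ) hres
          simp only [res_fst _ h0 hξ] at this
          exact this.symm
        refine ih k.length ?_ e2 (e2'.congr_right ha) rfl
        rw [← hn, show m = k ++ [y] from f1, List.length_append, List.length_singleton]
        exact Nat.lt_succ_self _
  obtain ⟨c₁, β, γ, hA | hA, -⟩ := h.head H <;>
  obtain ⟨c₁', β', γ', hA' | hA', -⟩ := h'.head H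
  · obtain ⟨k, y, e, β, γ, e1, e2, e3, -⟩ := h.last_ascends H hA
    obtain ⟨k', y', e', β', γ', e1', e2', e3', -⟩ := h'.last_ascends H hA'
    exact strip ⟨k, y, e, β, γ, e1, e2, e3⟩ ⟨k', y', e', β', γ', e1', e2', e3'⟩
  · obtain ⟨k, y, e, β, γ, e1, e2, e3, j, hj⟩ := h.last_ascends H hA
    rcases h'.last H with h1 | ⟨j', hj'⟩
    · exact strip ⟨k, y, e, β, γ, e1, e2, e3⟩ h1
    · exact absurd (hj j') (not_lt.2 (hj' j).le)
  · obtain ⟨k, y, e, β, γ, e1, e2, e3, j, hj⟩ := h'.last_ascends H hA'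
    rcases h.last H with h1 | ⟨j', hj'⟩
    · exact strip h1 ⟨k, y, e, β, γ, e1, e2, e3⟩
    · exact absurd (hj j') (not_lt.2 (hj' j).le)
  · obtain ⟨rfl, rfl, -⟩ := hA.unique H hA'
    exact ⟨β, γ, c₁, c₁', Or.inr ⟨hA, hA'⟩⟩

end Geo

end Data

/-! ### Branches of the tree -/

/-- A closed unbounded subset of a regular cardinal `κ` has limit points, in the set, of every
regular cofinality below `κ`. -/
theorem exists_limit_point_cof {κ c : Cardinal.{u}} (hκ : κ.IsRegular) (hc : c.IsRegular)
    (hlt : c < κ) {C : Set Ordinal.{u}} (hCκ : ∀ δ ∈ C, δ < κ.ord)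
    (hun : ∀ α < κ.ord, ∃ δ ∈ C, α < δ)
    (hcl : ∀ S ⊆ C, S.Nonempty → sSup S < κ.ord → sSup S ∈ C) {θ : Ordinal.{u}}
    (hθ : θ < κ.ord) :
    ∃ δ ∈ C, θ < δ ∧ δ.cof = c ∧ ∀ α < δ, ∃ ε ∈ C, α < ε ∧ ε < δ := by
  -- a closed unbounded class of ordinals, whose enumeration is continuous
  let E : Set Ordinal.{u} := (C ∩ Ioi θ) ∪ Ici κ.ord
  have hE : ¬ BddAbove E := by
    rintro ⟨b, hb⟩
    have h1 : max κ.ord (b + 1) ∈ E := Or.inr (mem_Ici.2 (le_max_left _ _))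
    exact absurd (hb h1) (not_le.2 ((Order.lt_add_one_iff.2 le_rfl).trans_le (le_max_right _ _)))
  have hn : Order.IsNormal (Ordinal.enumOrd E) := by
    refine Ordinal.isNormal_enumOrd (fun S hS hne hb => ?_) hE
    by_cases hk : κ.ord ≤ sSup S
    · exact Or.inr hk
    · rw [not_le] at hk
      have hSC : S ⊆ C ∩ Ioi θ := fun s hs =>
        (hS hs).resolve_right fun h => absurd ((le_csSup hb hs).trans_lt hk) (not_lt.2 h)
      refine Or.inl ⟨hcl S (fun s hs => (hSC hs).1) hne hk, ?_⟩
      obtain ⟨s, hs⟩ := hne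
      exact lt_of_lt_of_le (hSC hs).2 (le_csSup hb hs)
  have hlt' : ∀ i < κ.ord, Ordinal.enumOrd E i < κ.ord := by
    intro i
    induction i using WellFoundedLT.induction with
    | _ i ih =>
    intro hi
    obtain ⟨α, hα, h1⟩ := exists_bound_of_mk_lt hκ (ι := Iio i)
      (f := fun j => Ordinal.enumOrd E j.1) (by
        refine Cardinal.mk_range_le.trans_lt ?_
        rw [Cardinal.mk_Iio_ordinal, Cardinal.lift_lt]
        exact Cardinal.lt_ord.1 hi) fun j => ih j.1 j.2 (lt_trans j.2 hi)
    obtain ⟨δ, hδ, h2⟩ := hun (max α θ) (max_lt hα hθ)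
    refine (Ordinal.enumOrd_le_of_forall_lt (s := E) (a := δ)
      (Or.inl ⟨hδ, (le_max_right α θ).trans_lt h2⟩) fun b hb => ?_).trans_lt (hCκ δ hδ)
    exact (h1 ⟨b, hb⟩).trans ((le_max_left α θ).trans_lt h2)
  have hC : ∀ i < κ.ord, Ordinal.enumOrd E i ∈ C ∩ Ioi θ := fun i hi =>
    (Ordinal.enumOrd_mem hE i).resolve_right fun h => absurd (hlt' i hi) (not_lt.2 h)
  have hco : c.ord < κ.ord := Cardinal.ord_lt_ord.2 hlt
  have hl : Order.IsSuccLimit c.ord := Cardinal.isSuccLimit_ord hc.aleph0_le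
  refine ⟨Ordinal.enumOrd E c.ord, (hC _ hco).1, (hC _ hco).2, ?_, fun α hα => ?_⟩
  · rw [Ordinal.cof_map_of_isNormal hn hl, hc.cof_ord]
  · obtain ⟨i, hi, hαi⟩ := (hn.lt_iff_exists_lt hl).1 hα
    exact ⟨_, (hC i (hi.trans hco)).1, hαi, Ordinal.enumOrd_strictMono hE hi⟩

theorem IsElem.congr {κ : Cardinal.{u}} {P : Set ZFSet.{u}} {s t r s' t' r' : Fun2 κ}
    {δ ε : Ordinal.{u}} {h : δ ≤ ε} (H : IsElem P s t r h)
    (hs : ∀ ξ < ε, ext s ξ = ext s' ξ) (ht : ∀ ξ < ε, ext t ξ = ext t' ξ)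
    (hr : ∀ ξ < ε, ext r ξ = ext r' ξ) : IsElem P s' t' r' h := by
  intro n φ v
  have := H n φ v
  unfold Tr at this
  rw [str_congr hs ht hr, str_congr (fun ξ hξ => hs ξ (hξ.trans_le h))
    (fun ξ hξ => ht ξ (hξ.trans_le h)) (fun ξ hξ => hr ξ (hξ.trans_le h))] at this
  exact this

/-- Truth of a sentence in `V_δ`. -/
theorem IsElem.sentence {κ : Cardinal.{u}} {P : Set ZFSet.{u}} {s t r : Fun2 κ}
    {δ : Ordinal.{u}} {h : δ ≤ κ.ord} (H : IsElem P s t r h) (φ : voc.Sentence) :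
    Sat φ P s t r ↔ @FirstOrder.Language.Sentence.Realize voc (VSet δ) (str P s t r δ) φ := by
  have := H 0 φ default
  rw [Subsingleton.elim (incl h ∘ default) default] at this
  exact this

namespace Data

variable {D : Data.{u}}

theorem zero_lt_kappa (H : D.Admissible) : 0 < D.κ.ord :=
  Cardinal.lt_ord.2 (by simpa [pos_iff_ne_zero] using H.inacc.ne_zero)

/-- A directed family of nodes `x i` of `U`, considered up to `b i`, which coheres and whose closed
sets have a union unbounded in `κ`: the union of these nodes is a witness for `s ∼ t`, where
`s` and `t` are its first two components. The reason is that no member of `T_G` occurs in the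
union, since such a member could not be continued at limit points of cofinality `λ`. -/
theorem exists_sat_of_branch (H : D.Admissible) {I : Type*} (x : I → Node.{u})
    (b : I → Ordinal.{u}) (hU : ∀ i, x i ∈ D.U) (h0 : ∀ i, b i ≠ 0)
    (hb : ∀ i, b i < (x i).ord) (hsp : ∀ i, (x i).Split (b i))
    (hdir : ∀ i j, ∃ k, b i ≤ b k ∧ b j ≤ b k ∧ (x k).res (b i) = (x i).res (b i) ∧
      (x k).res (b j) = (x j).res (b j))
    (hun : ∀ α < D.κ.ord, ∃ i, ∃ δ ∈ (x i).cub, α < δ ∧ δ < b i) :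
    ∃ s t r : Fun2 D.κ, Sat D.φ D.P s t r ∧ ∀ i, ∀ ξ < bethOrd (b i),
      (x i).fst ξ = ext s ξ ∧ (x i).snd ξ = ext t ξ := by
  classical
  have hκ := H.inacc.isRegular
  have hUT : ∀ i, x i ∈ T D.κ := fun i => U_subset_T H (hU i)
  have hbκ : ∀ i, b i < D.κ.ord := fun i => (hb i).trans (ord_lt_of_mem_T (hUT i))
  have cres : ∀ i j, ∀ δ ≤ b i, δ ≤ b j → (x i).res δ = (x j).res δ := by
    intro i j δ hi hj
    obtain ⟨k, -, -, h3, h4⟩ := hdir i j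
    rw [← res_res (x i) hi, ← res_res (x j) hj, ← h3, ← h4, res_res _ hi, res_res _ hj]
  have cval : ∀ i j, ∀ ξ, ξ < bethOrd (b i) → ξ < bethOrd (b j) → (x i).fst ξ = (x j).fst ξ ∧
      (x i).snd ξ = (x j).snd ξ ∧ (x i).trd ξ = (x j).trd ξ := by
    intro i j ξ hi hj
    obtain ⟨k, -, -, h3, h4⟩ := hdir i j
    have e := fun f : Node.{u} → Fin 2 => (congrArg f h3).symm
    have e' := fun f : Node.{u} → Fin 2 => congrArg f h4
    have e1 := e fun z => z.fst ξ
    have e2 := e fun z => z.snd ξ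
    have e3 := e fun z => z.trd ξ
    have e1' := e' fun z => z.fst ξ
    have e2' := e' fun z => z.snd ξ
    have e3' := e' fun z => z.trd ξ
    simp only [res_fst _ (h0 i) hi, res_fst _ (h0 j) hj] at e1 e1'
    simp only [res_snd _ (h0 i) hi, res_snd _ (h0 j) hj] at e2 e2'
    simp only [res_trd _ (h0 i) hi, res_trd _ (h0 j) hj] at e3 e3'
    exact ⟨e1.trans e1', e2.trans e2', e3.trans e3'⟩
  have ccub : ∀ i j, ∀ δ < b i, δ < b j → δ ∈ (x i).cub → δ ∈ (x j).cub := by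
    intro i j δ hi hj hδ
    obtain ⟨k, -, -, h3, h4⟩ := hdir i j
    have e := (congrArg Node.cub h3).symm
    have e' := congrArg Node.cub h4
    rw [res_cub, res_cub] at e e'
    have h5 : δ ∈ (x k).cub ∩ Iio (b i) := by rw [← e]; exact ⟨hδ, hi⟩
    have h6 : δ ∈ (x k).cub ∩ Iio (b j) := ⟨h5.1, hj⟩
    rw [e'] at h6
    exact h6.1
  -- the functions and the closed set along the branch
  let glue : (Node.{u} → Ordinal.{u} → Fin 2) → Fun2 D.κ := fun f ξ =>
    if h : ∃ i, ξ.1 < bethOrd (b i) then f (x h.choose) ξ.1 else 0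
  let s := glue Node.fst
  let t := glue Node.snd
  let r := glue Node.trd
  have hglue : ∀ f : Node.{u} → Ordinal.{u} → Fin 2, (∀ i j, ∀ ξ, ξ < bethOrd (b i) →
      ξ < bethOrd (b j) → f (x i) ξ = f (x j) ξ) → ∀ i, ∀ ξ < bethOrd (b i),
      f (x i) ξ = ext (glue f) ξ := by
    intro f hf i ξ hξ
    rw [ext_of_lt _ (hξ.trans (bethOrd_lt_kappa H _ (hbκ i)))]
    have hex : ∃ i, ξ < bethOrd (b i) := ⟨i, hξ⟩
    simp only [glue, dif_pos hex]
    exact hf _ _ _ hξ hex.choose_spec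
  have hs : ∀ i, ∀ ξ < bethOrd (b i), (x i).fst ξ = ext s ξ :=
    hglue _ fun i j ξ h1 h2 => (cval i j ξ h1 h2).1
  have ht : ∀ i, ∀ ξ < bethOrd (b i), (x i).snd ξ = ext t ξ :=
    hglue _ fun i j ξ h1 h2 => (cval i j ξ h1 h2).2.1
  have hr : ∀ i, ∀ ξ < bethOrd (b i), (x i).trd ξ = ext r ξ :=
    hglue _ fun i j ξ h1 h2 => (cval i j ξ h1 h2).2.2
  let C : Set Ordinal.{u} := {δ | ∃ i, δ ∈ (x i).cub ∧ δ < b i}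
  have hCun : ∀ α < D.κ.ord, ∃ δ ∈ C, α < δ := fun α hα => by
    obtain ⟨i, δ, h1, h2, h3⟩ := hun α hα
    exact ⟨δ, ⟨i, h1, h3⟩, h2⟩
  have hCκ : ∀ δ ∈ C, δ < D.κ.ord := fun δ ⟨i, _, h⟩ => h.trans (hbκ i)
  have hCi : ∀ δ ∈ C, ∀ i, δ < b i → δ ∈ (x i).cub := fun δ ⟨j, h1, h2⟩ i hi =>
    ccub j i δ h2 hi h1
  have hCcl : ∀ S ⊆ C, S.Nonempty → sSup S < D.κ.ord → sSup S ∈ C := by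
    intro S hS hne hlt
    obtain ⟨i, δ, h1, h2, h3⟩ := hun _ hlt
    have hbd : BddAbove S := ⟨D.κ.ord, fun s hs => (hCκ s (hS hs)).le⟩
    have h4 := h2.trans h3
    have hroot : x i ≠ root := by
      intro he
      have := hb i
      rw [he] at this
      exact not_lt_zero this
    exact ⟨i, (mem_T_ne_root (hUT i) hroot).2.2.2.2 S
      (fun s hs => hCi s (hS hs) i ((le_csSup hbd hs).trans_lt h4)) hne (h4.trans (hb i)), h4⟩
  obtain ⟨i₁, -⟩ := hun 0 (zero_lt_kappa H)
  have hsplit : ∀ i, ∀ δ, b i₁ ≤ δ → δ < b i → (x i).Split δ := by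
    intro i δ h1 h2
    obtain ⟨ξ, hξ, hne⟩ := hsp i₁
    have hξi : ξ < bethOrd (b i) := hξ.trans (bethOrd_lt.2 (h1.trans_lt h2))
    obtain ⟨e1, e2, -⟩ := cval i₁ i ξ hξ hξi
    exact ⟨ξ, hξ.trans_le (bethOrd_le.2 h1), by rwa [← e1, ← e2]⟩
  have hne0 : ∀ δ, b i₁ ≤ δ → δ ≠ 0 := fun δ h he => h0 i₁ (by rw [he] at h; simpa using h)
  have hHG : ∀ i, ∀ δ ∈ C, b i₁ ≤ δ → δ < b i → (x i).res δ ∈ D.TH ∪ D.TG :=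
    fun i δ hδ h1 h2 => res_mem_TH_union_TG H (hU i).1 (hCi δ hδ i h2) (hne0 δ h1)
      (hsplit i δ h1 h2)
  -- if a restriction were not in `T_H`, neither would be that to a limit point of cofinality `λ`
  have hTH : ∀ i, ∀ δ ∈ C, b i₁ ≤ δ → δ < b i → (x i).res δ ∈ D.TH := by
    intro i δ₀ hδ₀ h1 h2
    by_contra hnot
    obtain ⟨δ, hδ, hlt, hcof, hlim⟩ := exists_limit_point_cof hκ H.regular H.lam_lt hCκ hCun hCcl
      (hCκ δ₀ hδ₀)
    obtain ⟨j, _, -, h3, h4⟩ := hun δ (hCκ δ hδ)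
    have hδj := h3.trans h4
    have h5 := hHG j δ hδ (h1.trans hlt.le) hδj
    have hroot : (x j).res δ ≠ root := fun he => by
      have := congrArg Node.ord he
      rw [res_ord] at this
      exact hne0 δ (h1.trans hlt.le) this
    rcases h5 with h5 | h5
    · have h6 := res_mem_TH (γ := δ₀) h5
        (by rw [res_cub]; exact ⟨hCi δ₀ hδ₀ j (hlt.trans hδj), hlt⟩)
        (hne0 δ₀ h1) (by
          obtain ⟨ξ, hξ, hne⟩ := hsplit j δ₀ h1 (hlt.trans hδj)
          have hξ' := hξ.trans (bethOrd_lt.2 hlt)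
          refine ⟨ξ, hξ, ?_⟩
          rwa [res_fst _ (hne0 δ (h1.trans hlt.le)) hξ',
            res_snd _ (hne0 δ (h1.trans hlt.le)) hξ'])
      rw [res_res _ hlt.le, cres j i δ₀ (hlt.trans hδj).le h2.le] at h6
      exact hnot h6
    · rcases TG_kinds H h5 hroot with ⟨⟨-, γ, hγ⟩, -⟩ | ⟨-, -, h6, -⟩
      · rw [res_ord] at hγ
        obtain ⟨ε, -, h7, h8⟩ := hlim (Order.succ γ) (by rw [hγ]; exact Order.lt_succ _)
        rw [hγ] at h8
        exact absurd (Order.lt_succ_iff.1 h8) (not_le.2 h7)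
      · rw [res_ord, hcof] at h6
        exact lt_irrefl _ h6
  -- the levels of the branch are elementary submodels with respect to the union
  let S : Set Ordinal.{u} := {δ | δ ∈ C ∧ b i₁ ≤ δ}
  have data : ∀ ε ∈ S, ∃ s' t' r' : Fun2 D.κ, (∀ ξ < ε, ext s' ξ = ext s ξ) ∧
      (∀ ξ < ε, ext t' ξ = ext t ξ) ∧ (∀ ξ < ε, ext r' ξ = ext r ξ) ∧
      Sat D.φ D.P s' t' r' ∧ ∀ δ ∈ S, δ ≤ ε → ElemSub D.P s' t' r' δ := by
    intro ε hε
    obtain ⟨i, _, -, h3, h4⟩ := hun ε (hCκ ε hε.1)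
    have hεi := h3.trans h4
    have hε0 := hne0 ε hε.2
    obtain ⟨h5, s', t', r', h6, h7, h8⟩ := hTH i ε hε.1 hε.2 hεi
    rw [res_ord] at h6 h7 h8
    have hlt : ∀ ξ < ε, ξ < bethOrd ε ∧ ξ < bethOrd (b i) := fun ξ hξ =>
      ⟨hξ.trans_le (le_bethOrd ε), hξ.trans_le ((le_bethOrd ε).trans (bethOrd_le.2 hεi.le))⟩
    have key : ∀ δ ∈ D.club s' t' r', δ ≠ 0 → ElemSub D.P s' t' r' δ ∧ Sat D.φ D.P s' t' r' :=
      fun δ hδ h0 => (hδ.resolve_left h0).2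
    refine ⟨s', t', r', ?_, ?_, ?_, (key ε h7 hε0).2, fun δ hδ hle => ?_⟩
    · intro ξ hξ
      rw [← (h6 ξ (hlt ξ hξ).1).1, res_fst _ hε0 (hlt ξ hξ).1, hs i ξ (hlt ξ hξ).2]
    · intro ξ hξ
      rw [← (h6 ξ (hlt ξ hξ).1).2.1, res_snd _ hε0 (hlt ξ hξ).1, ht i ξ (hlt ξ hξ).2]
    · intro ξ hξ
      rw [← (h6 ξ (hlt ξ hξ).1).2.2, res_trd _ hε0 (hlt ξ hξ).1, hr i ξ (hlt ξ hξ).2]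
    · rcases hle.lt_or_eq with hlt | rfl
      · have h9 : δ ∈ ((x i).res ε).cub := by
          rw [res_cub]
          exact ⟨hCi δ hδ.1 i (hlt.trans hεi), hlt⟩
        rw [h8] at h9
        exact (key δ h9.1 (hne0 δ hδ.2)).1
      · exact (key δ h7 hε0).1
  have hel : ∀ δ ∈ S, ∀ ε ∈ S, ∀ h : δ ≤ ε, IsElem D.P s t r h := by
    intro δ hδ ε hε h
    obtain ⟨s', t', r', h1, h2, h3, -, h5⟩ := data ε hε
    obtain ⟨h6, h7⟩ := elemSub_iff.1 (h5 δ hδ h)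
    obtain ⟨h8, h9⟩ := elemSub_iff.1 (h5 ε hε le_rfl)
    exact (IsElem.of_trans (h := h) (h' := h8) h7 h9).congr h1 h2 h3
  have hSun : ∀ α < D.κ.ord, ∃ δ ∈ S, α < δ := fun α hα => by
    obtain ⟨δ, h1, h2⟩ := hCun (max α (b i₁)) (max_lt hα (hbκ i₁))
    exact ⟨δ, ⟨h1, ((le_max_right _ _).trans_lt h2).le⟩, (le_max_left _ _).trans_lt h2⟩
  obtain ⟨ε, hε, -⟩ := hSun _ (hbκ i₁)
  have hfin := isElem_of_chain (σ := D.κ.ord) (fun δ hδ => (hCκ δ hδ.1).le) hSun hel hε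
  refine ⟨s, t, r, ?_, fun i ξ hξ => ⟨hs i ξ hξ, ht i ξ hξ⟩⟩
  obtain ⟨s', t', r', h1, h2, h3, h4, h5⟩ := data ε hε
  obtain ⟨h6, h7⟩ := elemSub_iff.1 (h5 ε hε le_rfl)
  rw [hfin.sentence, ← str_congr h1 h2 h3, ← h7.sentence]
  exact h4

end Data

/-! ### Chains of bounded length between the finite parts of families of length `κ` -/

namespace Data

variable {D : Data.{u}} {x x' y y' z v w : Node.{u}} {β β' γ γ' ξ ξ' ζ : Ordinal.{u}}

/-- `x` or its inverse is ascending with the parameters `β`, `γ`. -/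
def Moves (D : Data.{u}) (x : Node.{u}) (β γ : Ordinal.{u}) : Prop :=
  D.Up x β γ ∨ D.Up x.inv β γ

theorem Up.exists_reflectsAt (h : D.Up x β γ) : ∃ z v, z ∈ TLex D.κ ∧
    (z = x ∨ z = x.inv) ∧ D.SuccOf z v ∧ D.ReflectsAt z v β := by
  obtain ⟨v, ⟨h1, h2, h3, -⟩ | ⟨h1, h2, h3, -⟩⟩ := h
  · exact ⟨x, v, h1, Or.inl rfl, h2, h3⟩
  · exact ⟨x.inv, v, h1, Or.inr rfl, h2, h3⟩

theorem Moves.exists_reflectsAt (h : D.Moves x β γ) : ∃ z v, z ∈ TLex D.κ ∧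
    (z = x ∨ z = x.inv) ∧ D.SuccOf z v ∧ D.ReflectsAt z v β := by
  rcases h with h | h
  · exact h.exists_reflectsAt
  · obtain ⟨z, v, h1, h2, h3⟩ := h.exists_reflectsAt
    rw [inv_inv] at h2
    exact ⟨z, v, h1, h2.symm, h3⟩

theorem Moves.unique (H : D.Admissible) (h : D.Moves x β γ) (h' : D.Moves x β' γ') : β = β' := by
  obtain ⟨z, v, h1, h2, h3, h4⟩ := h.exists_reflectsAt
  obtain ⟨z', v', h1', h2', h3', h4'⟩ := h'.exists_reflectsAt
  have hz : z = z' := by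
    rcases h2 with rfl | rfl <;> rcases h2' with rfl | rfl
    · rfl
    · exact absurd h1' (not_mem_TLex_inv h1)
    · exact absurd h1 (not_mem_TLex_inv h1')
    · rfl
  subst hz
  obtain rfl := h3.unique h3'
  exact reflectsAt_unique H h3 h4 h4'

theorem Moves.basic (H : D.Admissible) (h : D.Moves x β γ) :
    x ∈ D.U ∧ x ≠ root ∧ β ≠ 0 ∧ β < x.ord ∧ x.Split β := by
  rcases h with h | h
  · obtain ⟨h1, h2, h3, h4, h5, -⟩ := h.basic H
    exact ⟨h1, h2, h3, h4, h5⟩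
  · obtain ⟨h1, h2, h3, h4, h5, -⟩ := h.basic H
    exact ⟨(inv_mem_U_iff H).1 h1, fun he => h2 (inv_eq_root.2 he), h3, h4, split_inv.1 h5⟩

theorem Moves.ord_le (H : D.Admissible) (h : D.Moves x β γ) (hy : y ∈ D.U) (hb : y.Below x) :
    y.ord ≤ β := by
  have key : ∀ {x y : Node.{u}}, D.Up x β γ → y ∈ D.U → y.Below x → y.ord ≤ β := by
    intro x y h hy hb
    obtain ⟨v, hs, hv, -⟩ := h.eq H
    rcases hs.eq_or_below hy hb with rfl | h1
    · exact hv
    · exact (h1.ord_lt (U_subset_T H hs.2.1)).le.trans hv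
  rcases h with h | h
  · exact key h hy hb
  · exact key (y := y.inv) h (inv_mem_U H hy) hb.inv

theorem Moves.lt (H : D.Admissible) (h : D.Moves x β γ) (hz : (ξ, ζ) ∈ D.p x) :
    ξ < bethOrd (Order.succ β) := by
  rcases h with h | h
  · exact (h.lt_dom H hz).trans (bethOrd_lt.2 (Order.lt_succ β))
  · refine h.lt_ran H (ξ := ζ) ?_
    rw [p_inv H ((inv_mem_U_iff H).1 (h.basic H).1)]
    exact hz

/-- If `c` and `d` are injective families of length `κ` of ordinals below `κ`, and the restrictions
to finite sets of indices are connected by chains of length at most `n`, then `η ∼ ν`. By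
the uniqueness of the first nodes of geodesics, the first nodes for the various finite sets cohere
and form a branch which shows that `η` is equivalent to a function `t`, to which the induction
hypothesis applies. -/
theorem equiv_of_finite_chains (H : D.Admissible) (n : ℕ) (η ν : Fun2 D.κ)
    (c d : Iio D.κ.ord → Ordinal.{u}) (hc : Function.Injective c) (hcκ : ∀ i, c i < D.κ.ord)
    (h : ∀ W : Finset (Iio D.κ.ord), ∃ l, l.length ≤ n ∧
      D.Conn (ext η) (fun i : W => c i) l (ext ν) (fun i : W => d i)) : D.Equiv η ν := by
  classical
  have hκlim := isSuccLimit_ord_of_inaccessible H.inacc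
  induction n generalizing η c with
  | zero =>
    have : η = ν := by
      refine ext_injective (funext fun ξ => ?_)
      by_cases hξ : ξ < D.κ.ord
      · obtain ⟨i, hi⟩ := exists_le_of_injective hc hξ
        obtain ⟨l, hl, hC⟩ := h {i}
        obtain rfl := List.length_eq_zero_iff.1 (Nat.le_zero.1 hl)
        exact (conn_nil_iff.1 hC).2 ⟨i, Finset.mem_singleton_self i⟩ ξ hi
      · rw [ext_of_le _ (not_lt.1 hξ), ext_of_le _ (not_lt.1 hξ)]
    rw [this]
    exact H.equiv.2.refl ν
  | succ n ih =>
    by_cases hall : ∀ W : Finset (Iio D.κ.ord), ∃ l, l.length ≤ n ∧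
      D.Conn (ext η) (fun i : W => c i) l (ext ν) (fun i : W => d i)
    · exact ih η c hc hcκ hall
    push Not at hall
    obtain ⟨W₀, hW₀⟩ := hall
    -- for finite sets including `W₀` the shortest chains have length `n + 1`
    have hne : W₀.Nonempty := by
      by_contra hemp
      rw [Finset.not_nonempty_iff_eq_empty] at hemp
      subst hemp
      refine hW₀ [] (Nat.zero_le _) (conn_nil_iff.2 ⟨funext fun i => ?_, fun i => ?_⟩)
      · exact absurd i.2 (Finset.notMem_empty _)
      · exact absurd i.2 (Finset.notMem_empty _)
    have hmin : ∀ W, W₀ ⊆ W → ∀ l, D.Conn (ext η) (fun i : W => c i) l (ext ν)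
        (fun i : W => d i) → n + 1 ≤ l.length := by
      intro W hW l hl
      have h1 := hl.restrict (fun i : W₀ => (⟨i.1, hW i.2⟩ : W))
      by_contra hlt
      exact hW₀ l (by omega) h1
    have hgeo : ∀ W, W₀ ⊆ W → ∃ (x : Node.{u}) (m : List Node.{u}) (β γ : Ordinal.{u}),
        m.length = n ∧ D.Moves x β γ ∧
        D.Geo (ext η) (fun i : W => c i) (x :: m) (ext ν) (fun i : W => d i) := by
      intro W hW
      obtain ⟨i, hi⟩ := hne.mono hW
      have : Nonempty W := ⟨⟨i, hi⟩⟩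
      obtain ⟨l, hl, hC⟩ := h W
      obtain ⟨l', h1, h2⟩ := exists_geo H hC fun l' hl' => hl.trans (hmin W hW l' hl')
      have h3 := hmin W hW l' h2.conn
      rw [h1.length_eq] at h3
      have h4 : l'.length = n + 1 := by rw [h1.length_eq]; omega
      cases l' with
      | nil => simp at h4
      | cons x m =>
        obtain ⟨c', β, γ, h5, -⟩ := h2.head H
        refine ⟨x, m, β, γ, by simpa using h4, ?_, h2⟩
        exact h5.imp (fun h => h.up) fun h => h.up
    let I := {W : Finset (Iio D.κ.ord) // W₀ ⊆ W}
    choose X M B Γ hM hmov hG using fun W : I => hgeo W.1 W.2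
    -- comparison of the first nodes for two sets of indices
    have cmp : ∀ W W' : I, W.1 ⊆ W'.1 → ∃ y γ, y ∈ D.U ∧ (y = X W' ∨ y.Below (X W')) ∧
        D.Moves y (B W) γ ∧ y.res (B W) = (X W).res (B W) ∧ D.p y = D.p (X W) := by
      intro W W' hWW
      have h1 := (hG W').conn.restrict (fun i : W.1 => (⟨i.1, hWW i.2⟩ : W'.1))
      obtain ⟨i, hi⟩ := hne.mono W.2
      have : Nonempty W.1 := ⟨⟨i, hi⟩⟩
      obtain ⟨l', h2, h3⟩ := exists_geo H h1 fun l' hl' => by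
        have := hmin W.1 W.2 l' hl'
        rw [List.length_cons, hM W']
        exact this
      cases l' with
      | nil => simp at h2
      | cons y m =>
        obtain ⟨h4, -⟩ := List.forall₂_cons.1 h2
        obtain ⟨β, γ, c₁, c₁', h5 | h5⟩ := (hG W).head_unique H h3
        · have hβ := (hmov W).unique H (Or.inl h5.1.up)
          rw [hβ]
          obtain ⟨e1, e2⟩ := h5.1.up.unique H h5.2.up
          exact ⟨y, γ, (h5.2.up.basic H).1, h4, Or.inl h5.2.up, e2.symm, e1.symm⟩
        · have hβ := (hmov W).unique H (Or.inr h5.1.up)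
          rw [hβ]
          obtain ⟨e1, e2⟩ := h5.1.up.unique H h5.2.up
          have hy := (inv_mem_U_iff H).1 (h5.2.up.basic H).1
          have hx := (inv_mem_U_iff H).1 (h5.1.up.basic H).1
          refine ⟨y, γ, hy, h4, Or.inr h5.2.up, ?_, ?_⟩
          · rw [inv_res, inv_res] at e2
            exact (congrArg Node.inv e2).symm
          · rw [p_inv H hx, p_inv H hy] at e1
            exact (congrArg gInv e1).symm
    have hres : ∀ W W' : I, W.1 ⊆ W'.1 → B W ≤ B W' ∧ (X W').res (B W) = (X W).res (B W) ∧
        D.p (X W) ⊆ D.p (X W') := by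
      intro W W' hWW
      obtain ⟨y, γ, h1, rfl | h2, h3, h4, h5⟩ := cmp W W' hWW
      · exact ⟨(h3.unique H (hmov W')).le, h4, h5.symm.subset⟩
      · have hlt := (h3.basic H).2.2.2.1
        have hX := ((hmov W').basic H).1
        refine ⟨hlt.le.trans ((hmov W').ord_le H h1 h2), ?_, ?_⟩
        · rw [← h4, h2.1, res_res _ hlt.le]
        · rw [← h5]
          exact p_mono H hX h1 h2
    have hBun : ∀ α < D.κ.ord, ∀ W : I, ∃ W' : I, W.1 ⊆ W'.1 ∧ α < B W' := by
      intro α hα W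
      obtain ⟨i, hi⟩ := exists_le_of_injective hc
        (bethOrd_lt_kappa H _ (hκlim.succ_lt hα))
      refine ⟨⟨insert i W.1, W.2.trans (Finset.subset_insert _ _)⟩, Finset.subset_insert _ _, ?_⟩
      obtain ⟨-, -, -, -, c', h5, -⟩ := (hG ⟨insert i W.1,
        W.2.trans (Finset.subset_insert _ _)⟩).tail
      have := (hmov _).lt H (h5 ⟨i, Finset.mem_insert_self i _⟩)
      exact Order.succ_lt_succ_iff.1 (bethOrd_lt.1 (hi.trans_lt this))
    have hBκ : ∀ W, B W < D.κ.ord := fun W =>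
      ((hmov W).basic H).2.2.2.1.trans (ord_lt_of_mem_T (U_subset_T H ((hmov W).basic H).1))
    obtain ⟨s, t, r, hsat, hst⟩ := exists_sat_of_branch H X B (fun W => ((hmov W).basic H).1)
      (fun W => ((hmov W).basic H).2.2.1) (fun W => ((hmov W).basic H).2.2.2.1)
      (fun W => ((hmov W).basic H).2.2.2.2)
      (fun W W' => by
        let W'' : I := ⟨W.1 ∪ W'.1, W.2.trans Finset.subset_union_left⟩
        obtain ⟨a1, a2, -⟩ := hres W W'' Finset.subset_union_left
        obtain ⟨b1, b2, -⟩ := hres W' W'' Finset.subset_union_right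
        exact ⟨W'', a1, b1, a2, b2⟩)
      (fun α hα => by
        -- the first nodes for three increasing sets of indices with increasing parameters: the
        -- first two have versions below the third one, and the height of the lower version is a
        -- member of the closed set of the third node
        obtain ⟨W, -, h1⟩ := hBun α hα ⟨W₀, subset_rfl⟩
        obtain ⟨W', h2, h3⟩ := hBun _ (hBκ W) W
        obtain ⟨W'', h4, h5⟩ := hBun _ (hBκ W') W'
        obtain ⟨y, γ, k1, k2, k3, -⟩ := cmp W W'' (h2.trans h4)
        obtain ⟨z, γ', j1, j2, j3, -⟩ := cmp W' W'' h4
        have k4 : y.Below (X W'') := k2.resolve_left fun he => by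
          rw [he] at k3
          exact (h3.trans h5).ne (k3.unique H (hmov W''))
        have j4 : z.Below (X W'') := j2.resolve_left fun he => by
          rw [he] at j3
          exact h5.ne (j3.unique H (hmov W''))
        have hlt : y.ord < z.ord := by
          rcases lt_trichotomy y.ord z.ord with h6 | h6 | h6
          · exact h6
          · rw [eq_of_ord_eq k4 j4 h6] at k3
            exact absurd (k3.unique H j3) h3.ne
          · have := k3.ord_le H j1 (below_of_lt j4 k4 h6)
            exact absurd (h3.trans (j3.basic H).2.2.2.1) (not_lt.2 this)
        refine ⟨W'', y.ord, k4.2, h1.trans (k3.basic H).2.2.2.1, ?_⟩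
        exact (j3.ord_le H k1 (below_of_lt k4 j4 hlt)).trans_lt h5)
    have hlt_beth : ∀ {ξ : Ordinal.{u}} {W : I}, ξ < B W → ξ < bethOrd (B W) :=
      fun h => h.trans_le (le_bethOrd _)
    have hη : s = η := by
      refine ext_injective (funext fun ξ => ?_)
      by_cases hξ : ξ < D.κ.ord
      · obtain ⟨i, hi⟩ := exists_le_of_injective hc hξ
        obtain ⟨W, hW, h1⟩ := hBun ξ hξ ⟨insert i W₀, Finset.subset_insert _ _⟩
        obtain ⟨-, -, h3, -⟩ := (hG W).tail
        rw [← (hst W ξ (hlt_beth h1)).1]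
        exact (h3 ⟨i, hW (Finset.mem_insert_self _ _)⟩ ξ hi).symm
      · rw [ext_of_le _ (not_lt.1 hξ), ext_of_le _ (not_lt.1 hξ)]
    subst hη
    -- the union of the functions of the first nodes maps `c` to a family `c₁`, from which chains of
    -- length at most `n` lead to `d`
    let J : Iio D.κ.ord → I := fun i => ⟨insert i W₀, Finset.subset_insert _ _⟩
    have hex : ∀ i, ∃ ζ, (c i, ζ) ∈ D.p (X (J i)) := fun i => by
      obtain ⟨-, -, -, -, c', h5, -⟩ := (hG (J i)).tail
      exact ⟨_, h5 ⟨i, Finset.mem_insert_self _ _⟩⟩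
    choose c₁ hc₁ using hex
    have hc₁' : ∀ (W : I) (i), i ∈ W.1 → (c i, c₁ i) ∈ D.p (X W) := fun W i hi =>
      (hres (J i) W (Finset.insert_subset hi W.2)).2.2 (hc₁ i)
    have hpinj : ∀ W, PInj (D.p (X W)) := fun W => pInj_p H ((hmov W).basic H).1
    refine H.equiv.2.trans ⟨r, hsat⟩ (ih t c₁ (fun i j hij => ?_) (fun i => ?_) fun W => ?_)
    · let W : I := ⟨insert i (insert j W₀), (Finset.subset_insert _ _).trans
        (Finset.subset_insert _ _)⟩
      have h1 := hc₁' W i (Finset.mem_insert_self _ _)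
      have h2 := hc₁' W j (Finset.mem_insert_of_mem (Finset.mem_insert_self _ _))
      rw [← hij] at h2
      exact hc ((hpinj W).2 _ _ _ h1 h2)
    · have hU := ((hmov (J i)).basic H).1
      exact (p_bound H hU (hc₁ i)).2.trans
        (bethOrd_lt_kappa H _ (ord_lt_of_mem_T (U_subset_T H hU)))
    · have hfin : ∀ i : W, c₁ i < D.κ.ord := fun i => by
        have hU := ((hmov (J i)).basic H).1
        exact (p_bound H hU (hc₁ i)).2.trans
          (bethOrd_lt_kappa H _ (ord_lt_of_mem_T (U_subset_T H hU)))
      obtain ⟨θ, hθ, h1⟩ := exists_bound_of_finite H.inacc.isRegular hfin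
      obtain ⟨W', h2, h3⟩ := hBun θ hθ ⟨W ∪ W₀, Finset.subset_union_right⟩
      obtain ⟨-, -, -, -, c', h5, h6⟩ := (hG W').tail
      obtain rfl : c' = fun i : W'.1 => c₁ i := funext fun i =>
        (hpinj W').1 _ _ _ (h5 i) (hc₁' W' i i.2)
      have h7 := h6.conn.restrict (fun i : W => (⟨i.1, h2 (Finset.mem_union_left _ i.2)⟩ : W'.1))
      refine ⟨M W', (hM W').le, h7.congr_left (.of_lt (δ := θ) (fun ξ hξ => ?_) h1)⟩
      exact (hst W' ξ (hlt_beth (hξ.trans h3))).2.symm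

end Data

/-! ### The relations of the models in terms of chains -/

theorem restr_agree {η ν : Ordinal.{u} → Fin 2} {θ : Ordinal.{u}}
    {S : Set (Ordinal.{u} × Fin 2)} (h : restr η θ ⊆ S) (hS : ∀ z ∈ S, z.2 = ν z.1) :
    ∀ ξ < θ, η ξ = ν ξ := fun ξ hξ => hS (ξ, η ξ) (h ⟨hξ, rfl⟩)

theorem ext_zero {κ : Cardinal.{u}} : ext (fun _ => 0 : Fun2 κ) = fun _ => 0 := by
  funext ξ
  simp [ext]

theorem agree_of_lt_psup {ι : Type*} {c : ι → Ordinal.{u}} {η ν : Ordinal.{u} → Fin 2}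
    {W : Set Ordinal.{u}} (hW : BddAbove W) (h : ∀ ξ < psup W, η ξ = ν ξ) (hc : ∀ j, c j ∈ W) :
    Agree η ν c := fun j ξ hξ => h ξ ((lt_psup hW).2 ⟨c j, hc j, hξ⟩)

theorem Agree.of_psup {ι : Type*} {c : ι → Ordinal.{u}} {η ν : Ordinal.{u} → Fin 2}
    (hc : BddAbove (range c)) (h : Agree η ν c) :
    ∀ ξ < psup (range c), η ξ = ν ξ := by
  intro ξ hξ
  obtain ⟨_, ⟨j, rfl⟩, hj⟩ := (lt_psup hc).1 hξ
  exact h j ξ hj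

namespace Data

variable {D : Data.{u}} {ι : Type*} {c d : ι → Ordinal.{u}} {η ν : Ordinal.{u} → Fin 2}
  {l : List Node.{u}} {x : ℕ → Node.{u}} {st : ℕ → ι → Ordinal.{u}}
  {θ : ℕ → Ordinal.{u} → Fin 2} {n i k m : ℕ} {W : Set Ordinal.{u}}

/-- A chain of length `n` given by the sequences of its nodes `x k`, of the families `st k` which
they connect, and of the functions `θ k` attached to these families. -/
def Stages (D : Data.{u}) (x : ℕ → Node.{u}) (st : ℕ → ι → Ordinal.{u})
    (θ : ℕ → Ordinal.{u} → Fin 2) (n : ℕ) : Prop :=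
  ∀ k < n, x k ∈ D.U ∧ x k ≠ root ∧ (∀ j, (st k j, st (k + 1) j) ∈ D.p (x k)) ∧
    Agree (θ k) (x k).fst (st k) ∧ θ (k + 1) = (x k).snd

theorem Stages.conn (h : D.Stages x st θ n) (him : i + m ≤ n) :
    D.Conn (θ i) (st i) ((List.range' i m).map x) (θ (i + m)) (st (i + m)) := by
  induction m generalizing i with
  | zero => exact .nil .refl
  | succ m ih =>
    obtain ⟨h1, h2, h3, h4, h5⟩ := h i (by omega)
    rw [List.range'_succ, List.map_cons]
    have := ih (i := i + 1) (by omega)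
    rw [h5, Nat.add_right_comm] at this
    exact .cons h1 h2 h4 h3 this

theorem Conn.stages (h : D.Conn η c l ν d) : ∃ x st θ, D.Stages x st θ l.length ∧ st 0 = c ∧
    θ 0 = η ∧ st l.length = d ∧ Agree (θ l.length) ν d ∧ (List.range' 0 l.length).map x = l := by
  induction h with
  | @nil η ν c ha =>
    exact ⟨fun _ => root, fun _ => c, fun _ => η, fun k hk => absurd hk (Nat.not_lt_zero k), rfl,
      rfl, rfl, ha, rfl⟩
  | @cons η ν c c' d y l h1 h2 h3 h4 _ ih =>
    obtain ⟨x, st, θ, i1, i2, i3, i4, i5, i6⟩ := ih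
    refine ⟨fun k => Nat.casesOn k y x, fun k => Nat.casesOn k c st,
      fun k => Nat.casesOn k η θ, ?_, rfl, rfl, i4, i5, ?_⟩
    · intro k hk
      cases k with
      | zero =>
        refine ⟨h1, h2, fun j => ?_, h3, i3⟩
        change (c j, st 0 j) ∈ D.p y
        rw [i2]
        exact h4 j
      | succ k => exact i1 k (by simpa using hk)
    · rw [List.length_cons, List.range'_succ, List.map_cons]
      congr 1
      conv_rhs => rw [← i6]
      rw [show 0 + 1 = 1 from rfl, List.range'_eq_map_range, List.range'_eq_map_range,
        List.map_map, List.map_map]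
      refine List.map_congr_left fun k _ => ?_
      simp only [Function.comp_apply, Nat.zero_add, Nat.add_comm 1 k]

theorem Stages.track_eq (H : D.Admissible) (h : D.Stages x st θ n) (hW : W = range (st 0))
    (hk : k ≤ n) : D.track x W k = range (st k) := by
  induction k with
  | zero => exact hW
  | succ k ih =>
    obtain ⟨h1, -, h3, -⟩ := h k hk
    rw [track, ih (by omega)]
    ext ζ
    constructor
    · rintro ⟨_, ⟨j, rfl⟩, hz⟩
      exact ⟨j, (pInj_p H h1).1 _ _ _ (h3 j) hz⟩
    · rintro ⟨j, rfl⟩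
      exact ⟨st k j, ⟨j, rfl⟩, h3 j⟩

theorem Stages.mem_comp (H : D.Admissible) (h : D.Stages x st θ n) (hW : W = range (st 0))
    (hk : k < n) {z : Ordinal.{u} × Ordinal.{u}} :
    z ∈ D.comp x W k ↔ ∃ j, z = (st k j, st (k + 1) j) := by
  obtain ⟨h1, -, h3, -⟩ := h k hk
  change (z ∈ D.p (x k) ∧ z.1 ∈ D.track x W k) ↔ _
  rw [h.track_eq H hW hk.le]
  constructor
  · rintro ⟨hz, j, hj⟩
    refine ⟨j, Prod.ext hj.symm ((pInj_p H h1).1 (st k j) _ _ ?_ (h3 j))⟩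
    rw [hj]
    exact hz
  · rintro ⟨j, rfl⟩
    exact ⟨h3 j, j, rfl⟩

theorem Stages.dom_comp (H : D.Admissible) (h : D.Stages x st θ n) (hW : W = range (st 0))
    (hk : k < n) : dom (D.comp x W k) = range (st k) := by
  ext ξ
  constructor
  · rintro ⟨ζ, hz⟩
    obtain ⟨j, hj⟩ := (h.mem_comp H hW hk).1 hz
    exact ⟨j, (congrArg Prod.fst hj).symm⟩
  · rintro ⟨j, rfl⟩
    exact ⟨_, (h.mem_comp H hW hk).2 ⟨j, rfl⟩⟩

theorem Stages.ran_comp (H : D.Admissible) (h : D.Stages x st θ n) (hW : W = range (st 0))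
    (hk : k < n) : ran (D.comp x W k) = range (st (k + 1)) := by
  ext ζ
  constructor
  · rintro ⟨ξ, hz⟩
    obtain ⟨j, hj⟩ := (h.mem_comp H hW hk).1 hz
    exact ⟨j, (congrArg Prod.snd hj).symm⟩
  · rintro ⟨j, rfl⟩
    exact ⟨_, (h.mem_comp H hW hk).2 ⟨j, rfl⟩⟩

theorem Stages.congr (H : D.Admissible) (h : D.Stages x st θ n) (hik : i + k ≤ n) {j j' : ι}
    (he : st i j = st i j') : st (i + k) j = st (i + k) j' := by
  induction k with
  | zero => exact he
  | succ k ih =>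
    obtain ⟨h1, -, h3, -⟩ := h (i + k) (by omega)
    refine (pInj_p H h1).1 _ _ _ (h3 j) ?_
    rw [ih (by omega)]
    exact h3 j'

theorem Stages.mem_compose (H : D.Admissible) (h : D.Stages x st θ n) (hW : W = range (st 0))
    (hk : i + k < n) {z : Ordinal.{u} × Ordinal.{u}} :
    z ∈ D.compose x W i k ↔ ∃ j, z = (st i j, st (i + k + 1) j) := by
  induction k generalizing z with
  | zero => exact h.mem_comp H hW hk
  | succ k ih =>
    change (∃ ζ, (z.1, ζ) ∈ D.compose x W i k ∧ (ζ, z.2) ∈ D.comp x W (i + k + 1)) ↔ _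
    constructor
    · rintro ⟨ζ, h1, h2⟩
      obtain ⟨j, hj⟩ := (ih (by omega)).1 h1
      obtain ⟨j', hj'⟩ := (h.mem_comp H hW hk).1 h2
      obtain ⟨e1, e2⟩ := Prod.ext_iff.1 hj
      obtain ⟨e3, e4⟩ := Prod.ext_iff.1 hj'
      refine ⟨j, Prod.ext e1 (e4.trans ?_)⟩
      exact h.congr H (i := i + k + 1) (k := 1) (by omega) (e3.symm.trans e2)
    · rintro ⟨j, rfl⟩
      exact ⟨st (i + k + 1) j, (ih (by omega)).2 ⟨j, rfl⟩, (h.mem_comp H hW hk).2 ⟨j, rfl⟩⟩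

theorem Stages.bddAbove (H : D.Admissible) (h : D.Stages x st θ n) (hk : k < n) :
    BddAbove (range (st k)) ∧ BddAbove (range (st (k + 1))) := by
  obtain ⟨h1, -, h3, -⟩ := h k hk
  constructor <;> refine ⟨bethOrd (x k).ord, ?_⟩ <;> rintro _ ⟨j, rfl⟩
  · exact (p_bound H h1 (h3 j)).1.le
  · exact (p_bound H h1 (h3 j)).2.le

theorem bddAbove_entries (a : BSeq D.κ) : BddAbove a.entries :=
  ⟨D.κ.ord, by rintro _ ⟨j, rfl⟩; exact (a.seq j).2.le⟩

/-- A sequence leading from the zero function to `ν` gives a chain. -/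
theorem Leads.conn (H : D.Admissible) {ν : Fun2 D.κ} {a : BSeq D.κ}
    {b : a.arity → Iio D.κ.ord} (h : D.Leads (fun _ => 0) ν n x a.entries)
    (hb : ∀ i : Iio a.len, ((a.seq i).1, (b i).1) ∈ D.compose x a.entries 0 (n - 1)) :
    ∃ l, D.Conn (fun _ => 0) (fun i : Iio a.len => (a.seq i).1) l (ext ν)
      (fun i : Iio a.len => (b i).1) := by
  classical
  obtain ⟨⟨hn, hne, hU, hdom, hag⟩, -, hbeg, hend⟩ := h
  -- the total functions `F k` extend `p_{x k}`, and their iterates provide the stages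
  let F : ℕ → Ordinal.{u} → Ordinal.{u} := fun k ξ =>
    if h : ∃ ζ, (ξ, ζ) ∈ D.p (x k) then h.choose else 0
  have hF : ∀ k ξ, ξ ∈ dom (D.p (x k)) → (ξ, F k ξ) ∈ D.p (x k) := by
    intro k ξ h
    have h : ∃ ζ, (ξ, ζ) ∈ D.p (x k) := h
    simp only [F, dif_pos h]
    exact h.choose_spec
  let st : ℕ → Iio a.len → Ordinal.{u} := fun k j => Nat.rec (a.seq j).1 (fun k ξ => F k ξ) k
  have hst : ∀ k ≤ n, ∀ j, st k j ∈ D.track x a.entries k := by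
    intro k
    induction k with
    | zero => exact fun _ j => ⟨j, rfl⟩
    | succ k ih =>
      intro hk j
      exact ⟨st k j, ih (by omega) j, hF k _ (hdom k hk (ih (by omega) j))⟩
  have hmap : ∀ k < n, ∀ j, (st k j, st (k + 1) j) ∈ D.p (x k) := fun k hk j =>
    hF k _ (hdom k hk (hst k hk.le j))
  have htb : ∀ k < n, BddAbove (D.track x a.entries k) := by
    intro k hk
    refine ⟨bethOrd (x k).ord, fun ξ hξ => ?_⟩
    obtain ⟨ζ, hz⟩ := hdom k hk hξ
    exact (p_bound H (hU k hk).1 hz).1.le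
  have h0 : ∀ ξ < psup a.entries, (x 0).fst ξ = 0 := by
    have e : dom (D.comp x a.entries 0) = a.entries := by
      ext ξ
      exact ⟨fun ⟨ζ, hz⟩ => hz.2, fun hξ => (hdom 0 hn hξ).imp fun ζ hz => ⟨hz, hξ⟩⟩
    rw [beg, e] at hbeg
    refine restr_agree (ν := fun _ => 0) hbeg fun z hz => ?_
    rw [hz.2, ext_zero]
  let θ : ℕ → Ordinal.{u} → Fin 2 := fun k => Nat.casesOn k (fun _ => 0) fun k => (x k).snd
  have hS : D.Stages x st θ n := by
    intro k hk
    refine ⟨(hU k hk).1, (hU k hk).2, hmap k hk, ?_, rfl⟩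
    refine agree_of_lt_psup (htb k hk) ?_ (hst k hk.le)
    cases k with
    | zero => exact fun ξ hξ => (h0 ξ hξ).symm
    | succ k => exact restr_agree (hag k hk).subset fun z hz => hz.2
  have hW : a.entries = range (st 0) := rfl
  have hconn := hS.conn (i := 0) (m := n) (by omega)
  rw [Nat.zero_add] at hconn
  obtain ⟨n, rfl⟩ : ∃ k, n = k + 1 := ⟨n - 1, by omega⟩
  have hfin : st (n + 1) = fun i : Iio a.len => (b i).1 := by
    funext j
    obtain ⟨j', hj'⟩ := (hS.mem_compose H hW (i := 0) (k := n) (by omega)).1 (hb j)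
    obtain ⟨e1, e2⟩ := Prod.ext_iff.1 hj'
    rw [Nat.zero_add] at e2
    have := hS.congr H (i := 0) (k := n + 1) (by omega) (j := j) (j' := j') e1
    rw [Nat.zero_add] at this
    exact this.trans e2.symm
  rw [← hfin]
  refine ⟨_, hconn.congr_right ?_⟩
  rw [fin, hS.ran_comp H hW (by omega)] at hend
  exact agree_of_lt_psup (hS.bddAbove H (k := n) (by omega)).2
    (restr_agree hend fun z hz => hz.2) fun j => ⟨j, rfl⟩

/-- A geodesic of positive length gives a minimal sequence. -/
theorem Geo.leads (H : D.Admissible) {ν : Fun2 D.κ} {a : BSeq D.κ} {b : a.arity → Iio D.κ.ord}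
    [Nonempty (Iio a.len)] {y : Node.{u}}
    (h : D.Geo (fun _ => 0) (fun i : Iio a.len => (a.seq i).1) (y :: l) (ext ν)
      (fun i : Iio a.len => (b i).1)) :
    ∃ (n : ℕ) (x : ℕ → Node.{u}), D.Leads (fun _ => 0) ν n x a.entries ∧
      ∀ i : Iio a.len, ((a.seq i).1, (b i).1) ∈ D.compose x a.entries 0 (n - 1) := by
  obtain ⟨x, st, θ, hS, h0, hθ0, hd, hθ, hl⟩ := h.conn.stages
  set n := (y :: l).length with hn
  have hn0 : 0 < n := by simp [hn]
  have hW : a.entries = range (st 0) := by rw [h0]; rfl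
  have hbdd : ∀ k ≤ n, BddAbove (range (st k)) := by
    intro k hk
    rcases k with _ | k
    · rw [← hW]; exact bddAbove_entries a
    · exact (hS.bddAbove H hk).2
  have hθ' : ∀ k < n, ∀ ξ < psup (range (st k)), θ k ξ = (x k).fst ξ := fun k hk =>
    Agree.of_psup (hbdd k hk.le) (hS k hk).2.2.2.1
  have happ : ∀ k ≤ n, y :: l = (List.range' 0 k).map x ++ (List.range' k (n - k)).map x := by
    intro k hk
    rw [← List.map_append, ← hl]
    congr 1
    have := List.range'_append_1 (s := 0) (m := k) (n := n - k)
    rw [Nat.zero_add, Nat.add_sub_cancel' hk] at this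
    exact this.symm
  have hpre : ∀ k ≤ n, D.Conn (fun _ => 0) (fun i : Iio a.len => (a.seq i).1)
      ((List.range' 0 k).map x) (θ k) (st k) := by
    intro k hk
    have := hS.conn (i := 0) (m := k) (by omega)
    rwa [Nat.zero_add, h0, hθ0] at this
  refine ⟨n, x, ⟨⟨hn0, ?_, fun k hk => ⟨(hS k hk).1, (hS k hk).2.1⟩, ?_, ?_⟩, ⟨?_, ?_⟩, ?_, ?_⟩, ?_⟩
  · obtain ⟨j⟩ := ‹Nonempty (Iio a.len)›
    exact ⟨_, j, rfl⟩
  · intro k hk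
    rw [hS.track_eq H hW hk.le]
    rintro _ ⟨j, rfl⟩
    exact ⟨_, (hS k hk).2.2.1 j⟩
  · intro k hk
    rw [hS.track_eq H hW hk.le]
    ext ⟨ξ, ε⟩
    refine and_congr_right fun hξ => ?_
    change ε = (x k).snd ξ ↔ ε = (x (k + 1)).fst ξ
    rw [← hθ' (k + 1) hk ξ hξ, (hS k (by omega)).2.2.2.2]
  · intro k hk w hw hb hsub
    rw [hS.dom_comp H hW hk] at hsub
    have e := happ k hk.le
    rw [show n - k = n - k - 1 + 1 by omega, List.range'_succ, List.map_cons] at e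
    exact h.tight _ _ _ _ _ e (hpre k hk.le) w hw hb fun j => hsub ⟨j, rfl⟩
  -- a part of the chain which composes to an identity function could be cut out
  · rintro ⟨i, k, hik, hid, he⟩
    have hst : st i = st (i + k + 1) := funext fun j =>
      hid (st i j, st (i + k + 1) j) ((hS.mem_compose H hW hik).2 ⟨j, rfl⟩)
    rw [beg, fin, hS.dom_comp H hW (by omega), hS.ran_comp H hW hik, ← hst] at he
    have ha : Agree (θ i) (θ (i + k + 1)) (st i) := by
      rw [(hS (i + k) hik).2.2.2.2]
      exact (hS i (by omega)).2.2.2.1.trans (agree_of_lt_psup (hbdd i (by omega))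
        (restr_agree he.subset fun z hz => hz.2) fun j => ⟨j, rfl⟩)
    have hsuf := hS.conn (i := i + k + 1) (m := n - (i + k + 1)) (by omega)
    rw [Nat.add_sub_cancel' (show i + k + 1 ≤ n by omega), ← hst, hd] at hsuf
    have := h.le _ ((hpre i (by omega)).append ((hsuf.congr_left ha).congr_right hθ))
    rw [← hn, List.length_append, List.length_map, List.length_map, List.length_range',
      List.length_range'] at this
    omega
  · rw [beg, hS.dom_comp H hW hn0]
    rintro ⟨ξ, ε⟩ ⟨h1, h2⟩
    obtain ⟨_, ⟨j, rfl⟩, hj⟩ := (lt_psup (hbdd 0 (by omega))).1 h1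
    refine ⟨hj.trans_lt ?_, ?_⟩
    · rw [h0]
      exact (a.seq j).2
    · rw [ext_zero]
      change ε = 0
      have := hθ' 0 hn0 ξ h1
      rw [hθ0] at this
      exact h2.trans this.symm
  · rw [fin, hS.ran_comp H hW (by omega), Nat.sub_add_cancel hn0, hd]
    rintro ⟨ξ, ε⟩ ⟨h1, h2⟩
    have hb := hbdd n le_rfl
    rw [hd] at hb
    obtain ⟨_, ⟨j, rfl⟩, hj⟩ := (lt_psup hb).1 h1
    refine ⟨hj.trans_lt (b j).2, ?_⟩
    have h3 := (hS (n - 1) (by omega)).2.2.2.2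
    rw [Nat.sub_add_cancel hn0] at h3
    change ε = ext ν ξ
    rw [← hθ j ξ hj, h3]
    exact h2
  · intro j
    refine (hS.mem_compose H hW (by omega)).2 ⟨j, ?_⟩
    rw [Nat.zero_add, Nat.sub_add_cancel hn0, h0, hd]

/-- The relation `R_a` of the model for `ν` consists of the families to which a chain leads from the
zero function and `a`. -/
theorem mem_relOf_iff (H : D.Admissible) {ν : Fun2 D.κ} {a : BSeq D.κ}
    {b : a.arity → Iio D.κ.ord} : b ∈ D.relOf ν a ↔
      ∃ l, D.Conn (fun _ => 0) (fun i : Iio a.len => (a.seq i).1) l (ext ν)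
        (fun i : Iio a.len => (b i).1) := by
  constructor
  · rintro (⟨h1, rfl⟩ | ⟨n, x, h1, h2⟩)
    · refine ⟨[], .nil ?_⟩
      exact agree_of_lt_psup (bddAbove_entries a) (fun ξ hξ => (h1 ξ hξ).symm) fun j => ⟨j, rfl⟩
    · exact h1.conn H h2
  · intro hex
    have first : D.Conn (fun _ => 0) (fun i : Iio a.len => (a.seq i).1) [] (ext ν)
        (fun i : Iio a.len => (b i).1) → b ∈ D.relOf ν a := by
      intro h
      obtain ⟨h1, h2⟩ := conn_nil_iff.1 h
      refine Or.inl ⟨fun ξ hξ => (h2.of_psup (bddAbove_entries a) ξ hξ).symm, ?_⟩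
      funext j
      exact Subtype.ext (congrFun h1 j).symm
    rcases isEmpty_or_nonempty (Iio a.len) with hemp | hne
    · exact first (conn_nil_iff.2 ⟨funext fun j => hemp.elim j, fun j => hemp.elim j⟩)
    · classical
      have hex' : ∃ n, ∃ l, l.length = n ∧ D.Conn (fun _ => 0)
          (fun i : Iio a.len => (a.seq i).1) l (ext ν) (fun i : Iio a.len => (b i).1) :=
        hex.imp' List.length fun l hl => ⟨l, rfl, hl⟩
      obtain ⟨l, hl, hC⟩ := Nat.find_spec hex'
      obtain ⟨l', -, hG⟩ := exists_geo H hC fun l' hl' => by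
        rw [hl]; exact Nat.find_min' hex' ⟨l', rfl, hl'⟩
      cases l' with
      | nil => exact first hG.conn
      | cons y l' => exact Or.inr (hG.leads H)

end Data

/-! ### Equivalent functions have isomorphic models -/

namespace Data

variable {D : Data.{u}} {s t r : Fun2 D.κ} {δ ε α ξ : Ordinal.{u}}

theorem club_closed (hsat : Sat D.φ D.P s t r) {S : Set Ordinal.{u}}
    (hS : S ⊆ D.club s t r) (hlt : sSup S < D.κ.ord) :
    sSup S ∈ D.club s t r := by
  have hbd : BddAbove S := ⟨D.κ.ord, fun δ hδ => by
    rcases hS hδ with h | h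
    · rw [show δ = 0 from h]; exact zero_le
    · exact h.1.le⟩
  by_cases hmem : sSup S ∈ S
  · exact hS hmem
  rcases eq_or_ne (sSup S) 0 with h0 | h0
  · exact Or.inl h0
  refine Or.inr ⟨hlt, ElemSub.of_cofinal (pos_iff_ne_zero.2 h0) hlt.le fun α hα => ?_, hsat⟩
  have hne : S.Nonempty := by
    by_contra hemp
    rw [not_nonempty_iff_eq_empty] at hemp
    rw [hemp] at h0
    simp at h0
  obtain ⟨δ, hδ, h1⟩ := exists_lt_of_lt_csSup hne hα
  refine ⟨δ, h1, lt_of_le_of_ne (le_csSup hbd hδ) fun he => hmem (by rwa [← he]), ?_⟩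
  rcases hS hδ with h | h
  · rw [show δ = 0 from h] at h1
    exact absurd h1 not_lt_zero
  · exact h.2.1

theorem exists_mem_club (H : D.Admissible) (hsat : Sat D.φ D.P s t r) (hα : α < D.κ.ord) :
    ∃ δ ∈ D.club s t r, α < δ := by
  obtain ⟨δ, h1, h2, h3⟩ := exists_elemSub H.inacc D.P s t r hα
  exact ⟨δ, Or.inr ⟨h1, h3, hsat⟩, h2⟩

theorem lt_kappa_of_mem_club (H : D.Admissible) (h : δ ∈ D.club s t r) : δ < D.κ.ord := by
  rcases h with h | h
  · rw [show δ = 0 from h]; exact zero_lt_kappa H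
  · exact h.1

/-- The node of height `δ` given by `s`, `t`, `r` and the set `club s t r`. -/
def branchNode (D : Data.{u}) (s t r : Fun2 D.κ) (δ : Ordinal.{u}) : Node.{u} :=
  ⟨δ, cut (bethOrd δ) (ext s), cut (bethOrd δ) (ext t), cut (bethOrd δ) (ext r),
    D.club s t r ∩ Iio δ⟩

theorem branchNode_res (h0 : δ ≠ 0) (h : δ ≤ ε) :
    (D.branchNode s t r ε).res δ = D.branchNode s t r δ := by
  rw [res_of_ne _ h0]
  simp only [branchNode, cut_cut (bethOrd_le.2 h), inter_assoc, Iio_inter_Iio, min_eq_right h]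

theorem cut_of_lt {η : Ordinal.{u} → Fin 2} {θ : Ordinal.{u}} (h : ξ < θ) : cut θ η ξ = η ξ :=
  if_pos h

/-- The nonzero members `δ` of `C_{str}` such that `s` is lexicographically smaller than `t` below
`ℶ_δ`. They are the heights of the nodes of a branch through `U_H ∩ T^<`. -/
def branchHeights (D : Data.{u}) (s t r : Fun2 D.κ) : Set Ordinal.{u} :=
  {δ | δ ∈ D.club s t r ∧ δ ≠ 0 ∧ ∃ ξ < bethOrd δ, ext s ξ < ext t ξ ∧
    ∀ ζ < ξ, ext s ζ = ext t ζ}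

theorem branchNode_mem (H : D.Admissible) (hsat : Sat D.φ D.P s t r)
    (hs : steady s = s) (ht : steady t = t) (hr : steady r = r)
    (hδ : δ ∈ D.branchHeights s t r) :
    D.branchNode s t r δ ∈ D.UH ∧ D.branchNode s t r δ ∈ TLex D.κ := by
  obtain ⟨h1, h0, ξ, hξ, h2, h3⟩ := hδ
  have hδκ := lt_kappa_of_mem_club H h1
  have hT : D.branchNode s t r δ ∈ T D.κ := by
    refine ⟨δ, hδκ, Or.inr ⟨h0, rfl, fun ζ hζ => ?_, fun he => ?_, fun ζ hζ => hζ.2, ?_⟩⟩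
    · simp [branchNode, cut, not_lt.2 hζ]
    · have := congrFun he ξ
      simp only [branchNode, cut_of_lt hξ] at this
      exact h2.ne this
    · intro S hS _ hlt
      exact ⟨club_closed hsat (fun x hx => (hS hx).1) (hlt.trans hδκ), hlt⟩
  have hTH : D.branchNode s t r δ ∈ D.TH :=
    ⟨hT, s, t, r, fun ζ hζ => ⟨cut_of_lt hζ, cut_of_lt hζ, cut_of_lt hζ⟩, h1, rfl⟩
  refine ⟨⟨hTH, Or.inl hTH, Or.inr ⟨?_, ?_, ?_⟩⟩, hT, ξ, hξ, ?_, fun ζ hζ => ?_⟩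
  · have := uFun_steady H.inacc s hδκ
    rwa [hs] at this
  · have := uFun_steady H.inacc t hδκ
    rwa [ht] at this
  · have := uFun_steady H.inacc r hδκ
    rwa [hr] at this
  · simp only [branchNode, cut_of_lt hξ]
    exact h2
  · simp only [branchNode, cut_of_lt (hζ.trans hξ)]
    exact h3 ζ hζ

theorem branchHeights_mono (hδ : δ ∈ D.branchHeights s t r) (hε : ε ∈ D.club s t r)
    (h : δ ≤ ε) : ε ∈ D.branchHeights s t r := by
  obtain ⟨h1, h0, ξ, hξ, h2⟩ := hδ
  exact ⟨hε, ((pos_iff_ne_zero.2 h0).trans_le h).ne', ξ, hξ.trans_le (bethOrd_le.2 h), h2⟩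

theorem branchNode_below (hδ : δ ∈ D.branchHeights s t r) (h : δ < ε) :
    (D.branchNode s t r δ).Below (D.branchNode s t r ε) :=
  ⟨(branchNode_res hδ.2.1 h.le).symm, hδ.1, h⟩

/-- The domains and the ranges of the functions `p_x`, for the nodes `x` of a branch, exhaust `κ`:
two successor steps after the height `δ₀` they include `ℶ_{δ₀}`. -/
theorem exists_branchNode_subset (H : D.Admissible) (hsat : Sat D.φ D.P s t r)
    (hs : steady s = s) (ht : steady t = t) (hr : steady r = r)
    (hne : (D.branchHeights s t r).Nonempty) (hα : α < D.κ.ord) :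
    ∃ δ ∈ D.branchHeights s t r, α ≤ δ ∧ ∀ ξ < α, ξ ∈ dom (D.p (D.branchNode s t r δ)) ∧
      ξ ∈ ran (D.p (D.branchNode s t r δ)) := by
  obtain ⟨δ', hδ'⟩ := hne
  have hmem := fun {δ} (hδ : δ ∈ D.branchHeights s t r) => branchNode_mem H hsat hs ht hr hδ
  have next : ∀ δ ∈ D.branchHeights s t r, ∃ ε ∈ D.branchHeights s t r, δ < ε ∧
      D.SuccOf (D.branchNode s t r ε) (D.branchNode s t r δ) := by
    intro δ hδ
    obtain ⟨ε₀, h1, h2⟩ := exists_mem_club H hsat (lt_kappa_of_mem_club H hδ.1)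
    let A : Set Ordinal.{u} := {ε | ε ∈ D.club s t r ∧ δ < ε}
    have hA : sInf A ∈ A := csInf_mem ⟨ε₀, h1, h2⟩
    have hε := branchHeights_mono hδ hA.1 hA.2.le
    refine ⟨sInf A, hε, hA.2, (hmem hε).1.2, (hmem hδ).1.2, branchNode_below hδ hA.2, ?_⟩
    rintro ⟨w, hw, h3, h4⟩
    have h5 : w.ord ∈ A := ⟨h4.2.1, h3.ord_lt (U_subset_T H hw)⟩
    exact absurd h4.2.2 (not_lt.2 (csInf_le' h5))
  obtain ⟨δ₀, h1, h2⟩ := exists_mem_club H hsat (max_lt hα (lt_kappa_of_mem_club H hδ'.1))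
  obtain ⟨h2, h3⟩ := max_lt_iff.1 h2
  have hδ₀ := branchHeights_mono hδ' h1 h3.le
  obtain ⟨δ₁, hδ₁, h4, h5⟩ := next δ₀ hδ₀
  obtain ⟨δ₂, hδ₂, h6, h7⟩ := next δ₁ hδ₁
  refine ⟨δ₂, hδ₂, (h2.trans (h4.trans h6)).le, fun ξ hξ => ?_⟩
  refine subset_dom_ran_of_two_steps H h5 h7 (hmem hδ₂).2 (ne_root_of_mem_TLex (hmem hδ₀).2)
    (fun β hβ => ?_) ((hξ.trans h2).trans_le (le_bethOrd _))
  rcases reflectsAt_kinds H h5 hβ with ⟨-, -, h8, -⟩ | ⟨-, h8, -⟩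
  · exact h8
  · have := (fixed_of_mem_club H hδ₁.1 hδ₁.2.1).1
    rw [show δ₁ = Order.succ β from h8] at this
    exact (limit_ne_succ this).elim

/-- The union of the functions `p_x`, for the nodes `x` of the branch given by `s`, `t` and a
witness `r`, is a bijection of `κ`. It is an isomorphism, because any chain leading to `s` can be
continued by a node of the branch to one leading to `t`, and conversely by the inverse of that
node. -/
theorem isomorphic_of_lex (H : D.Admissible) (hsat : Sat D.φ D.P s t r)
    (hs : steady s = s) (ht : steady t = t) (hr : steady r = r)
    (hne : (D.branchHeights s t r).Nonempty) :
    (D.modelOf s).Isomorphic (D.modelOf t) := by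
  have hlim := isSuccLimit_ord_of_inaccessible H.inacc
  have hmem := fun {δ} (hδ : δ ∈ D.branchHeights s t r) => branchNode_mem H hsat hs ht hr hδ
  have hex := fun {α} (hα : α < D.κ.ord) => exists_branchNode_subset H hsat hs ht hr hne hα
  let G : Gr.{u} := {z | ∃ δ ∈ D.branchHeights s t r, z ∈ D.p (D.branchNode s t r δ)}
  have hmono : ∀ δ ∈ D.branchHeights s t r, ∀ ε ∈ D.branchHeights s t r, δ ≤ ε →
      D.p (D.branchNode s t r δ) ⊆ D.p (D.branchNode s t r ε) := by
    intro δ hδ ε hε h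
    rcases h.lt_or_eq with h | rfl
    · exact p_mono H (hmem hε).1.2 (hmem hδ).1.2 (branchNode_below hδ h)
    · exact subset_rfl
  have hdir : ∀ z ∈ G, ∀ z' ∈ G, ∃ δ ∈ D.branchHeights s t r,
      z ∈ D.p (D.branchNode s t r δ) ∧ z' ∈ D.p (D.branchNode s t r δ) := by
    rintro z ⟨δ, hδ, hz⟩ z' ⟨ε, hε, hz'⟩
    rcases le_total δ ε with h | h
    · exact ⟨ε, hε, hmono δ hδ ε hε h hz, hz'⟩
    · exact ⟨δ, hδ, hz, hmono ε hε δ hδ h hz'⟩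
  have hGinj : PInj G := by
    constructor
    · intro ξ ζ ζ' h h'
      obtain ⟨δ, hδ, h1, h2⟩ := hdir _ h _ h'
      exact (pInj_p H (hmem hδ).1.2).1 _ _ _ h1 h2
    · intro ξ ζ ζ' h h'
      obtain ⟨δ, hδ, h1, h2⟩ := hdir _ h _ h'
      exact (pInj_p H (hmem hδ).1.2).2 _ _ _ h1 h2
  have hGκ : ∀ ξ ζ, (ξ, ζ) ∈ G → ξ < D.κ.ord ∧ ζ < D.κ.ord := by
    rintro ξ ζ ⟨δ, hδ, hz⟩
    have h1 := p_bound H (hmem hδ).1.2 hz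
    have h2 := bethOrd_lt_kappa H δ (lt_kappa_of_mem_club H hδ.1)
    exact ⟨h1.1.trans h2, h1.2.trans h2⟩
  have hdom : ∀ ξ : Iio D.κ.ord, ∃ ζ : Iio D.κ.ord, (ξ.1, ζ.1) ∈ G := by
    rintro ⟨ξ, hξ⟩
    obtain ⟨δ, hδ, -, h⟩ := hex (hlim.succ_lt hξ)
    obtain ⟨ζ, hz⟩ := (h ξ (Order.lt_succ ξ)).1
    exact ⟨⟨ζ, (hGκ ξ ζ ⟨δ, hδ, hz⟩).2⟩, δ, hδ, hz⟩
  have hran : ∀ ζ : Iio D.κ.ord, ∃ ξ : Iio D.κ.ord, (ξ.1, ζ.1) ∈ G := by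
    rintro ⟨ζ, hζ⟩
    obtain ⟨δ, hδ, -, h⟩ := hex (hlim.succ_lt hζ)
    obtain ⟨ξ, hz⟩ := (h ζ (Order.lt_succ ζ)).2
    exact ⟨⟨ξ, (hGκ ξ ζ ⟨δ, hδ, hz⟩).1⟩, δ, hδ, hz⟩
  choose f hf using hdom
  have hbij : Function.Bijective f := by
    refine ⟨fun ξ ξ' h => Subtype.ext (hGinj.2 _ _ (f ξ).1 (hf ξ) ?_), fun ζ => ?_⟩
    · rw [h]; exact hf ξ'
    · obtain ⟨ξ, hξ⟩ := hran ζ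
      exact ⟨ξ, Subtype.ext (hGinj.1 _ _ _ (hf ξ) hξ)⟩
  -- a single node of the branch connects a bounded family with its image
  have hconn : ∀ (a : BSeq D.κ) (b : a.arity → Iio D.κ.ord), ∃ x,
      D.Conn (ext s) (fun i : Iio a.len => (b i).1) [x] (ext t)
        (fun i : Iio a.len => (f (b i)).1) := by
    intro a b
    obtain ⟨α, hα, h1⟩ := exists_bound_of_mk_lt H.inacc.isRegular (ι := Iio a.len)
      (f := fun i => (b i).1) (by
        refine Cardinal.mk_range_le.trans_lt ?_
        rw [Cardinal.mk_Iio_ordinal, Cardinal.lift_lt]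
        exact Cardinal.lt_ord.1 a.len_lt) fun i => (b i).2
    obtain ⟨δ, hδ, h2, h3⟩ := hex hα
    have hm : ∀ i : Iio a.len, ((b i).1, (f (b i)).1) ∈ D.p (D.branchNode s t r δ) := by
      intro i
      obtain ⟨ζ, hz⟩ := (h3 _ (h1 i)).1
      rwa [hGinj.1 _ _ _ (hf (b i)) ⟨δ, hδ, hz⟩]
    refine ⟨D.branchNode s t r δ, .single (hmem hδ).1.2 (ne_root_of_mem_TLex (hmem hδ).2) hm ?_ ?_⟩
    · exact .of_lt (fun ξ hξ => (cut_of_lt hξ).symm) fun i => (p_bound H (hmem hδ).1.2 (hm i)).1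
    · exact .of_lt (fun ξ hξ => cut_of_lt hξ) fun i => (p_bound H (hmem hδ).1.2 (hm i)).2
  refine ⟨Equiv.ofBijective f hbij, fun a b => ?_⟩
  obtain ⟨x, hx⟩ := hconn a b
  change b ∈ D.relOf s a ↔ f ∘ b ∈ D.relOf t a
  rw [mem_relOf_iff H, mem_relOf_iff H]
  constructor
  · rintro ⟨l, hl⟩
    exact ⟨_, hl.append hx⟩
  · rintro ⟨l, hl⟩
    exact ⟨_, hl.append (hx.inv H)⟩

theorem isomorphic_symm {Sym M N : Type*} {ar : Sym → Type*} {A : RelStr ar M} {B : RelStr ar N}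
    (h : A.Isomorphic B) : B.Isomorphic A := by
  obtain ⟨f, hf⟩ := h
  refine ⟨f.symm, fun R b => ?_⟩
  rw [hf R (f.symm ∘ b), ← Function.comp_assoc, Equiv.self_comp_symm, Function.id_comp]

theorem steady_congr {s t : Fun2 D.κ}
    (h : ∀ α < D.κ.ord, ext s (bethOrd α) = ext t (bethOrd α)) : steady s = steady t := by
  funext ξ
  unfold steady
  split_ifs with h1
  · rfl
  · -- the supremum is one of the points `ℶ_β`
    let A : Set Ordinal.{u} := {β | ξ.1 < bethOrd (Order.succ β)}
    have hA : sInf A ∈ A := csInf_mem ⟨ξ.1, (Order.lt_succ _).trans_le (le_bethOrd _)⟩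
    have hle : bethOrd (sInf A) ≤ ξ.1 := by
      by_contra hlt
      rw [not_le] at hlt
      have hn : Order.IsNormal bethOrd.{u} := Cardinal.isNormal_ord.comp Cardinal.isNormal_beth
      rcases Ordinal.zero_or_succ_or_isSuccLimit (sInf A) with h2 | ⟨β, h2⟩ | h2
      · rw [h2] at hlt
        exact h1 hlt
      · rw [← h2] at hlt
        have := csInf_le' (show β ∈ A from hlt)
        rw [← h2] at this
        exact absurd this (not_le.2 (Order.lt_succ β))
      · obtain ⟨β, hβ, hξ⟩ := (hn.lt_iff_exists_lt h2).1 hlt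
        exact absurd (csInf_le' (show β ∈ A from hξ.trans (bethOrd_lt.2 (Order.lt_succ β))))
          (not_le.2 hβ)
    rw [sSup_bethOrd_le hle hA]
    exact h _ ((le_bethOrd _).trans_lt (hle.trans_lt ξ.2))

theorem steady_steady (H : D.Admissible) (s : Fun2 D.κ) : steady (steady s) = steady s :=
  steady_congr fun _ hα => ext_steady_bethOrd H.inacc s hα

/-- Both functions may be taken to be steady, and distinct ones are compared at the first place
where they differ. -/
theorem isomorphic_of_equiv (H : D.Admissible) (h : D.Equiv s t) :
    (D.model s).Isomorphic (D.model t) := by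
  have hss : ∀ s : Fun2 D.κ, D.Equiv (steady s) s := fun s =>
    H.beth _ _ fun α hα => ext_steady_bethOrd H.inacc s hα
  by_cases heq : steady s = steady t
  · unfold model
    rw [heq]
    exact ⟨Equiv.refl _, fun R b => Iff.rfl⟩
  have key : ∀ s t : Fun2 D.κ, D.Equiv s t → (∃ ξ < D.κ.ord, ext (steady s) ξ < ext (steady t) ξ ∧
      ∀ ζ < ξ, ext (steady s) ζ = ext (steady t) ζ) →
      (D.model s).Isomorphic (D.model t) := by
    rintro s t h ⟨ξ, hξ, h1, h2⟩
    obtain ⟨r, hr⟩ := H.equiv.2.trans (hss s) (H.equiv.2.trans h (H.equiv.2.symm (hss t)))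
    rw [H.witness _ _ r (steady r) fun α hα => (ext_steady_bethOrd H.inacc r hα).symm] at hr
    obtain ⟨δ, h3, h4⟩ := exists_mem_club H hr hξ
    exact isomorphic_of_lex H hr (steady_steady H s) (steady_steady H t) (steady_steady H r)
      ⟨δ, h3, (pos_of_gt h4).ne', ξ, h4.trans_le (le_bethOrd δ), h1, h2⟩
  let A : Set Ordinal.{u} := {ξ | ext (steady s) ξ ≠ ext (steady t) ξ}
  have hA : A.Nonempty := by
    by_contra hemp
    rw [not_nonempty_iff_eq_empty, eq_empty_iff_forall_notMem] at hemp
    exact heq (ext_injective (funext fun ξ => not_not.1 (hemp ξ)))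
  have hm : sInf A ∈ A := csInf_mem hA
  have hbel : ∀ ζ < sInf A, ext (steady s) ζ = ext (steady t) ζ := fun ζ hζ =>
    not_not.1 (notMem_of_lt_csInf' hζ)
  have hlt : sInf A < D.κ.ord := by
    by_contra hle
    refine hm ?_
    rw [ext_of_le _ (not_lt.1 hle), ext_of_le _ (not_lt.1 hle)]
  rcases lt_or_gt_of_ne hm with h1 | h1
  · exact key s t h ⟨_, hlt, h1, hbel⟩
  · exact isomorphic_symm (key t s (H.equiv.2.symm h) ⟨_, hlt, h1, fun ζ hζ => (hbel ζ hζ).symm⟩)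

end Data

/-! ### Isomorphic models come from equivalent functions -/

namespace Data

variable {D : Data.{u}} {s t : Fun2 D.κ} {α β γ ξ : Ordinal.{u}} {C : Set Ordinal.{u}}

/-- The node of height `α` with first component `0`, second component `s` and closed set `C`. -/
def genNode (s : Fun2 D.κ) (α : Ordinal.{u}) (C : Set Ordinal.{u}) : Node.{u} :=
  ⟨α, fun _ => 0, cut (bethOrd α) (ext s), fun _ => 0, C⟩

theorem genNode_res (hβ : β ≠ 0) (h : β ≤ α) :
    (genNode s α C).res β = genNode s β (C ∩ Iio β) := by
  rw [res_of_ne _ hβ]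
  have : cut (bethOrd β) (fun _ => (0 : Fin 2)) = fun _ => 0 := by
    funext ξ
    simp [cut]
  simp only [genNode, cut_cut (bethOrd_le.2 h), this]

/-- The condition for the membership of `genNode s α C` in `T_G`, for a finite set `C`. -/
theorem genNode_mem (H : D.Admissible) (hs : steady s = s) (hα : α ∈ GInds D.κ)
    (hξ : ξ < bethOrd α) (hne : ext s ξ ≠ 0) (hC : C.Finite) (hγ : IsGreatest C γ)
    (hγα : γ < α) (hbk : D.bk α = (genNode s α C).res γ)
    (hres : (genNode s α C).res γ ∈ D.TH ∪ D.TG) :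
    genNode s α C ∈ D.U ∧ genNode s α C ∈ TLex D.κ ∧ genNode s α C ∈ D.TG := by
  have hα0 : α ≠ 0 := (pos_of_gt hγα).ne'
  have hT : genNode s α C ∈ T D.κ := by
    refine ⟨α, hα.1, Or.inr ⟨hα0, rfl, fun ζ hζ => ?_, fun he => ?_,
      fun ζ hζ => (hγ.2 hζ).trans_lt hγα, fun S hS hne _ => ?_⟩⟩
    · simp [genNode, cut, not_lt.2 hζ]
    · have := congrFun he ξ
      simp only [genNode, cut, if_pos hξ] at this
      exact hne this.symm
    · exact hS (hne.csSup_mem (hC.subset hS))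
  have hLex : genNode s α C ∈ TLex D.κ := by
    let A : Set Ordinal.{u} := {ζ | ext s ζ ≠ 0}
    have hm : sInf A ∈ A := csInf_mem ⟨ξ, hne⟩
    have hlt : sInf A < bethOrd α := (csInf_le' hne).trans_lt hξ
    refine ⟨hT, sInf A, hlt, ?_, fun ζ hζ => ?_⟩
    · simp only [genNode, cut, if_pos hlt]
      exact Fin.pos_iff_ne_zero.2 hm
    · simp only [genNode, cut, if_pos (hζ.trans hlt)]
      exact (not_not.1 (notMem_of_lt_csInf' hζ)).symm
  have hsup : sSup C = γ := hγ.csSup_eq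
  have hTG : genNode s α C ∈ D.TG := by
    refine mem_TG_of_genCond hLex ⟨fun _ => ⟨hα, γ, hγ, hbk, hres⟩, fun he => ?_⟩
    exact absurd (hsup.symm.trans he) hγα.ne
  refine ⟨⟨Or.inr hTG, Or.inr ⟨?_, ?_, ?_⟩⟩, hLex, hTG⟩
  · exact ⟨fun _ _ => rfl, fun _ _ _ _ _ => rfl⟩
  · have := uFun_steady H.inacc s hα.1
    rwa [hs] at this
  · exact ⟨fun _ _ => rfl, fun _ _ _ _ _ => rfl⟩

/-- For a function `s` other than the zero function, three successive steps in `T_G` provide a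
function `p_x`, leading from the zero function to `s`, whose range contains any given ordinal. -/
theorem exists_genNode (H : D.Admissible) (hs : steady s = s) (hne : ∃ ξ, ext s ξ ≠ 0)
    (hα : α < D.κ.ord) : ∃ x ∈ D.U, x ≠ root ∧ x.fst = (fun _ => 0) ∧
      (∀ ξ < bethOrd x.ord, x.snd ξ = ext s ξ) ∧ ∀ ξ < α, ξ ∈ ran (D.p x) := by
  obtain ⟨ξ, hξ⟩ := hne
  have hξκ : ξ < D.κ.ord := by
    by_contra hle
    exact hξ (ext_of_le _ (not_lt.1 hle))
  have hlim := isSuccLimit_ord_of_inaccessible H.inacc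
  obtain ⟨-, -, -, hbook⟩ := H.book
  obtain ⟨α₁, g1, l1, b1⟩ := hbook root (Or.inl rfl) (max α ξ) (max_lt hα hξκ)
  obtain ⟨hα₁, hξ₁⟩ := max_lt_iff.1 l1
  have hξb : ∀ β, α₁ ≤ β → ξ < bethOrd β := fun β h => (hξ₁.trans_le h).trans_le (le_bethOrd β)
  have p1 : 0 < α₁ := pos_of_gt hξ₁
  have grt : ∀ {a b : Ordinal.{u}} {S : Set Ordinal.{u}}, IsGreatest S b → b < a →
      IsGreatest (insert a S) a := by
    intro a b S hS h
    have := hS.insert a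
    rwa [max_eq_left h.le] at this
  have gr0 : IsGreatest ({0} : Set Ordinal.{u}) 0 := isGreatest_singleton
  have gr1 := grt gr0 p1
  have inter : ∀ {a b : Ordinal.{u}} {S : Set Ordinal.{u}}, IsGreatest S b → b < a →
      insert a S ∩ Iio a = S := by
    intro a b S hS h
    ext ζ
    constructor
    · rintro ⟨rfl | h1, h2⟩
      · exact absurd h2 (lt_irrefl ζ)
      · exact h1
    · exact fun h1 => ⟨Or.inr h1, (hS.2 h1).trans_lt h⟩
  let x₁ := genNode s α₁ {0}
  have m1 := genNode_mem H hs g1 (hξb α₁ le_rfl) hξ (finite_singleton 0) gr0 p1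
    (by rw [res_zero, b1]) (by rw [res_zero]; exact Or.inl (root_mem_TH H))
  obtain ⟨α₂, g2, l2, b2⟩ := hbook x₁ (Or.inr m1.2.1) (Order.succ α₁) (hlim.succ_lt g1.1)
  -- since `succ α₁ < α₂`, the ordinal `β` with `α₂ = β + 1` is greater than `α₁`
  have l2' : α₁ < α₂ := (Order.lt_succ _).trans l2
  let x₂ := genNode s α₂ (insert α₁ {0})
  have r2 : x₂.res α₁ = x₁ := by
    rw [genNode_res p1.ne' l2'.le, inter gr0 p1]
  have m2 := genNode_mem H hs g2 (hξb α₂ l2'.le) hξ ((finite_singleton 0).insert α₁) gr1 l2'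
    (b2.trans r2.symm) (Or.inr (by rw [r2]; exact m1.2.2))
  obtain ⟨α₃, g3, l3, b3⟩ := hbook x₂ (Or.inr m2.2.1) α₂ g2.1
  have gr2 := grt gr1 l2'
  let x₃ := genNode s α₃ (insert α₂ (insert α₁ {0}))
  have r3 : x₃.res α₂ = x₂ := by
    rw [genNode_res (p1.trans l2').ne' l3.le, inter gr1 l2']
  have m3 := genNode_mem H hs g3 (hξb α₃ (l2'.trans l3).le) hξ
    (((finite_singleton 0).insert α₁).insert α₂) gr2 l3
    (b3.trans r3.symm) (Or.inr (by rw [r3]; exact m2.2.2))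
  have s2 : D.SuccOf x₂ x₁ := by
    refine ⟨m2.1, m1.1, ⟨r2.symm, Or.inl rfl⟩, ?_⟩
    rintro ⟨w, hw, h1, h2⟩
    exact absurd (gr1.2 h2.2) (not_le.2 (h1.ord_lt (U_subset_T H hw)))
  have s3 : D.SuccOf x₃ x₂ := by
    refine ⟨m3.1, m2.1, ⟨r3.symm, Or.inl rfl⟩, ?_⟩
    rintro ⟨w, hw, h1, h2⟩
    exact absurd (gr2.2 h2.2) (not_le.2 (h1.ord_lt (U_subset_T H hw)))
  refine ⟨x₃, m3.1, ne_root_of_mem_TLex m3.2.1, rfl, fun ζ hζ => if_pos hζ, fun ζ hζ => ?_⟩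
  refine (subset_dom_ran_of_two_steps H s2 s3 m3.2.1 (ne_root_of_mem_TLex m1.2.1)
    (fun β hβ => ?_) ((hζ.trans hα₁).trans_le (le_bethOrd α₁))).2
  rcases reflectsAt_kinds H s2 hβ with ⟨-, -, h, -⟩ | ⟨-, h, -⟩
  · exact h
  · have h' : α₂ = Order.succ β := h
    rw [h'] at l2
    exact Order.succ_lt_succ_iff.1 l2

/-- For any `α < κ` some chain leads from the zero function and a suitable sequence `a` to `s` and
the sequence of the ordinals below `α`. For `s = 0` the empty chain suffices. -/
theorem exists_source (H : D.Admissible) (hs : steady s = s) (hα : α < D.κ.ord) :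
    ∃ a : BSeq D.κ, a.len = α ∧ ∃ l, D.Conn (fun _ => 0) (fun i : Iio a.len => (a.seq i).1) l
      (ext s) (fun i : Iio a.len => i.1) := by
  have hb : ∀ f : Iio α → Iio D.κ.ord, psup (range fun i => (f i).1) < D.κ.ord := by
    intro f
    obtain ⟨θ, hθ, h1⟩ := exists_bound_of_mk_lt H.inacc.isRegular (f := fun i => (f i).1) (by
        refine Cardinal.mk_range_le.trans_lt ?_
        rw [Cardinal.mk_Iio_ordinal, Cardinal.lift_lt]
        exact Cardinal.lt_ord.1 hα) fun i => (f i).2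
    refine lt_of_le_of_lt (csSup_le' ?_) hθ
    rintro _ ⟨_, ⟨i, rfl⟩, rfl⟩
    exact Order.succ_le_of_lt (h1 i)
  by_cases hne : ∃ ξ, ext s ξ ≠ 0
  · obtain ⟨x, hx, hr, h1, h2, h3⟩ := exists_genNode H hs hne hα
    have h3' : ∀ i : Iio α, ∃ ξ, (ξ, i.1) ∈ D.p x := fun i => h3 i.1 i.2
    choose f hf using h3'
    have hfκ : ∀ i, f i < D.κ.ord := fun i => (p_bound H hx (hf i)).1.trans
      (bethOrd_lt_kappa H _ (ord_lt_of_mem_T (U_subset_T H hx)))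
    refine ⟨⟨α, hα, fun i => ⟨f i, hfκ i⟩, fun i j hij => ?_, hb _⟩, rfl, [x], ?_⟩
    · have hij' : f i = f j := congrArg (fun z : Iio D.κ.ord => z.1) hij
      have h4 := hf j
      rw [← hij'] at h4
      exact Subtype.ext ((pInj_p H hx).1 _ _ _ (hf i) h4)
    · refine .single hx hr hf (by rw [h1]; exact .refl) (.of_lt h2 fun j => ?_)
      exact (p_bound H hx (hf j)).2
  · push Not at hne
    refine ⟨⟨α, hα, fun i => ⟨i.1, i.2.trans hα⟩, fun i j hij => ?_, hb _⟩, rfl, [], .nil ?_⟩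
    · exact Subtype.ext (congrArg (fun z : Iio D.κ.ord => z.1) hij)
    · exact fun j ξ _ => (hne ξ).symm

/-- An isomorphism of `M_s` and `M_t` preserves the existence of chains from the zero function. By
`exists_source` it yields chains from `s` to `t` which map initial segments of `κ` to their images
under the isomorphism. -/
theorem equiv_of_isomorphic (H : D.Admissible) (hs : steady s = s)
    (h : (D.modelOf s).Isomorphic (D.modelOf t)) : D.Equiv s t := by
  classical
  obtain ⟨f, hf⟩ := h
  have hlim := isSuccLimit_ord_of_inaccessible H.inacc
  -- initial segments of `κ` are connected with their images
  have hseg : ∀ α (hα : α < D.κ.ord), ∃ l, D.Conn (ext s) (fun i : Iio α => i.1) l (ext t)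
      (fun i : Iio α => (f ⟨i.1, i.2.trans hα⟩).1) := by
    intro α hα
    obtain ⟨a, rfl, l, hl⟩ := exists_source H hs hα
    let b : a.arity → Iio D.κ.ord := fun i : Iio a.len => ⟨i.1, i.2.trans hα⟩
    have h1 : b ∈ D.relOf s a := (mem_relOf_iff H).2 ⟨l, hl⟩
    obtain ⟨l', hl'⟩ := (mem_relOf_iff H).1 ((hf a b).1 h1)
    exact ⟨_, (hl.inv H).append hl'⟩
  have hrestr : ∀ {α} (hα : α < D.κ.ord) (l), D.Conn (ext s) (fun i : Iio α => i.1) l (ext t)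
      (fun i : Iio α => (f ⟨i.1, i.2.trans hα⟩).1) → ∀ W : Finset (Iio D.κ.ord),
      (∀ i : W, i.1.1 < α) →
      D.Conn (ext s) (fun i : W => i.1.1) l (ext t) (fun i : W => (f i.1).1) :=
    fun hα _ hl W hW => hl.restrict fun i : W => (⟨i.1.1, hW i⟩ : Iio _)
  -- the lengths of the chains are bounded, since `κ` has uncountable cofinality
  obtain ⟨n, hn⟩ : ∃ n : ℕ, ∀ W : Finset (Iio D.κ.ord), ∃ l, l.length ≤ n ∧
      D.Conn (ext s) (fun i : W => i.1.1) l (ext t) (fun i : W => (f i.1).1) := by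
    by_contra! hcon
    choose W hW using hcon
    have hb : ∀ n, ∃ α < D.κ.ord, ∀ i : W n, i.1.1 < α := fun n =>
      exists_bound_of_finite H.inacc.isRegular fun i => i.1.2
    choose α hα hWα using hb
    obtain ⟨θ, hθ, h1⟩ := exists_bound_of_mk_lt H.inacc.isRegular (f := α) (by
      refine (countable_range α).le_aleph0.trans_lt ?_
      rw [← Cardinal.lift_aleph0.{u + 1, u}, Cardinal.lift_lt]
      exact H.inacc.aleph0_lt) hα
    obtain ⟨l, hl⟩ := hseg θ hθ
    exact hW l.length l le_rfl (hrestr hθ l hl _ fun i => (hWα _ i).trans (h1 _))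
  exact equiv_of_finite_chains H n s t (fun i => i.1) (fun i => (f i).1)
    (fun i j hij => Subtype.ext hij) (fun i => i.2) hn

theorem equiv_iff_isomorphic (H : D.Admissible) (s t : Fun2 D.κ) :
    D.Equiv s t ↔ (D.model s).Isomorphic (D.model t) := by
  refine ⟨isomorphic_of_equiv H, fun h => ?_⟩
  have hss : ∀ s : Fun2 D.κ, D.Equiv (steady s) s := fun s =>
    H.beth _ _ fun α hα => ext_steady_bethOrd H.inacc s hα
  have := equiv_of_isomorphic H (steady_steady H s) h
  exact H.equiv.2.trans (H.equiv.2.symm (hss s)) (H.equiv.2.trans this (hss t))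

end Data

end SigmaModels

end

theorem mainTheorem5 (D : SigmaModels.Data.{u})
    (hκ : D.κ.IsInaccessible)
    (hlam : D.lam.IsRegular) (hlamκ : D.lam < D.κ)
    (hφ : D.DefinesEquivalence)
    (hsymm : D.Symmetric)
    (hbeth : D.BethInvariant)
    (hwit : D.WitnessBethInvariant)
    (hbk : D.IsBookkeeping)
    (hwo : D.IsLevelOrder)
    (henum : D.IsEnumeration) :
    ∀ s t : SigmaModels.Fun2 D.κ,
      D.Equiv s t ↔ (D.model s).Isomorphic (D.model t) :=
  fun s t => SigmaModels.Data.equiv_iff_isomorphic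
    ⟨hκ, hlam, hlamκ, hφ, hsymm, hbeth, hwit, hbk, hwo, henum⟩ s t
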